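/- Let $M$ be a real symmetric positive definite $2\times 2$ matrix (in the application, the Hessian of the potential well at its minimum). On $L^2(\mathbb R^2)$ let $X=(X_1,X_2)$ be the position operator, $X^\perp=(-X_2,X_1)$, $P=-\mathrm i\nabla$, and for $b>0$, $\lambda>0$ let $$h_\lambda^{\rm MHO}=\Bigl(P-\tfrac12 b\lambda X^\perp\Bigr)^2+\tfrac12\lambda^2\langle X,MX\rangle ,$$ the self-adjoint anisotropic magnetic harmonic oscillator (essentially self-adjoint on Schwartz functions). Let $e_0\le e_1\le\cdots$ be the eigenvalues of $h_1^{\rm MHO}$, counted with multiplicity (they depend on $M$ and $b$). For $\xi\in\mathbb C$ with $|\xi|=1$ put $$\mu=e_0+\tfrac12(e_1-e_0)\xi,\qquad z_\lambda=-\lambda^2+\mu\lambda ,$$ and for $\Lambda>0$, $\varepsilon\in(0,\frac\pi2)$ let $\Omega_{\Lambda,\varepsilon}=\{z\in\mathbb C:\ |z|>\Lambda,\ |\arg z|<\frac\pi2-\varepsilon\}$. **Proposition.** For every $\varepsilon\in(0,\frac\pi2)$ there are $\Lambda_0>0$, $b_{\max}>0$ and constants $C,c>0$, depending only on $M$ and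 $\varepsilon$, such that the following holds for all $\Lambda\ge\Lambda_0$, all $b\in(0,b_{\max})$ and all $\xi$ with $|\xi|=1$, both for the spectral parameter $\zeta_\lambda=z_\lambda$ and for the spectral parameter $\zeta_\lambda=z_\lambda+\lambda^2=\mu\lambda$. 1. For real $\lambda>\Lambda$, every eigenvalue $E$ of $h_\lambda^{\rm MHO}$ satisfies $|\zeta_\lambda-E|\ge c\lambda$. 2. There is an analytic map $r:\Omega_{\Lambda,\varepsilon}\to\mathcal B(L^2(\mathbb R^2))$ with $r_\lambda=(h_\lambda^{\rm MHO}-\zeta_\lambda\mathbb 1)^{-1}$ for all real $\lambda>\Lambda$. 3. $\|r_\lambda\|\le C|\lambda|^{-1}$ for all $\lambda\in\Omega_{\Lambda,\varepsilon}$. 4. For all $\lambda\in\Omega_{\Lambda,\varepsilon}$ and $j=1,2$, the range of $r_\lambda$ is contained in the domain of $P_j$ and $P_jr_\lambda$ is a bounded operator; moreover, for $\alpha=0,1$ and all measurable non-empty $S,T\subseteq\mathbb R^2$ with $\mathrm{dist}(S,T)>|\lambda|^{-1/2}$, $$\bigl\|\chi_S(X)\,P_j^\alpha\, r_\lambda\,\chi_T(X)\bigr\|\le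 C\exp\bigl(-c\,|\lambda|\,\mathrm{dist}(S,T)^2\bigr).$$ -/

import Mathlib

open MeasureTheory Set
open scoped SchwartzMap LineDeriv

/-- The Euclidean plane. -/
abbrev Plane : Type := EuclideanSpace ℝ (Fin 2)

/-- The complex Hilbert space `L²(ℝ²)`. -/
abbrev L2Plane : Type := Lp ℂ 2 (volume : Measure Plane)

/-- Linear operators on the Schwartz space `𝓢(ℝ²)`. -/
abbrev SchwartzOp : Type := 𝓢(Plane, ℂ) →L[ℂ] 𝓢(Plane, ℂ)

noncomputable section

namespace MHO

/-! ### The operators on Schwartz functions -/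

/-- The position operator `X_j`: multiplication by the coordinate `x_j`. -/
def position (j : Fin 2) : SchwartzOp :=
  SchwartzMap.smulLeftCLM ℂ (fun x : Plane => ((x j : ℝ) : ℂ))

/-- The momentum operator `P_j = -i ∂_j`. -/
def momentum (j : Fin 2) : SchwartzOp :=
  (-Complex.I) • LineDeriv.lineDerivOpCLM ℂ 𝓢(Plane, ℂ) (EuclideanSpace.single j (1 : ℝ) : Plane)

/-- The components of `X^⊥ = (-X_2, X_1)` (the coordinates are numbered `0, 1` here). -/
def positionPerp : Fin 2 → SchwartzOp := ![-position 1, position 0]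

/-- The anisotropic magnetic harmonic oscillator
`(P - ½ b l X^⊥)² + ½ l² ⟨X, M X⟩` as an operator on Schwartz functions. -/
def oscillator (M : Matrix (Fin 2) (Fin 2) ℝ) (b l : ℝ) : SchwartzOp :=
  (∑ j : Fin 2, (momentum j - ((1 / 2 * b * l : ℝ) : ℂ) • positionPerp j) ∘L
      (momentum j - ((1 / 2 * b * l : ℝ) : ℂ) • positionPerp j)) +
    ((1 / 2 * l ^ 2 : ℝ) : ℂ) •
      ∑ j : Fin 2, ∑ k : Fin 2, ((M j k : ℝ) : ℂ) • (position j ∘L position k)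

theorem position_apply (j : Fin 2) (φ : 𝓢(Plane, ℂ)) (x : Plane) :
    position j φ x = ((x j : ℝ) : ℂ) * φ x := by
  have h : (fun x : Plane => ((x j : ℝ) : ℂ)).HasTemperateGrowth :=
    (Complex.ofRealCLM.comp (EuclideanSpace.proj j : Plane →L[ℝ] ℝ)).hasTemperateGrowth
  simpa [position] using SchwartzMap.smulLeftCLM_apply_apply h φ x

theorem momentum_apply (j : Fin 2) (φ : 𝓢(Plane, ℂ)) (x : Plane) :
    momentum j φ x = -Complex.I * fderiv ℝ φ x (EuclideanSpace.single j (1 : ℝ)) := by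
  simp [momentum, SchwartzMap.lineDerivOp_apply_eq_fderiv]

/-! ### Realization as (unbounded) operators on `L²(ℝ²)` -/

/-- For a symmetric operator `A` on Schwartz functions, `Acts A u g` says that `u ∈ L²` lies in
the domain of the operator that `A` defines on `L²(ℝ²)` and is mapped to `g ∈ L²` by it. The
domain is the maximal one: `A u`, computed in the sense of distributions, has to be in `L²`.
For `A = oscillator M b l`, which is essentially self-adjoint on Schwartz functions, this is the
graph of its unique self-adjoint extension; for `A = momentum j` it is the graph of `-i ∂_j` with
the weak derivative. -/
def Acts (A : SchwartzOp) (u g : L2Plane) : Prop :=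
  ∀ φ : 𝓢(Plane, ℂ), inner ℂ ((A φ).toLp 2 volume) u = inner ℂ (φ.toLp 2 volume) g

/-- The bounded operator `R` is the resolvent `(A - z)⁻¹`: `R` maps into the domain of `A` with
`(A - z) R f = f` for all `f`, and `R (A - z) u = u` for all `u` in the domain of `A`. -/
def IsResolvent (A : SchwartzOp) (z : ℂ) (R : L2Plane →L[ℂ] L2Plane) : Prop :=
  (∀ f : L2Plane, Acts A (R f) (z • R f + f)) ∧
    ∀ u g : L2Plane, Acts A u g → R (g - z • u) = u

/-- `u` is an eigenvector of `A` with the real eigenvalue `E`. -/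
def IsEigenvector (A : SchwartzOp) (E : ℝ) (u : L2Plane) : Prop :=
  u ≠ 0 ∧ Acts A u ((E : ℂ) • u)

/-- The `j`-th eigenvalue (`j = 0, 1, 2, …`) of `h₁` in ascending order, counted with
multiplicity: the least `t` such that there are `j + 1` linearly independent eigenvectors with
eigenvalues at most `t`. -/
def eigenvalue (M : Matrix (Fin 2) (Fin 2) ℝ) (b : ℝ) (j : ℕ) : ℝ :=
  sInf {t : ℝ | ∃ v : Fin (j + 1) → L2Plane, LinearIndependent ℂ v ∧
    ∀ i, ∃ E : ℝ, E ≤ t ∧ IsEigenvector (oscillator M b 1) E (v i)}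

/-- `μ = e₀ + ½ (e₁ - e₀) ξ`. -/
def mu (M : Matrix (Fin 2) (Fin 2) ℝ) (b : ℝ) (ξ : ℂ) : ℂ :=
  (eigenvalue M b 0 : ℂ) + 1 / 2 * ((eigenvalue M b 1 : ℂ) - (eigenvalue M b 0 : ℂ)) * ξ

/-- The spectral parameter `z_l = -l² + μ l`. -/
def zParam (M : Matrix (Fin 2) (Fin 2) ℝ) (b : ℝ) (ξ l : ℂ) : ℂ :=
  -l ^ 2 + mu M b ξ * l

/-- The truncated wedge `{z : |z| > L, |arg z| < π/2 - ε}`. -/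
def wedge (L ε : ℝ) : Set ℂ :=
  {z : ℂ | L < ‖z‖ ∧ |Complex.arg z| < Real.pi / 2 - ε}

/-! ### Cut-offs and distances -/

/-- The `L²` function `χ_S f`. -/
def cutoffFun (S : Set Plane) (hS : MeasurableSet S) (f : L2Plane) : L2Plane :=
  ((Lp.memLp f).indicator hS).toLp (S.indicator (f : Plane → ℂ))

theorem cutoffFun_coe (S : Set Plane) (hS : MeasurableSet S) (f : L2Plane) :
    (cutoffFun S hS f : Plane → ℂ) =ᵐ[volume] S.indicator (f : Plane → ℂ) := by
  unfold cutoffFun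
  exact MemLp.coeFn_toLp _

theorem cutoffFun_add (S : Set Plane) (hS : MeasurableSet S) (f g : L2Plane) :
    cutoffFun S hS (f + g) = cutoffFun S hS f + cutoffFun S hS g := by
  apply Lp.ext
  filter_upwards [cutoffFun_coe S hS (f + g), cutoffFun_coe S hS f, cutoffFun_coe S hS g,
    Lp.coeFn_add f g, Lp.coeFn_add (cutoffFun S hS f) (cutoffFun S hS g)] with x h1 h2 h3 h4 h5
  rw [h1, h5, Pi.add_apply, h2, h3]
  by_cases h : x ∈ S
  · simp only [Set.indicator_of_mem h]
    rw [h4, Pi.add_apply]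
  · simp only [Set.indicator_of_notMem h, add_zero]

theorem cutoffFun_smul (S : Set Plane) (hS : MeasurableSet S) (a : ℂ) (f : L2Plane) :
    cutoffFun S hS (a • f) = a • cutoffFun S hS f := by
  apply Lp.ext
  filter_upwards [cutoffFun_coe S hS (a • f), cutoffFun_coe S hS f,
    Lp.coeFn_smul a f, Lp.coeFn_smul a (cutoffFun S hS f)] with x h1 h2 h4 h5
  rw [h1, h5, Pi.smul_apply, h2]
  by_cases h : x ∈ S
  · simp only [Set.indicator_of_mem h]
    rw [h4, Pi.smul_apply]
  · simp only [Set.indicator_of_notMem h, smul_zero]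

theorem norm_cutoffFun_le (S : Set Plane) (hS : MeasurableSet S) (f : L2Plane) :
    ‖cutoffFun S hS f‖ ≤ ‖f‖ := by
  refine Lp.norm_le_norm_of_ae_le ?_
  filter_upwards [cutoffFun_coe S hS f] with x hx
  rw [hx]
  exact norm_indicator_le_norm_self _ _

/-- `χ_S(X)`: multiplication by the indicator function of the measurable set `S`, as a bounded
operator. -/
def cutoff (S : Set Plane) (hS : MeasurableSet S) : L2Plane →L[ℂ] L2Plane :=
  LinearMap.mkContinuous
    { toFun := cutoffFun S hS
      map_add' := cutoffFun_add S hS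
      map_smul' := cutoffFun_smul S hS }
    1 (fun f => by simpa using norm_cutoffFun_le S hS f)

/-- `dist(S, T) = inf {|s - t| : s ∈ S, t ∈ T}` for non-empty `S`, `T`. (If `S` or `T` is empty
the value is `0`; then `χ_S(X)` or `χ_T(X)` is zero.) -/
def setDist (S T : Set Plane) : ℝ :=
  ⨅ p : S × T, dist (p.1 : Plane) (p.2 : Plane)

end MHO

end

/-! Rotate into an eigenframe of `M` and rescale lengths by `√‖l‖`. For `b = 0` the oscillator then
becomes `l` times `κ̄ p² + κ y²` with `κ = l / ‖l‖` (`hamS_zero_eq_harm`), where the commutation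
relations of `p` and `y` no longer depend on `l`. On the wedge `Re κ ≥ sin ε`, so everything reduces
to estimates for this complex-scaled harmonic oscillator that are uniform in `κ`.

Coercivity of the form settles only `Re ζ ≤ 0`, while `μ` sits between the two lowest eigenvalues.
The gap is bridged by ladder operators: an annihilation operator intertwines the equation at `ζ`
with the equation at `ζ - 2 s_j` (`annih_harm`), and the number operator together with the
zero-point energy recovers `w` from its annihilated parts (`creat_annih`). Stability between the
form domain and its dual thus climbs from `Re ζ ≤ 0` to any bounded height in finitely many steps
(`norm_le_of_isStable`, then `isStable_of_norm_le` by duality; together `exists_isStable`). Combined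
with elliptic regularity (`norm2_le`) this gives `exists_norm2_le`: all monomials of degree at most
two are controlled by the right-hand side, and the estimate tolerates relatively small errors. The
magnetic terms are such an error for small `b` (`norm_hamS_sub_le`), whence `exists_estimate`.

Density of the range and the explicit values of `e₀` and `e₁` come from an exact ladder. The ground
state is a complex Gaussian; on polynomials in the two modes times this Gaussian the Hamiltonian is
triangular, with the levels `l (e + 2 m ω₀ + 2 n ω₁)` on the diagonal (`ham_excitation`). These
functions are total in `L²` (`eq_zero_of_orthogonal`), so a vector orthogonal to the range off the
levels vanishes. At `l = 1` the same argument identifies the two lowest eigenvalues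
(`eigenvalue_eq`).

The resolvent is the bounded extension of the inverse from the dense range. It is analytic because
the shifted oscillators at nearby `l` differ by a factor that is analytic in `l` and invertible
(`analyticAt_resolventOp`). Off-diagonal decay is a weighted estimate: if `|∇g| ≤ δ ‖l‖ |x| g`, and
similarly for second derivatives, then the commutator with `g` is a small relative error that the a
priori estimate absorbs (`size_wOp_le`). An exponential weight of slope about `δ ‖l‖ dist(S, T)`
would violate this near the origin, but one of `S`, `T` lies at distance at least `dist(S, T) / 2`
from the origin, so the weight can be taken constant near the origin (`exists_separating_weight`).
-/

noncomputable section

namespace MHO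

/-! ### Canonical commutation relations and elliptic regularity -/

section CCR

variable {E H : Type*} [AddCommGroup E] [Module ℂ E] [NormedAddCommGroup H] [InnerProductSpace ℂ H]

/-- Two degrees of freedom on a dense domain `E` of `H`: symmetric operators `p j`, `y j` with the
canonical commutation relations `[p j, y k] = -i s j δ_{jk}`. -/
structure IsCCR (ι : E →ₗ[ℂ] H) (s : Fin 2 → ℝ) (p y : Fin 2 → E →ₗ[ℂ] E) : Prop where
  p_symm : ∀ j v w, inner ℂ (ι (p j v)) (ι w) = inner ℂ (ι v) (ι (p j w))
  y_symm : ∀ j v w, inner ℂ (ι (y j v)) (ι w) = inner ℂ (ι v) (ι (y j w))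
  p_comm : ∀ i j v, p i (p j v) = p j (p i v)
  y_comm : ∀ i j v, y i (y j v) = y j (y i v)
  comm_self : ∀ j v, p j (y j v) = y j (p j v) - (Complex.I * (s j : ℂ)) • v
  comm_ne : ∀ i j, i ≠ j → ∀ v, p i (y j v) = y j (p i v)

/-- `a₀² + a₁²`. -/
def sumSq (a : Fin 2 → E →ₗ[ℂ] E) : E →ₗ[ℂ] E := a 0 ∘ₗ a 0 + a 1 ∘ₗ a 1

/-- The complex-scaled harmonic oscillator `κ̄ p² + κ y²`. -/
def harm (p y : Fin 2 → E →ₗ[ℂ] E) (κ : ℂ) : E →ₗ[ℂ] E :=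
  (starRingEnd ℂ κ) • sumSq p + κ • sumSq y

/-- The squared form norm. -/
def formSq (ι : E →ₗ[ℂ] H) (p y : Fin 2 → E →ₗ[ℂ] E) (w : E) : ℝ :=
  ‖ι (p 0 w)‖ ^ 2 + ‖ι (p 1 w)‖ ^ 2 + (‖ι (y 0 w)‖ ^ 2 + ‖ι (y 1 w)‖ ^ 2)

/-- The norm of the domain of the harmonic oscillator: all monomials of degree at most two. -/
def norm2 (ι : E →ₗ[ℂ] H) (p y : Fin 2 → E →ₗ[ℂ] E) (w : E) : ℝ :=
  ‖ι w‖ + ∑ j, (‖ι (p j w)‖ + ‖ι (y j w)‖) +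
    ∑ i, ∑ j, (‖ι (p i (p j w))‖ + ‖ι (y i (p j w))‖ + ‖ι (y i (y j w))‖)

variable {ι : E →ₗ[ℂ] H} {s : Fin 2 → ℝ} {p y : Fin 2 → E →ₗ[ℂ] E}

theorem formSq_nonneg (w : E) : 0 ≤ formSq ι p y w := by unfold formSq; positivity

theorem norm2_nonneg (w : E) : 0 ≤ norm2 ι p y w := by unfold norm2; positivity

/-- By symmetry and commutativity the cross term `⟨a₀² w, a₁² w⟩` equals `‖a₀ a₁ w‖²`. Hence `sumSq
a` alone controls every second-order monomial in `a`. -/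
theorem norm_sumSq_sq {a : Fin 2 → E →ₗ[ℂ] E}
    (hs : ∀ j v w, inner ℂ (ι (a j v)) (ι w) = inner ℂ (ι v) (ι (a j w)))
    (hc : ∀ i j v, a i (a j v) = a j (a i v)) (w : E) :
    ‖ι (sumSq a w)‖ ^ 2 =
      ‖ι (a 0 (a 0 w))‖ ^ 2 + 2 * ‖ι (a 0 (a 1 w))‖ ^ 2 + ‖ι (a 1 (a 1 w))‖ ^ 2 := by
  have e : inner ℂ (ι (a 0 (a 0 w))) (ι (a 1 (a 1 w))) = ((‖ι (a 0 (a 1 w))‖ ^ 2 : ℝ) : ℂ) := by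
    rw [hs, hc 0 1, ← hs, hc 1 0 w, inner_self_eq_norm_sq_to_K]; simp
  simp only [sumSq, LinearMap.add_apply, LinearMap.comp_apply, map_add]
  rw [@norm_add_sq ℂ, e]
  simp only [Complex.ofReal_pow]
  norm_cast

theorem inner_sumSq {a : Fin 2 → E →ₗ[ℂ] E}
    (hs : ∀ j v w, inner ℂ (ι (a j v)) (ι w) = inner ℂ (ι v) (ι (a j w))) (w : E) :
    inner ℂ (ι w) (ι (sumSq a w)) = ((‖ι (a 0 w)‖ ^ 2 + ‖ι (a 1 w)‖ ^ 2 : ℝ) : ℂ) := by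
  simp only [sumSq, LinearMap.add_apply, LinearMap.comp_apply, map_add, inner_add_right]
  rw [← hs 0 w, ← hs 1 w, inner_self_eq_norm_sq_to_K, inner_self_eq_norm_sq_to_K]
  simp

theorem sumSq_symm {a : Fin 2 → E →ₗ[ℂ] E}
    (hs : ∀ j v w, inner ℂ (ι (a j v)) (ι w) = inner ℂ (ι v) (ι (a j w))) (v w : E) :
    inner ℂ (ι (sumSq a v)) (ι w) = inner ℂ (ι v) (ι (sumSq a w)) := by
  simp only [sumSq, LinearMap.add_apply, LinearMap.comp_apply, map_add, inner_add_right,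
    inner_add_left, hs]

namespace IsCCR

variable (h : IsCCR ι s p y)
include h

/-- For non-real `κ` the operator is not symmetric; its formal adjoint is the one with `κ`
conjugated. This is why estimates are carried along for a pair and its conjugate. -/
theorem harm_adjoint (κ ζ : ℂ) (v w : E) :
    inner ℂ (ι (harm p y (starRingEnd ℂ κ) v - (starRingEnd ℂ ζ) • v)) (ι w) =
      inner ℂ (ι v) (ι (harm p y κ w - ζ • w)) := by
  simp only [harm, LinearMap.add_apply, LinearMap.smul_apply, map_add, map_sub, map_smul,
    inner_add_left, inner_sub_left, inner_smul_left, inner_add_right, inner_sub_right,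
    inner_smul_right, Complex.conj_conj, sumSq_symm h.p_symm, sumSq_symm h.y_symm]

/-- `κ` and its conjugate share their real part, so the real part of the form sees momenta and
positions alike. This is the source of coercivity for `Re κ > 0`. -/
theorem re_inner_harm (κ ζ : ℂ) (w : E) :
    (inner ℂ (ι w) (ι (harm p y κ w - ζ • w))).re =
      κ.re * formSq ι p y w - ζ.re * ‖ι w‖ ^ 2 := by
  simp only [harm, LinearMap.add_apply, LinearMap.smul_apply, map_add, map_sub, map_smul,
    inner_add_right, inner_sub_right, inner_smul_right, inner_sumSq h.p_symm,
    inner_sumSq h.y_symm, formSq]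
  rw [inner_self_eq_norm_sq_to_K]
  simp only [Complex.sub_re, Complex.add_re, Complex.re_mul_ofReal, Complex.conj_re]
  have : (ζ * ((‖ι w‖ : ℂ)) ^ 2).re = ζ.re * ‖ι w‖ ^ 2 := by
    rw [← Complex.ofReal_pow, Complex.re_mul_ofReal]
  erw [this]
  ring

theorem im_inner_py (j : Fin 2) (w : E) :
    2 * (inner ℂ (ι (p j w)) (ι (y j w))).im = - s j * ‖ι w‖ ^ 2 := by
  have h1 : inner ℂ (ι (p j w)) (ι (y j w)) =
      inner ℂ (ι (y j w)) (ι (p j w)) - Complex.I * s j * (‖ι w‖ : ℂ) ^ 2 := by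
    rw [h.p_symm, h.comm_self, map_sub, map_smul, inner_sub_right, inner_smul_right, h.y_symm,
      inner_self_eq_norm_sq_to_K]
    rfl
  have h2 : (inner ℂ (ι (y j w)) (ι (p j w))).im = - (inner ℂ (ι (p j w)) (ι (y j w))).im := by
    rw [← inner_conj_symm, Complex.conj_im]
  have h3 := congrArg Complex.im h1
  rw [Complex.sub_im, h2] at h3
  have h4 : (Complex.I * s j * (‖ι w‖ : ℂ) ^ 2).im = s j * ‖ι w‖ ^ 2 := by
    rw [mul_assoc, Complex.I_mul_im, ← Complex.ofReal_pow, ← Complex.ofReal_mul,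
      Complex.ofReal_re]
  rw [h4] at h3
  linarith

/-- The uncertainty inequality: the commutator fixes the imaginary part of `⟨p w, y w⟩`, and
Cauchy–Schwarz bounds it. -/
theorem mul_norm_sq_le (j : Fin 2) (w : E) :
    s j * ‖ι w‖ ^ 2 ≤ ‖ι (p j w)‖ ^ 2 + ‖ι (y j w)‖ ^ 2 := by
  have h1 := h.im_inner_py j w
  have h2 : |(inner ℂ (ι (p j w)) (ι (y j w))).im| ≤ ‖ι (p j w)‖ * ‖ι (y j w)‖ :=
    (Complex.abs_im_le_norm _).trans (norm_inner_le_norm _ _)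
  have h3 := neg_abs_le (inner ℂ (ι (p j w)) (ι (y j w))).im
  nlinarith [sq_nonneg (‖ι (p j w)‖ - ‖ι (y j w)‖)]

theorem mul_norm_sq_le_formSq (w : E) : (s 0 + s 1) * ‖ι w‖ ^ 2 ≤ formSq ι p y w := by
  have h1 := h.mul_norm_sq_le 0 w
  have h2 := h.mul_norm_sq_le 1 w
  unfold formSq
  linarith

/-- Moving one factor of each square across gives a nonnegative main term; the commutators only
leave terms of the order of the form. The sign of the main term limits the cancellation between `κ̄
p²` and `κ y²`. -/
theorem inner_kin_pot_sub (w : E) :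
    inner ℂ (ι (sumSq p w)) (ι (sumSq y w)) =
      ((‖ι (y 0 (p 0 w))‖ ^ 2 + ‖ι (y 0 (p 1 w))‖ ^ 2 + ‖ι (y 1 (p 0 w))‖ ^ 2 +
        ‖ι (y 1 (p 1 w))‖ ^ 2 : ℝ) : ℂ) -
      2 * Complex.I * (s 0 * inner ℂ (ι (p 0 w)) (ι (y 0 w)) +
        s 1 * inner ℂ (ι (p 1 w)) (ι (y 1 w))) := by
  have hd : ∀ j, inner ℂ (ι (p j (p j w))) (ι (y j (y j w))) = ((‖ι (y j (p j w))‖ ^ 2 : ℝ) : ℂ) -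
      2 * Complex.I * (s j * inner ℂ (ι (p j w)) (ι (y j w))) := by
    intro j
    rw [h.p_symm, h.comm_self, h.comm_self]
    simp only [map_sub, map_smul, inner_sub_right, inner_smul_right]
    rw [← h.y_symm, inner_self_eq_norm_sq_to_K]
    simp only [Complex.ofReal_pow, Complex.coe_algebraMap]
    ring
  have ho : ∀ i j, i ≠ j →
      inner ℂ (ι (p i (p i w))) (ι (y j (y j w))) = ((‖ι (y j (p i w))‖ ^ 2 : ℝ) : ℂ) := by
    intro i j hij
    rw [h.p_symm, h.comm_ne i j hij, h.comm_ne i j hij, ← h.y_symm, inner_self_eq_norm_sq_to_K]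
    simp
  simp only [sumSq, LinearMap.add_apply, LinearMap.comp_apply, map_add, inner_add_right,
    inner_add_left]
  rw [hd, hd, ho 0 1 (by simp), ho 1 0 (by simp)]
  push_cast
  ring

theorem formSq_le (w : E) :
    formSq ι p y w ≤ ‖ι w‖ * (‖ι (sumSq p w)‖ + ‖ι (sumSq y w)‖) := by
  have h1 := congrArg Complex.re (inner_sumSq h.p_symm w)
  have h2 := congrArg Complex.re (inner_sumSq h.y_symm w)
  rw [Complex.ofReal_re] at h1 h2
  have h3 := (Complex.re_le_norm _).trans (norm_inner_le_norm (𝕜 := ℂ) (ι w) (ι (sumSq p w)))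
  have h4 := (Complex.re_le_norm _).trans (norm_inner_le_norm (𝕜 := ℂ) (ι w) (ι (sumSq y w)))
  unfold formSq
  linarith

end IsCCR

/-- The ground state energy and its excitations for `b = 0`. -/
def level (s : Fin 2 → ℝ) (m n : ℕ) : ℝ := s 0 + s 1 + 2 * m * s 0 + 2 * n * s 1

end CCR

section CCR

variable {E H : Type*} [AddCommGroup E] [Module ℂ E] [NormedAddCommGroup H] [InnerProductSpace ℂ H]
variable {ι : E →ₗ[ℂ] H} {s : Fin 2 → ℝ} {p y : Fin 2 → E →ₗ[ℂ] E}

/-- Absorption: the term linear in `X` loses against the quadratic one unless `X` is already of the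
order of `a + n`. -/
theorem le_mul_add_of_sq_le {X a n c S : ℝ} (hX : 0 ≤ X) (ha : 0 ≤ a) (hn : 0 ≤ n) (hc : 0 < c)
    (hS : 0 ≤ S) (h : c ^ 2 * (X ^ 2 / 2) ≤ a ^ 2 + 4 * S * n * X) :
    X ≤ (2 / c + 8 * S / c ^ 2) * (a + n) := by
  have h1 : (c * X) ^ 2 ≤ 2 * a ^ 2 + 8 * S * n * X := by nlinarith
  have h2 : c ^ 2 * X ≤ 2 * c * a + 8 * S * n := by
    by_contra! hlt
    have h3 : 0 < X := by
      rcases hX.lt_or_eq with h | h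
      · exact h
      · exfalso
        rw [← h] at hlt
        have : 0 ≤ 2 * c * a + 8 * S * n := by positivity
        linarith
    have h4 : 2 * a ≤ c * X := by
      have : 2 * c * a ≤ c * (c * X) := by nlinarith [mul_nonneg hS hn]
      by_contra! h5
      nlinarith
    nlinarith
  have h3 : X ≤ (2 * c * a + 8 * S * n) / c ^ 2 := by
    rw [le_div_iff₀ (by positivity)]; linarith
  have h4 : (2 / c + 8 * S / c ^ 2) * (a + n) =
      (2 * c * a + 8 * S * n) / c ^ 2 + (2 / c * n + 8 * S / c ^ 2 * a) := by
    field_simp; ring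
  have : 0 ≤ 2 / c * n + 8 * S / c ^ 2 * a := by positivity
  linarith

theorem two_mul_sq_sub_one_le_re_sq {c : ℝ} {κ : ℂ} (hc : 0 < c) (hκ : ‖κ‖ = 1) (h : c ≤ κ.re) :
    2 * c ^ 2 - 1 ≤ (κ ^ 2).re := by
  have h1 : κ.re * κ.re + κ.im * κ.im = 1 := by
    rw [← Complex.normSq_apply, Complex.normSq_eq_norm_sq, hκ, one_pow]
  have h2 : c ^ 2 ≤ κ.re ^ 2 := pow_le_pow_left₀ hc.le h 2
  rw [sq κ, Complex.mul_re]
  linarith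

namespace IsCCR

set_option maxHeartbeats 1000000 in
/-- Elliptic regularity: `harm` controls all monomials of degree at most two. -/
theorem norm2_le {c₀ : ℝ} (hc₀ : 0 < c₀) (hs : ∀ j, 0 < s j) :
    ∃ C : ℝ, 0 < C ∧ ∀ p y : Fin 2 → E →ₗ[ℂ] E, IsCCR ι s p y → ∀ κ : ℂ, ‖κ‖ = 1 → c₀ ≤ κ.re →
      ∀ w, norm2 ι p y w ≤ C * (‖ι (harm p y κ w)‖ + ‖ι w‖) := by
  set S := s 0 + s 1 with hSdef
  have hs0 := hs 0
  have hs1 := hs 1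
  have hS : 0 < S := add_pos hs0 hs1
  set G := 2 / c₀ + 8 * S / c₀ ^ 2 with hG
  have hGpos : 0 < G := by positivity
  refine ⟨5 + 12 * G + 4 * S, by positivity, ?_⟩
  intro p y h κ hκ hre w
  set P := ‖ι (sumSq p w)‖ with hP
  set Q := ‖ι (sumSq y w)‖ with hQ
  set n := ‖ι w‖ with hn
  set a := ‖ι (harm p y κ w)‖ with ha
  set N := ‖ι (y 0 (p 0 w))‖ ^ 2 + ‖ι (y 0 (p 1 w))‖ ^ 2 + ‖ι (y 1 (p 0 w))‖ ^ 2 +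
        ‖ι (y 1 (p 1 w))‖ ^ 2 with hN
  set q := inner ℂ (ι (sumSq p w)) (ι (sumSq y w)) with hq
  have hP0 : 0 ≤ P := norm_nonneg _
  have hQ0 : 0 ≤ Q := norm_nonneg _
  have hn0 : 0 ≤ n := norm_nonneg _
  have ha0 : 0 ≤ a := norm_nonneg _
  have hN0 : 0 ≤ N := by positivity
  have hD : formSq ι p y w ≤ n * (P + Q) := h.formSq_le w
  -- The cross term `q` is the nonnegative number `N` up to lower order; the error is measured by
  -- the form, which interpolates between `n` and `P + Q`.
  have hqN : ‖q - (N : ℂ)‖ ≤ S * (n * (P + Q)) := by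
    rw [hq, h.inner_kin_pot_sub w, sub_sub_cancel_left, norm_neg, norm_mul, norm_mul,
      Complex.norm_I, mul_one, Complex.norm_ofNat]
    have e : ∀ j, ‖(s j : ℂ) * inner ℂ (ι (p j w)) (ι (y j w))‖ ≤
        s j * ((‖ι (p j w)‖ ^ 2 + ‖ι (y j w)‖ ^ 2) / 2) := by
      intro j
      rw [norm_mul, Complex.norm_real, Real.norm_of_nonneg (hs j).le]
      refine mul_le_mul_of_nonneg_left ((norm_inner_le_norm _ _).trans ?_) (hs j).le
      nlinarith [sq_nonneg (‖ι (p j w)‖ - ‖ι (y j w)‖)]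
    have e0 := e 0
    have e1 := e 1
    have e2 := norm_add_le ((s 0 : ℂ) * inner ℂ (ι (p 0 w)) (ι (y 0 w)))
      ((s 1 : ℂ) * inner ℂ (ι (p 1 w)) (ι (y 1 w)))
    have e3 : S * formSq ι p y w ≤ S * (n * (P + Q)) := mul_le_mul_of_nonneg_left hD hS.le
    have e4 : s 0 * (‖ι (p 0 w)‖ ^ 2 + ‖ι (y 0 w)‖ ^ 2) + s 1 * (‖ι (p 1 w)‖ ^ 2 + ‖ι (y 1 w)‖ ^ 2)
        ≤ S * formSq ι p y w := by
      unfold formSq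
      have u0 : 0 ≤ ‖ι (p 0 w)‖ ^ 2 + ‖ι (y 0 w)‖ ^ 2 := by positivity
      have u1 : 0 ≤ ‖ι (p 1 w)‖ ^ 2 + ‖ι (y 1 w)‖ ^ 2 := by positivity
      rw [hSdef]
      linarith [mul_nonneg hs0.le u1, mul_nonneg hs1.le u0]
    linarith
  have hc1 : c₀ ≤ 1 := hre.trans ((Complex.re_le_norm κ).trans hκ.le)
  have hsum : a ^ 2 = P ^ 2 + Q ^ 2 + 2 * (κ ^ 2 * q).re := by
    rw [ha, harm, LinearMap.add_apply, map_add, @norm_add_sq ℂ]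
    simp only [LinearMap.smul_apply, map_smul, norm_smul, inner_smul_left, inner_smul_right,
      Complex.conj_conj, RCLike.norm_conj, hκ, one_mul]
    rw [← hP, ← hQ, ← hq]
    change _ + 2 * (κ * (κ * q)).re + _ = _
    rw [← mul_assoc, ← sq]
    ring
  have hNle : N ≤ P * Q + S * (n * (P + Q)) := by
    have h1 : ‖q‖ ≤ P * Q := norm_inner_le_norm _ _
    have h2 : ‖(N : ℂ)‖ ≤ ‖q‖ + ‖q - N‖ := by
      calc ‖(N : ℂ)‖ = ‖q - (q - N)‖ := by rw [sub_sub_cancel]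
        _ ≤ _ := norm_sub_le _ _
    rw [Complex.norm_real, Real.norm_of_nonneg hN0] at h2
    linarith
  have hkre : 2 * c₀ ^ 2 - 1 ≤ (κ ^ 2).re :=
     two_mul_sq_sub_one_le_re_sq hc₀ hκ hre
  have hreq : (κ ^ 2).re * N - S * (n * (P + Q)) ≤ (κ ^ 2 * q).re := by
    have h1 : (κ ^ 2 * q).re = (κ ^ 2).re * N + (κ ^ 2 * (q - N)).re := by
      rw [mul_sub, Complex.sub_re, Complex.re_mul_ofReal]; ring
    have h2 : |(κ ^ 2 * (q - N)).re| ≤ S * (n * (P + Q)) := by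
      refine (Complex.abs_re_le_norm _).trans ?_
      rw [norm_mul, norm_pow, hκ]
      simpa using hqN
    have := neg_abs_le (κ ^ 2 * (q - N)).re
    linarith
  -- Since `Re κ² ≥ c₀² - 1` and `N ≤ P Q` up to lower order, `a²` dominates `P² + Q² - 2 (1 - c₀²)
  -- P Q = (1 - c₀²) (P - Q)² + c₀² (P² + Q²)`. The last expression is at least `c₀² (P + Q)² / 2`.
  have hmain : c₀ ^ 2 * ((P + Q) ^ 2 / 2) ≤ a ^ 2 + 4 * S * n * (P + Q) := by
    have h1 : -(1 - c₀ ^ 2) * N ≤ (κ ^ 2).re * N := by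
      apply mul_le_mul_of_nonneg_right _ hN0
      nlinarith
    have h2 : (1 - c₀ ^ 2) * N ≤ (1 - c₀ ^ 2) * (P * Q + S * (n * (P + Q))) :=
      mul_le_mul_of_nonneg_left hNle (by nlinarith)
    have h4 : 0 ≤ c₀ ^ 2 * (S * (n * (P + Q))) := by positivity
    have h5 : 0 ≤ c₀ ^ 2 * (P - Q) ^ 2 := by positivity
    have h6 : 0 ≤ (1 - c₀ ^ 2) * (P - Q) ^ 2 :=
      mul_nonneg (by nlinarith) (sq_nonneg _)
    linarith
  have hX : P + Q ≤ G * (a + n) :=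
    le_mul_add_of_sq_le (by positivity) ha0 hn0 hc₀ hS.le hmain
  have hPP := norm_sumSq_sq h.p_symm h.p_comm w
  have hYY := norm_sumSq_sq h.y_symm h.y_comm w
  rw [← hP] at hPP
  rw [← hQ] at hYY
  have hpp : ∀ i j, ‖ι (p i (p j w))‖ ≤ P := by
    intro i j
    refine abs_le_of_sq_le_sq' ?_ hP0 |>.2
    fin_cases i <;> fin_cases j <;> simp only [Fin.zero_eta, Fin.mk_one]
    · linarith [sq_nonneg ‖ι (p 0 (p 1 w))‖, sq_nonneg ‖ι (p 1 (p 1 w))‖]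
    · linarith [sq_nonneg ‖ι (p 0 (p 0 w))‖, sq_nonneg ‖ι (p 1 (p 1 w))‖,
        sq_nonneg ‖ι (p 0 (p 1 w))‖]
    · rw [h.p_comm 1 0]
      linarith [sq_nonneg ‖ι (p 0 (p 0 w))‖, sq_nonneg ‖ι (p 1 (p 1 w))‖,
        sq_nonneg ‖ι (p 0 (p 1 w))‖]
    · linarith [sq_nonneg ‖ι (p 0 (p 1 w))‖, sq_nonneg ‖ι (p 0 (p 0 w))‖]
  have hyy : ∀ i j, ‖ι (y i (y j w))‖ ≤ Q := by
    intro i j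
    refine abs_le_of_sq_le_sq' ?_ hQ0 |>.2
    fin_cases i <;> fin_cases j <;> simp only [Fin.zero_eta, Fin.mk_one]
    · linarith [sq_nonneg ‖ι (y 0 (y 1 w))‖, sq_nonneg ‖ι (y 1 (y 1 w))‖]
    · linarith [sq_nonneg ‖ι (y 0 (y 0 w))‖, sq_nonneg ‖ι (y 1 (y 1 w))‖,
        sq_nonneg ‖ι (y 0 (y 1 w))‖]
    · rw [h.y_comm 1 0]
      linarith [sq_nonneg ‖ι (y 0 (y 0 w))‖, sq_nonneg ‖ι (y 1 (y 1 w))‖,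
        sq_nonneg ‖ι (y 0 (y 1 w))‖]
    · linarith [sq_nonneg ‖ι (y 0 (y 1 w))‖, sq_nonneg ‖ι (y 0 (y 0 w))‖]
  have hX0 : 0 ≤ P + Q := by positivity
  have hyp : ∀ i j, ‖ι (y i (p j w))‖ ≤ P + Q + S * n := by
    intro i j
    refine abs_le_of_sq_le_sq' ?_ (by positivity) |>.2
    have h1 : ‖ι (y i (p j w))‖ ^ 2 ≤ N := by
      rw [hN]
      fin_cases i <;> fin_cases j <;> simp only [Fin.zero_eta, Fin.mk_one] <;>
      linarith [sq_nonneg ‖ι (y 0 (p 0 w))‖, sq_nonneg ‖ι (y 0 (p 1 w))‖,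
        sq_nonneg ‖ι (y 1 (p 0 w))‖, sq_nonneg ‖ι (y 1 (p 1 w))‖]
    have h3 : 0 ≤ S * (n * (P + Q)) := by positivity
    have h4 : (P + Q + S * n) ^ 2 =
        P ^ 2 + Q ^ 2 + 2 * (P * Q) + 2 * (S * (n * (P + Q))) + (S * n) ^ 2 := by ring
    have h5 := mul_nonneg hP0 hQ0
    linarith [sq_nonneg (S * n), sq_nonneg P, sq_nonneg Q]
  have hD1 : ∀ t, 0 ≤ t → t ^ 2 ≤ formSq ι p y w → t ≤ n + (P + Q) := by
    intro t ht htt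
    refine abs_le_of_sq_le_sq' ?_ (by positivity) |>.2
    have h4 := mul_nonneg hn0 hX0
    have h5 : (n + (P + Q)) ^ 2 = n ^ 2 + 2 * (n * (P + Q)) + (P + Q) ^ 2 := by ring
    linarith [sq_nonneg n, sq_nonneg (P + Q)]
  have hp1 : ∀ j, ‖ι (p j w)‖ ≤ n + (P + Q) := by
    intro j
    refine hD1 _ (norm_nonneg _) ?_
    unfold formSq
    fin_cases j <;> simp only [Fin.zero_eta, Fin.mk_one] <;>
    linarith [sq_nonneg ‖ι (p 0 w)‖, sq_nonneg ‖ι (p 1 w)‖, sq_nonneg ‖ι (y 0 w)‖,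
      sq_nonneg ‖ι (y 1 w)‖]
  have hy1 : ∀ j, ‖ι (y j w)‖ ≤ n + (P + Q) := by
    intro j
    refine hD1 _ (norm_nonneg _) ?_
    unfold formSq
    fin_cases j <;> simp only [Fin.zero_eta, Fin.mk_one] <;>
    linarith [sq_nonneg ‖ι (p 0 w)‖, sq_nonneg ‖ι (p 1 w)‖, sq_nonneg ‖ι (y 0 w)‖,
      sq_nonneg ‖ι (y 1 w)‖]
  have hfin : norm2 ι p y w ≤ n + 4 * (n + (P + Q)) + 4 * (P + (P + Q + S * n) + Q) := by
    unfold norm2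
    simp only [Fin.sum_univ_two]
    linarith [hp1 0, hp1 1, hy1 0, hy1 1, hpp 0 0, hpp 0 1, hpp 1 0, hpp 1 1, hyy 0 0, hyy 0 1,
      hyy 1 0, hyy 1 1, hyp 0 0, hyp 0 1, hyp 1 0, hyp 1 1]
  have hSn : S * n ≤ S * (a + n) := mul_le_mul_of_nonneg_left (by linarith) hS.le
  have e : (5 + 12 * G + 4 * S) * (a + n) =
      5 * (a + n) + 12 * (G * (a + n)) + 4 * (S * (a + n)) := by ring
  linarith

/-! ### The ladder -/

/-- Stability of `harm κ - ζ` between the form domain and its dual. -/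
def IsStable (ι : E →ₗ[ℂ] H) (p y : Fin 2 → E →ₗ[ℂ] E) (κ ζ : ℂ) (C : ℝ) : Prop :=
  ∀ w M, 0 ≤ M → (∀ v, ‖inner ℂ (ι v) (ι (harm p y κ w - ζ • w))‖ ≤ M * √(formSq ι p y v)) →
    √(formSq ι p y w) ≤ C * M

/-- The base of the ladder: testing with `v = w` and taking real parts is coercive, since `-Re ζ
‖w‖²` has the good sign. -/
theorem isStable_of_re_nonpos {c₀ : ℝ} (hc₀ : 0 < c₀) (h : IsCCR ι s p y) {κ ζ : ℂ}
    (hκ : c₀ ≤ κ.re) (hζ : ζ.re ≤ 0) : IsStable ι p y κ ζ c₀⁻¹ := by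
  intro w M hM hw
  have h1 := (Complex.re_le_norm _).trans (hw w)
  rw [h.re_inner_harm] at h1
  set V := √(formSq ι p y w) with hV
  have hV2 : formSq ι p y w = V ^ 2 := (Real.sq_sqrt (formSq_nonneg w)).symm
  have hV0 : 0 ≤ V := Real.sqrt_nonneg _
  rw [hV2] at h1
  have h2 : c₀ * V ^ 2 ≤ M * V := by
    have : c₀ * V ^ 2 ≤ κ.re * V ^ 2 := mul_le_mul_of_nonneg_right hκ (sq_nonneg V)
    linarith [sq_nonneg ‖ι w‖, mul_nonneg (neg_nonneg.2 hζ) (sq_nonneg ‖ι w‖)]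
  rw [← div_eq_inv_mul, le_div_iff₀ hc₀]
  rcases hV0.lt_or_eq with h3 | h3
  · nlinarith
  · rw [← h3]; simpa using hM

/-- The annihilation operator. -/
def annih (p y : Fin 2 → E →ₗ[ℂ] E) (κ : ℂ) (j : Fin 2) : E →ₗ[ℂ] E :=
  Complex.I • p j + κ • y j

/-- The creation operator. -/
def creat (p y : Fin 2 → E →ₗ[ℂ] E) (κ : ℂ) (j : Fin 2) : E →ₗ[ℂ] E :=
  (-Complex.I) • p j + κ • y j

theorem norm_smul_add_smul_le {α β : ℂ} (hα : ‖α‖ = 1) (hβ : ‖β‖ = 1) (j : Fin 2) (v : E) :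
    ‖ι ((α • p j + β • y j) v)‖ ≤ 2 * √(formSq ι p y v) := by
  have h1 : ∀ t, 0 ≤ t → t ^ 2 ≤ formSq ι p y v → t ≤ √(formSq ι p y v) := fun t _ ht =>
    Real.le_sqrt_of_sq_le ht
  have hp : ‖ι (p j v)‖ ≤ √(formSq ι p y v) := by
    refine h1 _ (norm_nonneg _) ?_
    unfold formSq
    fin_cases j <;> simp only [Fin.zero_eta, Fin.mk_one] <;>
    linarith [sq_nonneg ‖ι (p 0 v)‖, sq_nonneg ‖ι (p 1 v)‖, sq_nonneg ‖ι (y 0 v)‖,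
      sq_nonneg ‖ι (y 1 v)‖]
  have hy : ‖ι (y j v)‖ ≤ √(formSq ι p y v) := by
    refine h1 _ (norm_nonneg _) ?_
    unfold formSq
    fin_cases j <;> simp only [Fin.zero_eta, Fin.mk_one] <;>
    linarith [sq_nonneg ‖ι (p 0 v)‖, sq_nonneg ‖ι (p 1 v)‖, sq_nonneg ‖ι (y 0 v)‖,
      sq_nonneg ‖ι (y 1 v)‖]
  simp only [LinearMap.add_apply, LinearMap.smul_apply, map_add, map_smul]
  refine (norm_add_le _ _).trans ?_
  rw [norm_smul, norm_smul, hα, hβ]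
  linarith

/-- The factorization of the complex-scaled oscillator; the commutators leave the zero-point energy.
The factors are not adjoint to each other unless `κ` is real, so no positivity is available, only
boundedness on the form domain. -/
theorem creat_annih (h : IsCCR ι s p y) {κ : ℂ} (hκ : ‖κ‖ = 1) (w : E) :
    (starRingEnd ℂ κ) • (creat p y κ 0 (annih p y κ 0 w) + creat p y κ 1 (annih p y κ 1 w)) =
      harm p y κ w - ((s 0 + s 1 : ℝ) : ℂ) • w := by
  have hk : (starRingEnd ℂ κ) * κ = 1 := by
    rw [mul_comm, Complex.mul_conj, Complex.normSq_eq_norm_sq, hκ]; simp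
  have hk2 : (starRingEnd ℂ κ) * (κ * κ) = κ := by rw [← mul_assoc, hk, one_mul]
  have hj : ∀ j, creat p y κ j (annih p y κ j w) =
      p j (p j w) + (κ * κ) • y j (y j w) - (κ * s j) • w := by
    intro j
    simp only [creat, annih, LinearMap.add_apply, LinearMap.smul_apply, map_add, map_smul,
      h.comm_self, smul_sub, smul_add, smul_smul]
    have hI := Complex.I_mul_I
    linear_combination (norm := module) (-1 : ℂ) • hI • (p j (p j w)) + (κ * s j) • hI • w
  rw [hj, hj]
  simp only [harm, sumSq, LinearMap.add_apply, LinearMap.smul_apply, LinearMap.comp_apply,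
    smul_add, smul_sub, smul_smul]
  push_cast
  linear_combination (norm := module) κ • hk • (y 0 (y 0 w) + y 1 (y 1 w)) -
    (s 0 + s 1 : ℂ) • hk • w
end IsCCR
end CCR

section CCR

variable {E H : Type*} [AddCommGroup E] [Module ℂ E] [NormedAddCommGroup H] [InnerProductSpace ℂ H]
variable {ι : E →ₗ[ℂ] H} {s : Fin 2 → ℝ} {p y : Fin 2 → E →ₗ[ℂ] E}

namespace IsCCR

theorem annih_creat_self (h : IsCCR ι s p y) (κ : ℂ) (j : Fin 2) (v : E) :
    annih p y κ j (creat p y κ j v) = creat p y κ j (annih p y κ j v) + (2 * κ * s j) • v := by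
  have hI := Complex.I_mul_I
  simp only [creat, annih, LinearMap.add_apply, LinearMap.smul_apply, map_add, map_smul,
      h.comm_self, smul_sub, smul_add, smul_smul]
  linear_combination (norm := module) (-2 * κ * s j) • hI • v

theorem annih_creat_ne (h : IsCCR ι s p y) (κ : ℂ) {i j : Fin 2} (hij : i ≠ j) (v : E) :
    annih p y κ i (creat p y κ j v) = creat p y κ j (annih p y κ i v) := by
  simp only [creat, annih, LinearMap.add_apply, LinearMap.smul_apply, map_add, map_smul,
      h.comm_ne i j hij, ← h.comm_ne j i hij.symm, h.p_comm i j, h.y_comm i j]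
  module

theorem annih_comm (h : IsCCR ι s p y) (κ : ℂ) (i j : Fin 2) (v : E) :
    annih p y κ i (annih p y κ j v) = annih p y κ j (annih p y κ i v) := by
  rcases eq_or_ne i j with rfl | hij
  · rfl
  simp only [annih, LinearMap.add_apply, LinearMap.smul_apply, map_add, map_smul,
      h.comm_ne i j hij, ← h.comm_ne j i hij.symm, h.p_comm i j, h.y_comm i j]
  module

/-- The intertwining relation of the ladder: the equation at `ζ` for `w` becomes the equation at `ζ
- 2 s_j` for the annihilated vector. -/
theorem annih_harm (h : IsCCR ι s p y) {κ : ℂ} (hκ : ‖κ‖ = 1) (j : Fin 2) (w : E) :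
    annih p y κ j (harm p y κ w) =
      harm p y κ (annih p y κ j w) + (2 * s j : ℂ) • annih p y κ j w := by
  have hk : (starRingEnd ℂ κ) * κ = 1 := by
    rw [mul_comm, Complex.mul_conj, Complex.normSq_eq_norm_sq, hκ]; simp
  have e1 := eq_add_of_sub_eq (h.creat_annih hκ w).symm
  have e2 := eq_add_of_sub_eq (h.creat_annih hκ (annih p y κ j w)).symm
  rw [e1, e2]
  simp only [map_add, map_smul]
  fin_cases j <;> simp only [Fin.zero_eta, Fin.mk_one]
  · rw [h.annih_creat_self, h.annih_creat_ne κ (show (0 : Fin 2) ≠ 1 by simp), h.annih_comm κ 0 1]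
    linear_combination (norm := module) (2 * s 0 : ℂ) • hk • annih p y κ 0 w
  · rw [h.annih_creat_self, h.annih_creat_ne κ (show (1 : Fin 2) ≠ 0 by simp), h.annih_comm κ 1 0]
    linear_combination (norm := module) (2 * s 1 : ℂ) • hk • annih p y κ 1 w

theorem inner_annih (h : IsCCR ι s p y) (κ : ℂ) (j : Fin 2) (v w : E) :
    inner ℂ (ι v) (ι (annih p y κ j w)) =
      inner ℂ (ι (((-Complex.I) • p j + (starRingEnd ℂ κ) • y j) v)) (ι w) := by
  simp only [annih, LinearMap.add_apply, LinearMap.smul_apply, map_add, map_smul, inner_add_left,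
    inner_add_right, inner_smul_left, inner_smul_right, h.p_symm, h.y_symm, Complex.conj_conj,
    map_neg, Complex.conj_I, neg_neg]

/-- If `f` is the right-hand side for `w`, the annihilated vector solves the lowered equation with
right-hand side `a_j f`, which is bounded in the dual of the form domain. Stability one step down
bounds `a_j w` in the form norm, hence the number operator applied to `w`; dividing by the distance
of `ζ` to the zero-point energy recovers `w`. -/
theorem norm_le_of_isStable (h : IsCCR ι s p y) {κ ζ : ℂ} (hκ : ‖κ‖ = 1) {C δ : ℝ}
    (hδ : 0 < δ) (hζ : δ ≤ ‖ζ - ((s 0 + s 1 : ℝ) : ℂ)‖)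
    (hst : ∀ j, IsStable ι p y κ (ζ - (2 * s j : ℂ)) C) (w : E) :
    ‖ι w‖ ≤ (8 * C + 1) / δ * ‖ι (harm p y κ w - ζ • w)‖ := by
  set f := harm p y κ w - ζ • w with hf
  have hV : ∀ j, √(formSq ι p y (annih p y κ j w)) ≤ C * (2 * ‖ι f‖) := by
    intro j
    refine hst j _ _ (by positivity) fun v => ?_
    have e : harm p y κ (annih p y κ j w) - (ζ - (2 * s j : ℂ)) • annih p y κ j w =
        annih p y κ j f := by
      rw [hf, map_sub, h.annih_harm hκ, map_smul]; module
    rw [e, h.inner_annih]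
    refine (norm_inner_le_norm _ _).trans ?_
    have := norm_smul_add_smul_le (ι := ι) (p := p) (y := y) (α := -Complex.I)
      (β := starRingEnd ℂ κ) (by simp) (by simpa using hκ) j v
    nlinarith [norm_nonneg (ι f)]
  have hB : ∀ j, ‖ι (creat p y κ j (annih p y κ j w))‖ ≤ 2 * (C * (2 * ‖ι f‖)) := by
    intro j
    refine (norm_smul_add_smul_le (by simp) hκ j _).trans ?_
    linarith [hV j]
  have e : (ζ - ((s 0 + s 1 : ℝ) : ℂ)) • ι w = (starRingEnd ℂ κ) •
      (ι (creat p y κ 0 (annih p y κ 0 w)) + ι (creat p y κ 1 (annih p y κ 1 w))) - ι f := by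
    rw [← map_add, ← map_smul ι (starRingEnd ℂ κ), h.creat_annih hκ, ← map_sub, ← map_smul, hf]
    congr 1
    module
  -- Each of the two modes contributes `2 * C * 2`, and `f` itself contributes `1`.
  have h1 : ‖ζ - ((s 0 + s 1 : ℝ) : ℂ)‖ * ‖ι w‖ ≤ (8 * C + 1) * ‖ι f‖ := by
    rw [← norm_smul, e]
    refine (norm_sub_le _ _).trans ?_
    rw [norm_smul, RCLike.norm_conj, hκ, one_mul]
    have := norm_add_le (ι (creat p y κ 0 (annih p y κ 0 w))) (ι (creat p y κ 1 (annih p y κ 1 w)))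
    linarith [hB 0, hB 1]
  rw [div_mul_eq_mul_div, le_div_iff₀ hδ]
  nlinarith [norm_nonneg (ι w)]

/-- Duality. The norm bound for the adjoint problem improves to a form bound by taking real parts;
density of the adjoint range then turns it into a bound of `w` by a dual norm of its image, and real
parts once more give the form norm of `w`. -/
theorem isStable_of_norm_le (h : IsCCR ι s p y) {κ ζ : ℂ} {c₀ r K : ℝ} (hc₀ : 0 < c₀)
    (hκ : c₀ ≤ κ.re) (hr : 0 ≤ r) (hζ : ζ.re ≤ r) (hK : 0 ≤ K)
    (hle : ∀ v, ‖ι v‖ ≤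
      K * ‖ι (harm p y (starRingEnd ℂ κ) v - (starRingEnd ℂ ζ) • v)‖)
    (hd : DenseRange fun v => ι (harm p y (starRingEnd ℂ κ) v - (starRingEnd ℂ ζ) • v)) :
    IsStable ι p y κ ζ (c₀⁻¹ + r * (1 + (K + r * K ^ 2) / c₀) ^ 2 / c₀ + 1) := by
  set K' := 1 + (K + r * K ^ 2) / c₀ with hK'
  have hK'0 : 0 ≤ K' := by positivity
  have hform : ∀ v, √(formSq ι p y v) ≤
      K' * ‖ι (harm p y (starRingEnd ℂ κ) v - (starRingEnd ℂ ζ) • v)‖ := by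
    intro v
    have h1 := (Complex.re_le_norm _).trans (norm_inner_le_norm (𝕜 := ℂ) (ι v)
      (ι (harm p y (starRingEnd ℂ κ) v - (starRingEnd ℂ ζ) • v)))
    rw [h.re_inner_harm, Complex.conj_re, Complex.conj_re] at h1
    have h2 := hle v
    set g := ‖ι (harm p y (starRingEnd ℂ κ) v - (starRingEnd ℂ ζ) • v)‖ with hg
    have hg0 : 0 ≤ g := norm_nonneg _
    have h3 : c₀ * formSq ι p y v ≤ (K + r * K ^ 2) * g ^ 2 := by
      have a1 : c₀ * formSq ι p y v ≤ κ.re * formSq ι p y v :=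
        mul_le_mul_of_nonneg_right hκ (formSq_nonneg v)
      have a2 : ‖ι v‖ ^ 2 ≤ (K * g) ^ 2 := pow_le_pow_left₀ (norm_nonneg _) h2 2
      have a3 : ζ.re * ‖ι v‖ ^ 2 ≤ r * ‖ι v‖ ^ 2 := mul_le_mul_of_nonneg_right hζ (sq_nonneg _)
      have a4 : r * ‖ι v‖ ^ 2 ≤ r * (K * g) ^ 2 := mul_le_mul_of_nonneg_left a2 hr
      have a5 : ‖ι v‖ * g ≤ K * g * g := mul_le_mul_of_nonneg_right h2 hg0
      linarith
    rw [Real.sqrt_le_left (by positivity)]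
    have h4 : formSq ι p y v ≤ (K + r * K ^ 2) / c₀ * g ^ 2 := by
      rw [div_mul_eq_mul_div, le_div_iff₀ hc₀]; linarith
    refine h4.trans ?_
    rw [mul_pow]
    refine mul_le_mul_of_nonneg_right ?_ (sq_nonneg g)
    have : 0 ≤ (K + r * K ^ 2) / c₀ := by positivity
    rw [hK']
    nlinarith
  intro w M hM hw
  have hn : ‖ι w‖ ≤ K' * M := by
    -- On the range of the adjoint problem the pairing with `w` is the functional bounded by `M`
    -- times the form norm of the solution, and `hform` bounds that form norm by `‖u‖`.
    have key : ∀ u : H, ‖inner ℂ u (ι w)‖ ≤ K' * M * ‖u‖ := by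
      intro u
      refine hd.induction_on (p := fun u => ‖inner ℂ u (ι w)‖ ≤ K' * M * ‖u‖) u ?_ ?_
      · exact isClosed_le (by fun_prop) (by fun_prop)
      · intro v
        rw [h.harm_adjoint]
        have := hw v
        have := mul_le_mul_of_nonneg_left (hform v) hM
        linarith
    have h1 := key (ι w)
    rw [inner_self_eq_norm_sq_to_K] at h1
    have h2 : ‖((‖ι w‖ : ℂ)) ^ 2‖ = ‖ι w‖ ^ 2 := by simp
    erw [h2] at h1
    rcases (norm_nonneg (ι w)).lt_or_eq with h3 | h3
    · nlinarith
    · rw [← h3]; positivity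
  have h1 := (Complex.re_le_norm _).trans (hw w)
  rw [h.re_inner_harm] at h1
  set V := √(formSq ι p y w) with hVdef
  have hV2 : formSq ι p y w = V ^ 2 := (Real.sq_sqrt (formSq_nonneg w)).symm
  have hV0 : 0 ≤ V := Real.sqrt_nonneg _
  rw [hV2] at h1
  -- The summand `1` in the constant forces `M ≤ V` under the contrary assumption, so that `M²` may
  -- be replaced by `M * V` and one factor `V` divided out.
  by_contra! hlt
  have hT : 0 ≤ r * K' ^ 2 / c₀ := by positivity
  have hc' : 0 < c₀⁻¹ := by positivity
  have hVM : M ≤ V := by nlinarith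
  have hVpos : 0 < V := by
    have : 0 ≤ (c₀⁻¹ + r * K' ^ 2 / c₀ + 1) * M := by positivity
    linarith
  have a1 : c₀ * V ^ 2 ≤ κ.re * V ^ 2 := mul_le_mul_of_nonneg_right hκ (sq_nonneg V)
  have a2 : ‖ι w‖ ^ 2 ≤ (K' * M) ^ 2 := pow_le_pow_left₀ (norm_nonneg _) hn 2
  have a3 : ζ.re * ‖ι w‖ ^ 2 ≤ r * ‖ι w‖ ^ 2 := mul_le_mul_of_nonneg_right hζ (sq_nonneg _)
  have a4 : r * ‖ι w‖ ^ 2 ≤ r * (K' * M) ^ 2 := mul_le_mul_of_nonneg_left a2 hr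
  have a5 : c₀ * V ^ 2 ≤ M * V + r * K' ^ 2 * (M * M) := by linarith
  have a6 : M * M ≤ M * V := mul_le_mul_of_nonneg_left hVM hM
  have a7 : c₀ * V ^ 2 ≤ (1 + r * K' ^ 2) * M * V := by
    have : r * K' ^ 2 * (M * M) ≤ r * K' ^ 2 * (M * V) :=
      mul_le_mul_of_nonneg_left a6 (by positivity)
    linarith
  have a8 : c₀ * V ≤ (1 + r * K' ^ 2) * M := by
    by_contra! hh
    nlinarith
  have a9 : c₀ * ((c₀⁻¹ + r * K' ^ 2 / c₀ + 1) * M) = (1 + r * K' ^ 2) * M + c₀ * M := by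
    field_simp
  have a10 := mul_lt_mul_of_pos_left hlt hc₀
  have : 0 ≤ c₀ * M := by positivity
  linarith

/-- The spectral parameter stays at distance `δ` from the unperturbed levels, and the scaling angle
in a closed sector. -/
structure Admissible (s : Fin 2 → ℝ) (c₀ δ : ℝ) (κ ζ : ℂ) : Prop where
  norm_eq : ‖κ‖ = 1
  le_re : c₀ ≤ κ.re
  le_dist : ∀ m n : ℕ, δ ≤ ‖ζ - (level s m n : ℂ)‖

theorem Admissible.conj {c₀ δ : ℝ} {κ ζ : ℂ} (h : Admissible s c₀ δ κ ζ) :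
    Admissible s c₀ δ (starRingEnd ℂ κ) (starRingEnd ℂ ζ) where
  norm_eq := by rw [RCLike.norm_conj, h.norm_eq]
  le_re := by simpa using h.le_re
  le_dist m n := by
    rw [← Complex.conj_ofReal, ← map_sub, RCLike.norm_conj]
    exact h.le_dist m n

/-- The set of levels is closed under adding `2 s_j`, so descending the ladder never brings `ζ`
closer to it. This is why all levels, not just the lowest, enter `Admissible`. -/
theorem Admissible.sub {c₀ δ : ℝ} {κ ζ : ℂ} (h : Admissible s c₀ δ κ ζ) (j : Fin 2) :
    Admissible s c₀ δ κ (ζ - (2 * s j : ℂ)) where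
  norm_eq := h.norm_eq
  le_re := h.le_re
  le_dist m n := by
    fin_cases j <;> simp only [Fin.zero_eta, Fin.mk_one]
    · have := h.le_dist (m + 1) n
      convert this using 2
      simp only [level]; push_cast; ring
    · have := h.le_dist m (n + 1)
      convert this using 2
      simp only [level]; push_cast; ring

/-- Induction on the height of `Re ζ` in units of `2 σ`: every annihilation lowers it by at least
one unit. The constant depends only on the height, and the statement ranges over all admissible
pairs because each step passes to the conjugate one. -/
theorem exists_isStable (ι : E →ₗ[ℂ] H) {c₀ δ σ : ℝ} (hc₀ : 0 < c₀) (hδ : 0 < δ) (hσ : 0 < σ)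
    (hs : ∀ j, σ ≤ s j) (k : ℕ) :
    ∃ C : ℝ, 0 ≤ C ∧ ∀ p y : Fin 2 → E →ₗ[ℂ] E, IsCCR ι s p y →
      (∀ κ ζ, Admissible s c₀ δ κ ζ → DenseRange fun v => ι (harm p y κ v - ζ • v)) →
      ∀ κ ζ, Admissible s c₀ δ κ ζ → ζ.re ≤ 2 * σ * k → IsStable ι p y κ ζ C := by
  induction k with
  | zero =>
    refine ⟨c₀⁻¹, by positivity, fun p y h _ κ ζ ha hζ => ?_⟩
    exact isStable_of_re_nonpos hc₀ h ha.le_re (by simpa using hζ)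
  | succ k ih =>
    obtain ⟨C, hC, hst⟩ := ih
    have hr : 0 ≤ 2 * σ * (k + 1 : ℕ) := by positivity
    have hK : 0 ≤ (8 * C + 1) / δ := by positivity
    refine ⟨c₀⁻¹ + (2 * σ * (k + 1 : ℕ)) * (1 + ((8 * C + 1) / δ +
      (2 * σ * (k + 1 : ℕ)) * ((8 * C + 1) / δ) ^ 2) / c₀) ^ 2 / c₀ + 1, by positivity,
      fun p y h hd κ ζ ha hζ => ?_⟩
    refine h.isStable_of_norm_le hc₀ ha.le_re hr hζ hK ?_ (hd _ _ ha.conj)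
    refine h.norm_le_of_isStable ha.conj.norm_eq hδ ?_ fun j => ?_
    · simpa [level] using ha.conj.le_dist 0 0
    · refine hst p y h hd _ _ (ha.conj.sub j) ?_
      have := hs j
      simp only [Complex.sub_re, Complex.conj_re, Complex.mul_re, Complex.re_ofNat,
        Complex.ofReal_re, Complex.im_ofNat, Complex.ofReal_im]
      push_cast at hζ
      linarith

/-- A priori bound for small perturbations of the complex-scaled harmonic oscillator. -/
theorem exists_norm2_le (ι : E →ₗ[ℂ] H) {c₀ δ : ℝ} (hc₀ : 0 < c₀) (hδ : 0 < δ)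
    (hs : ∀ j, 0 < s j) (r : ℝ) {K : ℝ} (hK0 : 0 ≤ K) :
    ∃ C : ℝ, 0 < C ∧ ∃ η : ℝ, 0 < η ∧ ∀ p y : Fin 2 → E →ₗ[ℂ] E, IsCCR ι s p y →
      (∀ κ ζ, Admissible s c₀ δ κ ζ → DenseRange fun v => ι (harm p y κ v - ζ • v)) →
      ∀ κ ζ, Admissible s c₀ δ κ ζ → ζ.re ≤ r → (‖ζ‖ ≤ K ∨ ‖ζ‖ ≤ K * -ζ.re) →
      ∀ (w : E) (g : H), ‖ι (harm p y κ w - ζ • w) - g‖ ≤ η * norm2 ι p y w →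
        norm2 ι p y w ≤ C * ‖g‖ := by
  obtain ⟨σ, hσ, hσs⟩ : ∃ σ : ℝ, 0 < σ ∧ ∀ j, σ ≤ s j :=
    ⟨min (s 0) (s 1), lt_min (hs 0) (hs 1), fun j => by
      fin_cases j
      · exact min_le_left _ _
      · exact min_le_right _ _⟩
  obtain ⟨k, hk⟩ := exists_nat_ge (r / (2 * σ))
  obtain ⟨C₁, hC₁, hst⟩ := exists_isStable ι hc₀ hδ hσ hσs k
  obtain ⟨C₂, hC₂, hell⟩ := norm2_le (ι := ι) hc₀ hs
  set e := s 0 + s 1 with he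
  have hepos : 0 < e := add_pos (hs 0) (hs 1)
  set A := C₁ / e with hA
  have hA0 : 0 ≤ A := by positivity
  set C := C₂ * (1 + |K| * A + |K| + A) with hCdef
  have hC0 : 0 < C := by
    by_cases hz : 0 < 1 + |K| * A + |K| + A
    · positivity
    · exact absurd (by positivity) hz
  refine ⟨2 * C, by positivity, 1 / (2 * C), by positivity, ?_⟩
  intro p y h hd κ ζ ha hr hK w g hg
  set f := harm p y κ w - ζ • w with hf
  have hζr : ζ.re ≤ 2 * σ * k := by
    rw [div_le_iff₀ (by positivity)] at hk
    linarith
  have hsq : ∀ v, √e * ‖ι v‖ ≤ √(formSq ι p y v) := by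
    intro v
    apply Real.le_sqrt_of_sq_le
    rw [mul_pow, Real.sq_sqrt hepos.le]
    exact h.mul_norm_sq_le_formSq v
  have hse : 0 < √e := Real.sqrt_pos.2 hepos
  -- As a functional on the form domain, `f` has norm at most `‖f‖ / √e` by the uncertainty
  -- inequality; the same inequality returns from the form norm of `w` to its norm.
  have hn : ‖ι w‖ ≤ A * ‖ι f‖ := by
    have h1 := hst p y h hd κ ζ ha hζr w (‖ι f‖ / √e) (by positivity) fun v => by
      refine (norm_inner_le_norm _ _).trans ?_
      rw [div_mul_eq_mul_div, le_div_iff₀ hse]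
      nlinarith [hsq v, norm_nonneg (ι f)]
    have h2 := (hsq w).trans h1
    have h3 : A * ‖ι f‖ = C₁ * (‖ι f‖ / √e) / √e := by
      rw [hA]
      field_simp
      rw [Real.sq_sqrt hepos.le]
      ring
    rw [h3, le_div_iff₀ hse]
    linarith
  -- A possibly large `ζ` must have `Re ζ` negative and comparable to `‖ζ‖`; then the real part of
  -- the form bounds `-Re ζ ‖w‖` directly.
  have hζn : ‖ζ‖ * ‖ι w‖ ≤ (|K| * A + |K|) * ‖ι f‖ := by
    have hKf : 0 ≤ |K| * ‖ι f‖ := by positivity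
    have hKA : 0 ≤ |K| * A * ‖ι f‖ := by positivity
    rcases hK with hK | hK
    · have : ‖ζ‖ * ‖ι w‖ ≤ |K| * (A * ‖ι f‖) :=
        mul_le_mul (hK.trans (le_abs_self K)) hn (norm_nonneg _) (abs_nonneg _)
      linarith
    · have h1 := (Complex.re_le_norm _).trans (norm_inner_le_norm (𝕜 := ℂ) (ι w) (ι f))
      rw [hf, h.re_inner_harm, ← hf] at h1
      have h2 : 0 ≤ κ.re * formSq ι p y w :=
        mul_nonneg (hc₀.le.trans ha.le_re) (formSq_nonneg w)
      have h3 : -ζ.re * ‖ι w‖ ≤ ‖ι f‖ := by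
        rcases (norm_nonneg (ι w)).lt_or_eq with h4 | h4
        · by_contra! hh
          nlinarith
        · rw [← h4]; simp
      have h5 : ‖ζ‖ * ‖ι w‖ ≤ K * (-ζ.re * ‖ι w‖) := by
        rw [← mul_assoc]
        exact mul_le_mul_of_nonneg_right hK (norm_nonneg _)
      have h6 : K * (-ζ.re * ‖ι w‖) ≤ |K| * ‖ι f‖ := by
        rcases le_total 0 (-ζ.re) with h7 | h7
        · exact mul_le_mul (le_abs_self K) h3 (mul_nonneg h7 (norm_nonneg _)) (abs_nonneg _)
        · have : K * (-ζ.re * ‖ι w‖) ≤ 0 := mul_nonpos_of_nonneg_of_nonpos hK0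
            (mul_nonpos_of_nonpos_of_nonneg h7 (norm_nonneg _))
          linarith
      linarith
  have hharm : ‖ι (harm p y κ w)‖ ≤ ‖ι f‖ + ‖ζ‖ * ‖ι w‖ := by
    have e1 : harm p y κ w = f + ζ • w := by rw [hf]; abel
    rw [e1, map_add, map_smul]
    exact (norm_add_le _ _).trans (by rw [norm_smul])
  have hmain : norm2 ι p y w ≤ C * ‖ι f‖ := by
    refine (hell p y h κ ha.norm_eq ha.le_re w).trans ?_
    rw [hCdef, mul_assoc]
    refine mul_le_mul_of_nonneg_left ?_ hC₂.le
    linarith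
  -- With `η = 1 / (2 C)` the error contributes half of the left-hand side and is absorbed; this
  -- doubles the constant.
  have hfg : ‖ι f‖ ≤ ‖g‖ + 1 / (2 * C) * norm2 ι p y w := by
    calc ‖ι f‖ = ‖g + (ι f - g)‖ := by rw [add_sub_cancel]
      _ ≤ _ := (norm_add_le _ _).trans (by linarith)
  have h9 := mul_le_mul_of_nonneg_left hfg hC0.le
  have h10 : C * (‖g‖ + 1 / (2 * C) * norm2 ι p y w) = C * ‖g‖ + norm2 ι p y w / 2 := by
    field_simp
  linarith
end IsCCR
end CCR

/-! ### Position and momentum operators on Schwartz functions -/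

/-- The inclusion of the Schwartz space into `L²(ℝ²)`. -/
def toL2 : 𝓢(Plane, ℂ) →ₗ[ℂ] L2Plane := (SchwartzMap.toLpCLM ℂ ℂ 2 volume).toLinearMap

theorem toL2_apply (φ : 𝓢(Plane, ℂ)) : toL2 φ = φ.toLp 2 volume := rfl

theorem toL2_injective : Function.Injective toL2 :=
  SchwartzMap.injective_toLp (F := ℂ) 2 (volume : Measure Plane)

theorem inner_toL2 (φ ψ : 𝓢(Plane, ℂ)) :
    inner ℂ (toL2 φ) (toL2 ψ) = ∫ x, starRingEnd ℂ (φ x) * ψ x := by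
  rw [toL2_apply, toL2_apply, SchwartzMap.inner_toL2_toL2_eq φ ψ volume]
  simp only [RCLike.inner_apply, mul_comm]

theorem position_symm (j : Fin 2) (φ ψ : 𝓢(Plane, ℂ)) :
    inner ℂ (toL2 (position j φ)) (toL2 ψ) = inner ℂ (toL2 φ) (toL2 (position j ψ)) := by
  rw [inner_toL2, inner_toL2]
  congr 1
  ext x
  rw [position_apply, position_apply, map_mul, Complex.conj_ofReal]
  ring

/-- Complex conjugation of Schwartz functions. -/
def conjS (φ : 𝓢(Plane, ℂ)) : 𝓢(Plane, ℂ) :=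
  SchwartzMap.postcompCLM (𝕜 := ℝ) (Complex.conjCLE : ℂ →L[ℝ] ℂ) φ

theorem conjS_apply (φ : 𝓢(Plane, ℂ)) (x : Plane) : conjS φ x = starRingEnd ℂ (φ x) := rfl

theorem lineDeriv_conjS (φ : 𝓢(Plane, ℂ)) (v x : Plane) :
    (∂_{v} (conjS φ)) x = starRingEnd ℂ ((∂_{v} φ) x) := by
  rw [SchwartzMap.lineDerivOp_apply_eq_fderiv, SchwartzMap.lineDerivOp_apply_eq_fderiv]
  have h : HasFDerivAt (conjS φ) ((Complex.conjCLE : ℂ →L[ℝ] ℂ) ∘L fderiv ℝ φ x) x :=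
    (Complex.conjCLE : ℂ →L[ℝ] ℂ).hasFDerivAt.comp x (φ.hasFDerivAt x)
  rw [h.fderiv]
  rfl

theorem momentum_eq (j : Fin 2) (φ : 𝓢(Plane, ℂ)) :
    momentum j φ = (-Complex.I) • ∂_{(EuclideanSpace.single j (1 : ℝ) : Plane)} φ := rfl

theorem momentum_symm (j : Fin 2) (φ ψ : 𝓢(Plane, ℂ)) :
    inner ℂ (toL2 (momentum j φ)) (toL2 ψ) = inner ℂ (toL2 φ) (toL2 (momentum j ψ)) := by
  rw [inner_toL2, inner_toL2]
  set v : Plane := EuclideanSpace.single j (1 : ℝ)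
  have h := SchwartzMap.integral_mul_lineDerivOp_right_eq_neg_left (μ := volume) (conjS φ) ψ v
  have h1 : ∀ x, starRingEnd ℂ (momentum j φ x) * ψ x =
      Complex.I * ((∂_{v} (conjS φ)) x * ψ x) := by
    intro x
    rw [momentum_eq, lineDeriv_conjS, smul_apply, smul_eq_mul, map_mul, map_neg,
      Complex.conj_I]
    ring
  have h2 : ∀ x, starRingEnd ℂ (φ x) * momentum j ψ x =
      -Complex.I * (conjS φ x * (∂_{v} ψ) x) := by
    intro x
    rw [momentum_eq, conjS_apply, smul_apply, smul_eq_mul]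
    ring
  simp only [h1, h2]
  rw [integral_const_mul, integral_const_mul, h]
  ring

theorem position_comm (i j : Fin 2) (φ : 𝓢(Plane, ℂ)) :
    position i (position j φ) = position j (position i φ) := by
  ext x
  simp only [position_apply]
  ring

theorem lineDeriv_comm (φ : 𝓢(Plane, ℂ)) (v w : Plane) : ∂_{v} (∂_{w} φ) = ∂_{w} (∂_{v} φ) := by
  ext x
  have key : ∀ v w : Plane, (∂_{v} (∂_{w} φ)) x = fderiv ℝ (fderiv ℝ φ) x v w := by
    intro v w
    rw [SchwartzMap.lineDerivOp_apply_eq_fderiv]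
    have h : ((∂_{w} φ : 𝓢(Plane, ℂ)) : Plane → ℂ) = fun z => fderiv ℝ φ z w :=
      funext (SchwartzMap.lineDerivOp_apply_eq_fderiv w φ)
    have hd : DifferentiableAt ℝ (fderiv ℝ φ) x :=
      ((φ.smooth 2).fderiv_right (m := 1) (by norm_num)).differentiable (by norm_num) x
    rw [h, fderiv_clm_apply hd (differentiableAt_const w)]
    simp
  rw [key, key]
  exact (φ.contDiffAt 2).isSymmSndFDerivAt (by simp) v w

theorem momentum_comm (i j : Fin 2) (φ : 𝓢(Plane, ℂ)) :
    momentum i (momentum j φ) = momentum j (momentum i φ) := by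
  simp only [momentum_eq]
  rw [LineDeriv.lineDerivOp_smul, LineDeriv.lineDerivOp_smul, lineDeriv_comm]

theorem momentum_position (i j : Fin 2) (φ : 𝓢(Plane, ℂ)) :
    momentum i (position j φ) =
      position j (momentum i φ) - (if i = j then Complex.I else 0) • φ := by
  ext x
  have hx : HasFDerivAt (fun x : Plane => ((x j : ℝ) : ℂ))
      (Complex.ofRealCLM.comp (EuclideanSpace.proj j : Plane →L[ℝ] ℝ)) x :=
    (Complex.ofRealCLM.comp (EuclideanSpace.proj j : Plane →L[ℝ] ℝ)).hasFDerivAt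
  have h := (HasFDerivAt.mul hx (φ.hasFDerivAt x)).congr_of_eventuallyEq
    (Filter.Eventually.of_forall fun z => position_apply j φ z)
  rw [momentum_apply, h.fderiv, sub_apply, position_apply, momentum_apply,
    smul_apply]
  by_cases hij : i = j
  · subst hij
    simp
    ring
  · have : j ≠ i := fun h => hij h.symm
    simp [hij, this]
    ring

/-- Rotation of a pair of operators by the angle with cosine `c` and sine `d`. -/
def rot (c d : ℝ) (A : Fin 2 → SchwartzOp) : Fin 2 → 𝓢(Plane, ℂ) →ₗ[ℂ] 𝓢(Plane, ℂ) :=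
  ![(c : ℂ) • (A 0 : 𝓢(Plane, ℂ) →ₗ[ℂ] 𝓢(Plane, ℂ)) +
      (d : ℂ) • (A 1 : 𝓢(Plane, ℂ) →ₗ[ℂ] 𝓢(Plane, ℂ)),
    (-d : ℂ) • (A 0 : 𝓢(Plane, ℂ) →ₗ[ℂ] 𝓢(Plane, ℂ)) +
      (c : ℂ) • (A 1 : 𝓢(Plane, ℂ) →ₗ[ℂ] 𝓢(Plane, ℂ))]

theorem rot_zero_apply (c d : ℝ) (A : Fin 2 → SchwartzOp) (φ : 𝓢(Plane, ℂ)) :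
    rot c d A 0 φ = (c : ℂ) • A 0 φ + (d : ℂ) • A 1 φ := rfl

theorem rot_one_apply (c d : ℝ) (A : Fin 2 → SchwartzOp) (φ : 𝓢(Plane, ℂ)) :
    rot c d A 1 φ = (-d : ℂ) • A 0 φ + (c : ℂ) • A 1 φ := rfl

theorem rot_symm (c d : ℝ) {A : Fin 2 → SchwartzOp}
    (hA : ∀ j φ ψ, inner ℂ (toL2 (A j φ)) (toL2 ψ) = inner ℂ (toL2 φ) (toL2 (A j ψ)))
    (j : Fin 2) (φ ψ : 𝓢(Plane, ℂ)) :
    inner ℂ (toL2 (rot c d A j φ)) (toL2 ψ) = inner ℂ (toL2 φ) (toL2 (rot c d A j ψ)) := by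
  fin_cases j <;>
  simp only [Fin.zero_eta, Fin.mk_one, rot_zero_apply, rot_one_apply, map_add, map_smul,
    inner_add_left, inner_add_right, inner_smul_left, inner_smul_right, hA, map_neg,
    Complex.conj_ofReal]

theorem rot_comm (c d : ℝ) {A : Fin 2 → SchwartzOp} (hA : ∀ i j φ, A i (A j φ) = A j (A i φ))
    (i j : Fin 2) (φ : 𝓢(Plane, ℂ)) :
    rot c d A i (rot c d A j φ) = rot c d A j (rot c d A i φ) := by
  fin_cases i <;> fin_cases j <;>
  simp only [Fin.zero_eta, Fin.mk_one, rot_zero_apply, rot_one_apply, map_add, map_smul, hA 1 0] <;>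
  module

theorem rot_momentum_position {c d : ℝ} (hcd : c ^ 2 + d ^ 2 = 1) (i j : Fin 2)
    (φ : 𝓢(Plane, ℂ)) :
    rot c d momentum i (rot c d position j φ) = rot c d position j (rot c d momentum i φ) -
      (if i = j then Complex.I else 0) • φ := by
  have h : (c : ℂ) ^ 2 + (d : ℂ) ^ 2 = 1 := by exact_mod_cast hcd
  fin_cases i <;> fin_cases j <;>
  simp only [Fin.zero_eta, Fin.mk_one, rot_zero_apply, rot_one_apply, map_add, map_smul,
    momentum_position, Fin.isValue, if_true, zero_ne_one, one_ne_zero, if_false, zero_smul]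
  · linear_combination (norm := module) (-Complex.I) • h • φ
  · module
  · module
  · linear_combination (norm := module) (-Complex.I) • h • φ

/-- The rescaled rotated momenta and positions satisfy the canonical commutation relations. -/
theorem isCCR_rot {c d : ℝ} (hcd : c ^ 2 + d ^ 2 = 1) {r : ℝ} (hr : 0 < r) (s : Fin 2 → ℝ) :
    IsCCR toL2 s (fun j => ((r⁻¹ : ℝ) : ℂ) • rot c d momentum j)
      (fun j => ((s j * r : ℝ) : ℂ) • rot c d position j) where
  p_symm j v w := by
    simp only [LinearMap.smul_apply, map_smul, inner_smul_left, inner_smul_right,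
      Complex.conj_ofReal, rot_symm c d momentum_symm]
  y_symm j v w := by
    simp only [LinearMap.smul_apply, map_smul, inner_smul_left, inner_smul_right,
      Complex.conj_ofReal, rot_symm c d position_symm]
  p_comm i j v := by
    simp only [LinearMap.smul_apply, map_smul]
    rw [rot_comm c d momentum_comm]
  y_comm i j v := by
    simp only [LinearMap.smul_apply, map_smul]
    rw [rot_comm c d position_comm, smul_comm]
  comm_self j v := by
    simp only [LinearMap.smul_apply, map_smul, rot_momentum_position hcd, if_true]
    have h : ((r⁻¹ : ℝ) : ℂ) * (r : ℂ) = 1 := by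
      rw [← Complex.ofReal_mul, inv_mul_cancel₀ hr.ne', Complex.ofReal_one]
    push_cast at h ⊢
    linear_combination (norm := module) (-(s j : ℂ) * Complex.I) • h • v
  comm_ne i j hij v := by
    simp only [LinearMap.smul_apply, map_smul, rot_momentum_position hcd, if_neg hij, zero_smul,
      sub_zero]
    rw [smul_comm]

/-! ### Gaussians as Schwartz functions and totality of polynomials times a Gaussian -/

theorem exists_pow_mul_exp_le {c : ℝ} (hc : 0 < c) (k : ℕ) :
    ∃ C : ℝ, ∀ r : ℝ, 0 ≤ r → (1 + r) ^ k * Real.exp (-(c * r ^ 2)) ≤ C := by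
  set a := min c 1 with ha
  have ha0 : 0 < a := lt_min hc one_pos
  refine ⟨(2 / a) ^ k * ((k.factorial : ℝ) * Real.exp 1), fun r hr => ?_⟩
  have h1 : 1 + r ≤ 2 / a * (1 + a * r ^ 2) := by
    rw [div_mul_eq_mul_div, le_div_iff₀ ha0]
    have : a ≤ 1 := min_le_right _ _
    nlinarith [mul_nonneg ha0.le (sq_nonneg (r - 1)), mul_nonneg ha0.le (sq_nonneg r)]
  have h2 : (1 + r) ^ k ≤ (2 / a) ^ k * (1 + a * r ^ 2) ^ k := by
    rw [← mul_pow]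
    exact pow_le_pow_left₀ (by positivity) h1 k
  have h3 : (1 + a * r ^ 2) ^ k ≤ (k.factorial : ℝ) * Real.exp (1 + a * r ^ 2) := by
    have := Real.pow_div_factorial_le_exp (1 + a * r ^ 2) (by positivity) k
    rwa [div_le_iff₀' (by positivity)] at this
  have h4 : Real.exp (1 + a * r ^ 2) * Real.exp (-(c * r ^ 2)) ≤ Real.exp 1 := by
    rw [← Real.exp_add]
    apply Real.exp_le_exp.2
    have : a ≤ c := min_le_left _ _
    nlinarith [sq_nonneg r]
  calc (1 + r) ^ k * Real.exp (-(c * r ^ 2))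
      ≤ ((2 / a) ^ k * ((k.factorial : ℝ) * Real.exp (1 + a * r ^ 2))) *
          Real.exp (-(c * r ^ 2)) := by
        gcongr
        exact h2.trans (by gcongr)
    _ = (2 / a) ^ k *
        ((k.factorial : ℝ) * (Real.exp (1 + a * r ^ 2) * Real.exp (-(c * r ^ 2)))) := by
        ring
    _ ≤ _ := by gcongr

/-- Strong induction on the order of the derivative: the derivative of `exp (-q)` is itself times
`-q'`, and the polynomial growth of the derivatives of `q'` is paid for by a larger exponent `k`.
Hence `k` is quantified inside the induction. -/
theorem decay_cexp_neg {q : Plane → ℂ} (hq : q.HasTemperateGrowth)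
    (hq' : (fderiv ℝ q).HasTemperateGrowth) {c : ℝ} (hc : 0 < c)
    (hre : ∀ x, c * ‖x‖ ^ 2 ≤ (q x).re) (n : ℕ) :
    ∀ k : ℕ, ∃ C : ℝ, ∀ x, (1 + ‖x‖) ^ k *
      ‖iteratedFDeriv ℝ n (fun x => Complex.exp (-q x)) x‖ ≤ C := by
  have hqs : ContDiff ℝ (⊤ : ℕ∞) q := hq.1
  have hψs : ContDiff ℝ (⊤ : ℕ∞) (fun x => Complex.exp (-q x)) := hqs.neg.cexp
  have hfd : fderiv ℝ (fun x => Complex.exp (-q x)) =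
      fun x => Complex.exp (-q x) • (-fderiv ℝ q) x := by
    ext1 x
    have h1 : HasFDerivAt q (fderiv ℝ q x) x :=
      (hqs.differentiable (by simp) x).hasFDerivAt
    simpa using h1.neg.cexp.fderiv
  have hF : (-fderiv ℝ q).HasTemperateGrowth := hq'.neg
  induction n using Nat.strong_induction_on with
  | _ n ih =>
    intro k
    rcases n with _ | n
    · obtain ⟨C, hC⟩ := exists_pow_mul_exp_le hc k
      refine ⟨C, fun x => le_trans ?_ (hC ‖x‖ (norm_nonneg x))⟩
      rw [norm_iteratedFDeriv_zero, Complex.norm_exp, Complex.neg_re]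
      gcongr
      exact hre x
    · obtain ⟨l, D, hD0, hD⟩ := hF.norm_iteratedFDeriv_le_uniform n
      choose C hC using fun i : Fin (n + 1) => ih i i.2 (k + l)
      refine ⟨∑ i : Fin (n + 1), (n.choose i : ℝ) * C i * D, fun x => ?_⟩
      rw [← norm_iteratedFDeriv_fderiv, hfd]
      have h1 := norm_iteratedFDeriv_smul_le (n := n) hψs hF.1 x (by exact_mod_cast le_top)
      refine (mul_le_mul_of_nonneg_left h1 (by positivity)).trans ?_
      rw [Finset.sum_range, Finset.mul_sum]
      refine Finset.sum_le_sum fun i _ => ?_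
      have h2 := hD (n - i) (Nat.sub_le _ _) x
      calc (1 + ‖x‖) ^ k * ((n.choose i : ℝ) *
            ‖iteratedFDeriv ℝ i (fun x => Complex.exp (-q x)) x‖ *
            ‖iteratedFDeriv ℝ (n - i) (-fderiv ℝ q) x‖)
          ≤ (1 + ‖x‖) ^ k * ((n.choose i : ℝ) *
            ‖iteratedFDeriv ℝ i (fun x => Complex.exp (-q x)) x‖ * (D * (1 + ‖x‖) ^ l)) := by
            gcongr
        _ = (n.choose i : ℝ) * ((1 + ‖x‖) ^ (k + l) *
            ‖iteratedFDeriv ℝ i (fun x => Complex.exp (-q x)) x‖) * D := by ring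
        _ ≤ _ := by
            gcongr
            exact hC i x

/-- The Gaussian `exp (-q)` as a Schwartz function. -/
def gaussian (q : Plane → ℂ) (hq : q.HasTemperateGrowth)
    (hq' : (fderiv ℝ q).HasTemperateGrowth) (c : ℝ) (hc : 0 < c)
    (hre : ∀ x, c * ‖x‖ ^ 2 ≤ (q x).re) : 𝓢(Plane, ℂ) where
  toFun x := Complex.exp (-q x)
  smooth' := (show ContDiff ℝ (⊤ : ℕ∞) q from hq.1).neg.cexp
  decay' k n := by
    obtain ⟨C, hC⟩ := decay_cexp_neg hq hq' hc hre n k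
    refine ⟨C, fun x => le_trans ?_ (hC x)⟩
    gcongr
    linarith

theorem gaussian_apply (q : Plane → ℂ) (hq : q.HasTemperateGrowth)
    (hq' : (fderiv ℝ q).HasTemperateGrowth) (c : ℝ) (hc : 0 < c)
    (hre : ∀ x, c * ‖x‖ ^ 2 ≤ (q x).re) (x : Plane) :
    gaussian q hq hq' c hc hre x = Complex.exp (-q x) := rfl

/-- A real Gaussian bounded Schwartz function dominating `exp (|⟨k, x⟩| - c |x|²)`. -/
theorem memLp_exp_mul_gaussian {c : ℝ} (hc : 0 < c) (k : Plane) :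
    MemLp (fun x : Plane => Real.exp (|inner ℝ k x| - c * ‖x‖ ^ 2)) 2 volume := by
  set q : Plane → ℂ := fun x => ((c / 2 : ℝ) : ℂ) * ((‖x‖ ^ 2 : ℝ) : ℂ) with hqdef
  have hn : (fun x : Plane => ((‖x‖ ^ 2 : ℝ) : ℂ)).HasTemperateGrowth :=
    Complex.ofRealCLM.hasTemperateGrowth.comp (Function.hasTemperateGrowth_norm_sq Plane)
  have hq : q.HasTemperateGrowth := (Function.HasTemperateGrowth.const _).mul hn
  have hfd : fderiv ℝ q = fun x => ((c : ℝ) : ℂ) • Complex.ofRealCLM.comp (innerSL ℝ x) := by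
    ext1 x
    have h1 : HasFDerivAt (fun x : Plane => ‖x‖ ^ 2) (2 • innerSL ℝ x) x :=
      (hasStrictFDerivAt_norm_sq x).hasFDerivAt
    have h2 := (Complex.ofRealCLM.hasFDerivAt.comp x h1).const_mul ((c / 2 : ℝ) : ℂ)
    refine (h2.fderiv).trans ?_
    ext v
    simp
    ring
  have hq' : (fderiv ℝ q).HasTemperateGrowth := by
    rw [hfd]
    have : (fun x : Plane => ((c : ℝ) : ℂ) • Complex.ofRealCLM.comp (innerSL ℝ x)) =
        ⇑(((c : ℝ) : ℂ) • (ContinuousLinearMap.compL ℝ Plane ℝ ℂ Complex.ofRealCLM).comp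
          (innerSL ℝ : Plane →L[ℝ] Plane →L[ℝ] ℝ)) := rfl
    rw [this]
    exact ContinuousLinearMap.hasTemperateGrowth _
  have hre : ∀ x, c / 2 * ‖x‖ ^ 2 ≤ (q x).re := fun x => by
    rw [hqdef]
    simp only [← Complex.ofReal_mul, Complex.ofReal_re, le_refl]
  have hg := ((gaussian q hq hq' (c / 2) (by positivity) hre).memLp 2 volume).norm
  refine (hg.const_mul (Real.exp (‖k‖ ^ 2 / (2 * c)))).mono' ?_ ?_
  · exact (by fun_prop : Continuous fun x : Plane =>
      Real.exp (|inner ℝ k x| - c * ‖x‖ ^ 2)).aestronglyMeasurable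
  · refine Filter.Eventually.of_forall fun x => ?_
    rw [gaussian_apply, Complex.norm_exp, Real.norm_of_nonneg (Real.exp_pos _).le, ← Real.exp_add]
    apply Real.exp_le_exp.2
    have h1 := abs_real_inner_le_norm k x
    have h2 : (-q x).re = -(c / 2 * ‖x‖ ^ 2) := by
      rw [hqdef]
      simp only [← Complex.ofReal_mul, ← Complex.ofReal_neg, Complex.ofReal_re]
    have h3 : ‖k‖ * ‖x‖ ≤ ‖k‖ ^ 2 / (2 * c) + c / 2 * ‖x‖ ^ 2 := by
      have : ‖k‖ ^ 2 / (2 * c) + c / 2 * ‖x‖ ^ 2 - ‖k‖ * ‖x‖ = (‖k‖ - c * ‖x‖) ^ 2 / (2 * c) := by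
        field_simp
        ring
      have h4 : 0 ≤ (‖k‖ - c * ‖x‖) ^ 2 / (2 * c) := by positivity
      linarith
    rw [h2]
    linarith

/-- Injectivity of the Fourier transform on `L¹`. -/
theorem ae_eq_zero_of_integral_exp_eq_zero {f : Plane → ℂ} (hf : Integrable f)
    (h : ∀ k : Plane, ∫ x, Complex.exp (Complex.I * (inner ℝ k x : ℝ)) * f x = 0) :
    f =ᵐ[volume] 0 := by
  have hF : ∀ w, VectorFourier.fourierIntegral Real.fourierChar volume (innerₗ Plane) f w = 0 := by
    intro w
    rw [← h ((-2 * Real.pi) • w), VectorFourier.fourierIntegral]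
    congr 1
    ext x
    rw [Circle.smul_def, Real.fourierChar_apply, smul_eq_mul]
    congr 2
    rw [inner_smul_left, innerₗ_apply_apply, real_inner_comm]
    push_cast
    simp
    ring
  refine ae_eq_zero_of_integral_contDiff_smul_eq_zero hf.locallyIntegrable fun g hg hgc => ?_
  -- The test function is the Fourier transform of a Schwartz function `K`; moving the transform
  -- from `K` to `f` makes the integral vanish.
  set G : 𝓢(Plane, ℂ) := (hgc.comp_left (g := fun t : ℝ => (t : ℂ)) (by simp)).toSchwartzMap
    (Complex.ofRealCLM.contDiff.comp hg) with hG
  set K : 𝓢(Plane, ℂ) := FourierTransformInv.fourierInv G with hK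
  have h1 := VectorFourier.integral_fourierIntegral_smul_eq_flip (L := innerₗ Plane)
    Real.continuous_fourierChar continuous_inner hf (K.integrable (μ := volume))
  simp only [hF, zero_smul, integral_zero] at h1
  have h2 : VectorFourier.fourierIntegral Real.fourierChar volume (innerₗ Plane).flip K = G := by
    have : (FourierTransform.fourier K : 𝓢(Plane, ℂ)) = G := by
      rw [hK]; exact FourierTransform.fourier_fourierInv_eq G
    rw [← this, SchwartzMap.fourier_coe]
    rw [flip_innerₗ]
    rfl
  rw [h2] at h1
  rw [h1]
  congr 1
  ext x
  change _ = f x * (g x : ℂ)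
  rw [Complex.real_smul, mul_comm]

/-- A subspace of Schwartz functions that contains a Gaussian and is stable under multiplication by
the coordinates is total in `L²`. -/
theorem eq_zero_of_orthogonal {Φ : Submodule ℂ 𝓢(Plane, ℂ)}
    (hX : ∀ j, ∀ φ ∈ Φ, position j φ ∈ Φ) {ψ : 𝓢(Plane, ℂ)} (hψ : ψ ∈ Φ) {c : ℝ} (hc : 0 < c)
    (hdec : ∀ x, ‖ψ x‖ ≤ Real.exp (-(c * ‖x‖ ^ 2))) (h0 : ∀ x, ψ x ≠ 0)
    {u : L2Plane} (hu : ∀ φ ∈ Φ, inner ℂ (toL2 φ) u = 0) : u = 0 := by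
  have hinner : ∀ φ : 𝓢(Plane, ℂ), inner ℂ (toL2 φ) u = ∫ x, starRingEnd ℂ (φ x) * u x := by
    intro φ
    rw [L2.inner_def]
    refine integral_congr_ae ?_
    filter_upwards [φ.coeFn_toLp 2 volume] with x hx
    rw [toL2_apply, hx, RCLike.inner_apply, mul_comm]
  set f : Plane → ℂ := fun x => starRingEnd ℂ (ψ x) * u x with hf
  have hmeas : AEStronglyMeasurable f volume :=
    ((Complex.continuous_conj.comp ψ.continuous).aestronglyMeasurable).mul
      (Lp.aestronglyMeasurable u)
  have hexp : ∀ k : Plane, Integrable (fun x => Real.exp |inner ℝ k x| * ‖f x‖) := by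
    intro k
    have h1 := (memLp_exp_mul_gaussian hc k).integrable_mul (Lp.memLp u).norm
    refine h1.mono' ?_ ?_
    · exact (by fun_prop : Continuous fun x : Plane =>
        Real.exp |inner ℝ k x|).aestronglyMeasurable.mul hmeas.norm
    · refine Filter.Eventually.of_forall fun x => ?_
      rw [Real.norm_of_nonneg (by positivity), Pi.mul_apply, hf, norm_mul, RCLike.norm_conj,
        sub_eq_add_neg, Real.exp_add, mul_assoc]
      gcongr
      exact hdec x
  have hfint : Integrable f := by
    have := hexp 0
    refine this.mono' hmeas (Filter.Eventually.of_forall fun x => ?_)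
    simp
  -- Multiplication by `⟨k, x⟩` preserves `Φ`, so the orthogonality says that all directional
  -- moments of `ψ̄ u` vanish.
  have hpow : ∀ (k : Plane) (n : ℕ), ∫ x, ((inner ℝ k x : ℝ) : ℂ) ^ n * f x = 0 := by
    intro k n
    set A : 𝓢(Plane, ℂ) → 𝓢(Plane, ℂ) := fun φ =>
      ((k 0 : ℝ) : ℂ) • position 0 φ + ((k 1 : ℝ) : ℂ) • position 1 φ with hA
    have hmem : A^[n] ψ ∈ Φ := by
      induction n with
      | zero => simpa using hψ
      | succ n ih =>
        rw [Function.iterate_succ_apply']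
        exact Φ.add_mem (Φ.smul_mem _ (hX 0 _ ih)) (Φ.smul_mem _ (hX 1 _ ih))
    have hval : ∀ x, A^[n] ψ x = ((inner ℝ k x : ℝ) : ℂ) ^ n * ψ x := by
      intro x
      clear hmem
      induction n with
      | zero => simp
      | succ n ih =>
        rw [Function.iterate_succ_apply', hA]
        simp only [add_apply, smul_apply, position_apply]
        rw [hA] at ih
        rw [ih, pow_succ, PiLp.inner_apply, Fin.sum_univ_two]
        simp
        ring
    rw [← hu _ hmem, hinner]
    congr 1
    ext x
    rw [hval, map_mul, map_pow, Complex.conj_ofReal, hf, mul_assoc]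
  -- Termwise integration of the exponential series, dominated by `exp |⟨k, x⟩| ‖f‖`, which the
  -- Gaussian decay of `ψ` makes integrable.
  have hF : ∀ k : Plane, ∫ x, Complex.exp (Complex.I * (inner ℝ k x : ℝ)) * f x = 0 := by
    intro k
    have hs := hasSum_integral_of_dominated_convergence (μ := (volume : Measure Plane))
      (F := fun (n : ℕ) x => (Complex.I ^ n / n.factorial) * (((inner ℝ k x : ℝ) : ℂ) ^ n * f x))
      (f := fun x => Complex.exp (Complex.I * (inner ℝ k x : ℝ)) * f x)
      (fun n x => |inner ℝ k x| ^ n / n.factorial * ‖f x‖) ?_ ?_ ?_ ?_ ?_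
    · refine hs.unique ?_
      convert hasSum_zero with n
      rw [integral_const_mul, hpow, mul_zero]
    · intro n
      exact (((by fun_prop : Continuous fun x : Plane =>
        ((inner ℝ k x : ℝ) : ℂ) ^ n).aestronglyMeasurable).mul hmeas).const_mul _
    · intro n
      refine Filter.Eventually.of_forall fun x => ?_
      simp [mul_assoc, div_eq_inv_mul]
    · refine Filter.Eventually.of_forall fun x => ?_
      exact (Real.summable_pow_div_factorial _).mul_right _
    · refine (hexp k).congr (Filter.Eventually.of_forall fun x => ?_)
      simp only
      rw [tsum_mul_right, Real.exp_eq_exp_ℝ, NormedSpace.exp_eq_tsum_div]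
    · refine Filter.Eventually.of_forall fun x => ?_
      have h1 := (NormedSpace.expSeries_div_hasSum_exp (𝔸 := ℂ)
        (Complex.I * (inner ℝ k x : ℝ))).mul_right (f x)
      rw [← Complex.exp_eq_exp_ℂ] at h1
      have e : (fun n : ℕ => (Complex.I ^ n / n.factorial) *
          (((inner ℝ k x : ℝ) : ℂ) ^ n * f x)) =
          fun n : ℕ => (Complex.I * (inner ℝ k x : ℝ)) ^ n / n.factorial * f x := by
        ext n
        rw [mul_pow]
        ring
      rw [e]
      exact h1
  have hf0 := ae_eq_zero_of_integral_exp_eq_zero hfint hF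
  apply Lp.ext
  filter_upwards [hf0, Lp.coeFn_zero ℂ 2 (volume : Measure Plane)] with x hx hx0
  rw [hx0]
  have : starRingEnd ℂ (ψ x) * u x = 0 := hx
  rcases mul_eq_zero.1 this with h | h
  · exact absurd ((map_eq_zero _).1 h) (h0 x)
  · simpa using h

/-! ### Algebra of the magnetic ladder -/

section Ladder

variable {E : Type*} [AddCommGroup E] [Module ℂ E]

/-- The magnetic momenta `P - ½ b l X^⊥`. -/
def magP (P X : Fin 2 → E →ₗ[ℂ] E) (b : ℝ) (l : ℂ) : Fin 2 → E →ₗ[ℂ] E :=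
  ![P 0 + (b * l / 2) • X 1, P 1 - (b * l / 2) • X 0]

theorem magP_zero (P X : Fin 2 → E →ₗ[ℂ] E) (b : ℝ) (l : ℂ) :
    magP P X b l 0 = P 0 + (b * l / 2) • X 1 := rfl

theorem magP_one (P X : Fin 2 → E →ₗ[ℂ] E) (b : ℝ) (l : ℂ) :
    magP P X b l 1 = P 1 - (b * l / 2) • X 0 := rfl

/-- The magnetic oscillator in the eigenframe of the potential, with complex `l`. -/
def ham (P X : Fin 2 → E →ₗ[ℂ] E) (s : Fin 2 → ℝ) (b : ℝ) (l : ℂ) : E →ₗ[ℂ] E :=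
  sumSq (magP P X b l) +
    l ^ 2 • ((s 0 : ℂ) ^ 2 • (X 0 ∘ₗ X 0) + (s 1 : ℂ) ^ 2 • (X 1 ∘ₗ X 1))

/-- The excitations `L₀ᵐ L₁ⁿ ψ`. -/
def excitation (L : Fin 2 → E →ₗ[ℂ] E) (ψ : E) (m n : ℕ) : E := (L 0)^[m] ((L 1)^[n] ψ)

/-- The span of the excitations of order less than `N`. -/
def lowerSpan (L : Fin 2 → E →ₗ[ℂ] E) (ψ : E) (N : ℕ) : Submodule ℂ E :=
  Submodule.span ℂ {v | ∃ m n, m + n < N ∧ v = excitation L ψ m n}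

variable {L : Fin 2 → E →ₗ[ℂ] E} {ψ : E}

theorem excitation_succ_left (m n : ℕ) :
    excitation L ψ (m + 1) n = L 0 (excitation L ψ m n) := by
  simp only [excitation, Function.iterate_succ_apply']

theorem excitation_succ_right (hL : ∀ i j v, L i (L j v) = L j (L i v)) (m n : ℕ) :
    excitation L ψ m (n + 1) = L 1 (excitation L ψ m n) := by
  induction m with
  | zero => simp only [excitation, Function.iterate_zero_apply, Function.iterate_succ_apply']
  | succ m ih => rw [excitation_succ_left, ih, excitation_succ_left, hL]

theorem excitation_mem {m n N : ℕ} (h : m + n < N) : excitation L ψ m n ∈ lowerSpan L ψ N :=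
  Submodule.subset_span ⟨m, n, h, rfl⟩

theorem lowerSpan_mono {M N : ℕ} (h : M ≤ N) : lowerSpan L ψ M ≤ lowerSpan L ψ N :=
  Submodule.span_mono fun _ ⟨m, n, hmn, e⟩ => ⟨m, n, hmn.trans_le h, e⟩

theorem apply_mem_lowerSpan (hL : ∀ i j v, L i (L j v) = L j (L i v)) (k : Fin 2) {N : ℕ} {v : E}
    (hv : v ∈ lowerSpan L ψ N) : L k v ∈ lowerSpan L ψ (N + 1) := by
  refine (Submodule.span_le (p := (lowerSpan L ψ (N + 1)).comap (L k))).2 ?_ hv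
  rintro _ ⟨m, n, hmn, rfl⟩
  fin_cases k <;> simp only [Fin.zero_eta, Fin.mk_one, SetLike.mem_coe, Submodule.mem_comap]
  · rw [← excitation_succ_left]
    exact excitation_mem (by omega)
  · rw [← excitation_succ_right hL]
    exact excitation_mem (by omega)

/-- The commutation relations of a Hamiltonian `h` with linear functions `L k` of the coordinates
and the corresponding momenta `Q k`, and a ground state `ψ`. -/
structure IsLadder (h : E →ₗ[ℂ] E) (L Q : Fin 2 → E →ₗ[ℂ] E) (ω : Fin 2 → ℝ) (l : ℂ) (e : ℝ)
    (ψ : E) : Prop where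
  comm : ∀ i j v, L i (L j v) = L j (L i v)
  ham_L : ∀ k v, h (L k v) = L k (h v) - (2 * Complex.I) • Q k v
  Q_L : ∀ k m, ∃ g : ℂ, ∀ v, Q k (L m v) = L m (Q k v) - g • v
  Q_ground : ∀ k, Q k ψ = (Complex.I * l * ω k) • L k ψ
  ham_ground : h ψ = (l * e) • ψ

namespace IsLadder

variable {h : E →ₗ[ℂ] E} {Q : Fin 2 → E →ₗ[ℂ] E} {ω : Fin 2 → ℝ} {l : ℂ} {e : ℝ}

/-- On the ground state `Q k` acts as `i l ω_k L k`; commuting it past a factor `L j` costs only a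
scalar, so the relation persists modulo lower degree. -/
theorem Q_excitation (hl : IsLadder h L Q ω l e ψ) (k : Fin 2) (m n : ℕ) :
    Q k (excitation L ψ m n) - (Complex.I * l * ω k) • L k (excitation L ψ m n) ∈
      lowerSpan L ψ (m + n) := by
  have step : ∀ (j : Fin 2) (N : ℕ) (v : E), v ∈ lowerSpan L ψ (N + 1) →
      Q k v - (Complex.I * l * ω k) • L k v ∈ lowerSpan L ψ N →
      Q k (L j v) - (Complex.I * l * ω k) • L k (L j v) ∈ lowerSpan L ψ (N + 1) := by
    intro j N v hv hQ
    obtain ⟨g, hg⟩ := hl.Q_L k j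
    have e1 : Q k (L j v) - (Complex.I * l * ω k) • L k (L j v) =
        L j (Q k v - (Complex.I * l * ω k) • L k v) - g • v := by
      rw [hg, hl.comm k j, map_sub, map_smul]; abel
    rw [e1]
    exact Submodule.sub_mem _ (apply_mem_lowerSpan hl.comm j hQ) (Submodule.smul_mem _ _ hv)
  induction m with
  | zero =>
    induction n with
    | zero =>
      change Q k ψ - _ • L k ψ ∈ _
      rw [hl.Q_ground, sub_self]
      exact Submodule.zero_mem _
    | succ n ih =>
      rw [excitation_succ_right hl.comm]
      exact step 1 (0 + n) _ (excitation_mem (by omega)) ih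
  | succ m ih =>
    rw [excitation_succ_left, show m + 1 + n = m + n + 1 by omega]
    exact step 0 (m + n) _ (excitation_mem (by omega)) ih

/-- The Hamiltonian is triangular with respect to the degree. Plain monomials thus do the work of
Hermite functions: only the diagonal matters for density and for locating eigenvalues. -/
theorem ham_excitation (hl : IsLadder h L Q ω l e ψ) (m n : ℕ) :
    h (excitation L ψ m n) - (l * (e + 2 * m * ω 0 + 2 * n * ω 1)) • excitation L ψ m n ∈
      lowerSpan L ψ (m + n) := by
  have step : ∀ (j : Fin 2) (N : ℕ) (v : E) (a a' : ℂ), a' = a + 2 * ω j →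
      Q j v - (Complex.I * l * ω j) • L j v ∈ lowerSpan L ψ N →
      h v - (l * a) • v ∈ lowerSpan L ψ N →
      h (L j v) - (l * a') • L j v ∈ lowerSpan L ψ (N + 1) := by
    rintro j N v a _ rfl hQ hv
    have e1 : h (L j v) - (l * (a + 2 * ω j)) • L j v = L j (h v - (l * a) • v) -
        (2 * Complex.I) • (Q j v - (Complex.I * l * ω j) • L j v) := by
      have hI := Complex.I_mul_I
      rw [hl.ham_L, map_sub, map_smul]
      linear_combination (norm := module) (-2 * l * ω j) • hI • L j v
    rw [e1]
    exact Submodule.sub_mem _ (apply_mem_lowerSpan hl.comm j hv)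
      (Submodule.smul_mem _ _ (lowerSpan_mono (by omega) hQ))
  induction m with
  | zero =>
    induction n with
    | zero =>
      change h ψ - _ • ψ ∈ _
      rw [hl.ham_ground]
      simp
    | succ n ih =>
      rw [excitation_succ_right hl.comm]
      exact step 1 (0 + n) _ _ _ (by push_cast; ring) (hl.Q_excitation 1 0 n) ih
  | succ m ih =>
    rw [excitation_succ_left, show m + 1 + n = m + n + 1 by omega]
    exact step 0 (m + n) _ _ _ (by push_cast; ring) (hl.Q_excitation 0 m n) ih

theorem ham_first (hl : IsLadder h L Q ω l e ψ) (k : Fin 2) :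
    h (L k ψ) = (l * (e + 2 * ω k)) • L k ψ := by
  have hI := Complex.I_mul_I
  rw [hl.ham_L, hl.Q_ground, hl.ham_ground, map_smul]
  linear_combination (norm := module) (-2 * l * ω k) • hI • L k ψ

/-- Induction on the degree: modulo lower excitations `h - l ζ` multiplies an excitation by a scalar
that is nonzero off its level. In the application `K` is the orthogonal complement of a vector. -/
theorem excitation_mem_of_forall (hl : IsLadder h L Q ω l e ψ) (hl0 : l ≠ 0) {K : Submodule ℂ E}
    {ζ : ℂ} (hK : ∀ v, h v - (l * ζ) • v ∈ K)
    (hζ : ∀ m n : ℕ, ζ ≠ e + 2 * m * ω 0 + 2 * n * ω 1 ∨ excitation L ψ m n ∈ K) (m n : ℕ) :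
    excitation L ψ m n ∈ K := by
  have main : ∀ N, lowerSpan L ψ N ≤ K := by
    intro N
    induction N with
    | zero =>
      refine Submodule.span_le.2 ?_
      rintro _ ⟨m, n, hmn, rfl⟩
      omega
    | succ N ih =>
      refine Submodule.span_le.2 ?_
      rintro _ ⟨m, n, hmn, rfl⟩
      rcases hζ m n with hne | hmem
      · have h1 := ih (lowerSpan_mono (show m + n ≤ N by omega) (hl.ham_excitation m n))
        have h2 := K.sub_mem (hK (excitation L ψ m n)) h1
        have e2 : h (excitation L ψ m n) - (l * ζ) • excitation L ψ m n -
            (h (excitation L ψ m n) -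
              (l * (e + 2 * m * ω 0 + 2 * n * ω 1)) • excitation L ψ m n) =
            (l * ((e + 2 * m * ω 0 + 2 * n * ω 1) - ζ)) • excitation L ψ m n := by module
        rw [e2] at h2
        exact (K.smul_mem_iff (mul_ne_zero hl0 (sub_ne_zero.2 hne.symm))).1 h2
      · exact hmem
  exact main _ (excitation_mem (Nat.lt_succ_self _))

end IsLadder

/-- Construction of the ladder from the eigenvectors of the matrix `W` with `W Wᵀ = diag s²`. -/
theorem isLadder_ham {P X : Fin 2 → E →ₗ[ℂ] E} {s : Fin 2 → ℝ} {b : ℝ} {l : ℂ}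
    (hXX : ∀ i j v, X i (X j v) = X j (X i v))
    (hPX : ∀ i j v, P i (X j v) = X j (P i v) - (if i = j then Complex.I else 0) • v)
    {W C : Fin 2 → Fin 2 → ℂ} {ω : Fin 2 → ℝ} {e : ℝ}
    (hW00 : W 0 0 ^ 2 + W 0 1 ^ 2 = (s 0 : ℂ) ^ 2) (hW11 : W 1 0 ^ 2 + W 1 1 ^ 2 = (s 1 : ℂ) ^ 2)
    (hW01 : W 0 0 * W 1 0 + W 0 1 * W 1 1 = 0) (hWe : W 0 0 + W 1 1 = e)
    (hC0 : ∀ k, W 0 0 * C k 0 + W 0 1 * C k 1 = ω k * C k 0)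
    (hC1 : ∀ k, W 1 0 * C k 0 + W 1 1 * C k 1 = ω k * C k 1)
    (hψ0 : magP P X b l 0 ψ = (Complex.I * l) • (W 0 0 • X 0 ψ + W 1 0 • X 1 ψ))
    (hψ1 : magP P X b l 1 ψ = (Complex.I * l) • (W 0 1 • X 0 ψ + W 1 1 • X 1 ψ)) :
    IsLadder (ham P X s b l) (fun k => C k 0 • X 0 + C k 1 • X 1)
      (fun k => C k 0 • magP P X b l 0 + C k 1 • magP P X b l 1) ω l e ψ := by
  have hmX : ∀ i j v, magP P X b l i (X j v) =
      X j (magP P X b l i v) - (if i = j then Complex.I else 0) • v := by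
    intro i j v
    fin_cases i
    · simp only [Fin.zero_eta, magP_zero, LinearMap.add_apply,
        LinearMap.smul_apply, map_add, map_smul, hPX]
      rw [hXX 1 j]
      abel
    · simp only [Fin.mk_one, magP_one, LinearMap.sub_apply,
        LinearMap.smul_apply, map_sub, map_smul, hPX]
      rw [hXX 0 j]
      abel
  have hI := Complex.I_mul_I
  refine ⟨?_, ?_, ?_, ?_, ?_⟩
  · intro i j v
    simp only [LinearMap.add_apply, LinearMap.smul_apply, map_add, map_smul, hXX 1 0]
    module
  · intro k v
    simp only [ham, sumSq, LinearMap.add_apply, LinearMap.smul_apply, LinearMap.comp_apply,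
      map_add, map_smul, hmX, map_sub, hXX 1 0]
    simp only [if_true, zero_ne_one, one_ne_zero, if_false, zero_smul, sub_zero]
    module
  · intro k m
    refine ⟨Complex.I * (C k 0 * C m 0 + C k 1 * C m 1), fun v => ?_⟩
    simp only [LinearMap.add_apply, LinearMap.smul_apply, map_add, map_smul, hmX]
    simp only [if_true, zero_ne_one, one_ne_zero, if_false, zero_smul, sub_zero]
    module
  · intro k
    simp only [LinearMap.add_apply, LinearMap.smul_apply, hψ0, hψ1]
    linear_combination (norm := module) (Complex.I * l) • hC0 k • X 0 ψ +
      (Complex.I * l) • hC1 k • X 1 ψ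
  · simp only [ham, sumSq, LinearMap.add_apply, LinearMap.smul_apply, LinearMap.comp_apply]
    rw [hψ0, hψ1]
    simp only [map_add, map_smul, hmX, hψ0, hψ1]
    simp only [if_true, zero_ne_one, one_ne_zero, if_false, zero_smul, sub_zero, hXX 1 0]
    linear_combination (norm := module) (l ^ 2 * (W 0 0 ^ 2 + W 0 1 ^ 2)) • hI • X 0 (X 0 ψ) +
      (2 * l ^ 2 * (W 0 0 * W 1 0 + W 0 1 * W 1 1)) • hI • X 0 (X 1 ψ) +
      (l ^ 2 * (W 1 0 ^ 2 + W 1 1 ^ 2)) • hI • X 1 (X 1 ψ) -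
      (l ^ 2) • hW00 • X 0 (X 0 ψ) - (l ^ 2) • hW11 • X 1 (X 1 ψ) -
      (2 * l ^ 2) • hW01 • X 0 (X 1 ψ) - (l * (W 0 0 + W 1 1)) • hI • ψ + l • hWe • ψ

end Ladder

/-! ### Diagonalization of the potential -/

/-- The oscillator in the frame with angle `(c, d)`, for complex `l`. -/
def hamS (c d : ℝ) (s : Fin 2 → ℝ) (b : ℝ) (l : ℂ) : 𝓢(Plane, ℂ) →ₗ[ℂ] 𝓢(Plane, ℂ) :=
  ham (rot c d momentum) (rot c d position) s b l

/-- `(c, d)` is a unit eigenvector of `M` and `2 s₀²`, `2 s₁²` are the eigenvalues of `M`. -/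
structure IsFrame (M : Matrix (Fin 2) (Fin 2) ℝ) (c d : ℝ) (s : Fin 2 → ℝ) : Prop where
  unit : c ^ 2 + d ^ 2 = 1
  pos : ∀ j, 0 < s j
  entry00 : M 0 0 = 2 * (s 0 ^ 2 * c ^ 2 + s 1 ^ 2 * d ^ 2)
  entry01 : M 0 1 = 2 * (s 0 ^ 2 - s 1 ^ 2) * c * d
  entry10 : M 1 0 = 2 * (s 0 ^ 2 - s 1 ^ 2) * c * d
  entry11 : M 1 1 = 2 * (s 0 ^ 2 * d ^ 2 + s 1 ^ 2 * c ^ 2)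

/-- The spectral decomposition of a symmetric two-by-two matrix. The second eigenvalue is the
quadratic form at the orthogonal unit vector `(-d, c)`. -/
theorem entries_of_eigenvector {α β γ c d m : ℝ} (u : c ^ 2 + d ^ 2 = 1)
    (e0 : α * c + β * d = m * c) (e1 : β * c + γ * d = m * d) :
    α = m * c ^ 2 + (α * d ^ 2 - 2 * β * c * d + γ * c ^ 2) * d ^ 2 ∧
    β = (m - (α * d ^ 2 - 2 * β * c * d + γ * c ^ 2)) * c * d ∧
    γ = m * d ^ 2 + (α * d ^ 2 - 2 * β * c * d + γ * c ^ 2) * c ^ 2 := by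
  refine ⟨?_, ?_, ?_⟩
  · linear_combination (c ^ 3 + 2 * c * d ^ 2) * e0 + (c ^ 2 * d - 2 * c ^ 2 * d) * e1 +
      (c ^ 2 * m - α * (c ^ 2 + d ^ 2 + 1)) * u
  · linear_combination (c ^ 2 * d - d * (c ^ 2 - d ^ 2)) * e0 +
      (c * d ^ 2 + c * (c ^ 2 - d ^ 2)) * e1 + (c * d * m - β * (c ^ 2 + d ^ 2 + 1)) * u
  · linear_combination (c * d ^ 2 - 2 * c * d ^ 2) * e0 + (d ^ 3 + 2 * c ^ 2 * d) * e1 +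
      (d ^ 2 * m - γ * (c ^ 2 + d ^ 2 + 1)) * u

theorem exists_isFrame {M : Matrix (Fin 2) (Fin 2) ℝ} (hM : M.PosDef) :
    ∃ c d s, IsFrame M c d s := by
  set v := hM.isHermitian.eigenvectorBasis 0 with hv
  set m := hM.isHermitian.eigenvalues 0 with hm
  have hnorm : v 0 ^ 2 + v 1 ^ 2 = 1 := by
    have h1 : ‖v‖ = 1 := hM.isHermitian.eigenvectorBasis.norm_eq_one 0
    have h2 := EuclideanSpace.norm_sq_eq v
    rw [h1, Fin.sum_univ_two] at h2
    simpa using h2.symm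
  have heig := hM.isHermitian.mulVec_eigenvectorBasis 0
  have e0 := congrFun heig 0
  have e1 := congrFun heig 1
  simp only [Matrix.mulVec, dotProduct, Fin.sum_univ_two, Pi.smul_apply, smul_eq_mul] at e0 e1
  change M 0 0 * v 0 + M 0 1 * v 1 = m * v 0 at e0
  change M 1 0 * v 0 + M 1 1 * v 1 = m * v 1 at e1
  have hsymm : M 1 0 = M 0 1 := by
    have := hM.isHermitian.apply 0 1
    simpa using this
  have hm0 : 0 < m := hM.eigenvalues_pos 0
  set c := v 0
  set d := v 1
  set m' := M 0 0 * d ^ 2 - 2 * M 0 1 * c * d + M 1 1 * c ^ 2 with hm'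
  have hm'0 : 0 < m' := by
    have hne : (![-d, c] : Fin 2 → ℝ) ≠ 0 := by
      intro h
      have h0 := congrFun h 0
      have h1 := congrFun h 1
      simp only [Matrix.cons_val_zero, Matrix.cons_val_one, Pi.zero_apply] at h0 h1
      nlinarith
    have := hM.dotProduct_mulVec_pos hne
    simp only [Matrix.mulVec, dotProduct, Fin.sum_univ_two, star_trivial, Matrix.cons_val_zero,
      Matrix.cons_val_one, hsymm] at this
    rw [hm']
    linarith
  rw [hsymm] at e1
  have h0 : √(m / 2) ^ 2 = m / 2 := Real.sq_sqrt (by positivity)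
  have h1 : √(m' / 2) ^ 2 = m' / 2 := Real.sq_sqrt (by positivity)
  have hs : ∀ j : Fin 2, 0 < (![√(m / 2), √(m' / 2)] : Fin 2 → ℝ) j := by
    intro j
    fin_cases j
    · exact Real.sqrt_pos.2 (by positivity)
    · exact Real.sqrt_pos.2 (by positivity)
  obtain ⟨f0, f1, f2⟩ := entries_of_eigenvector hnorm e0 e1
  rw [← hm'] at f0 f1 f2
  refine ⟨c, d, ![√(m / 2), √(m' / 2)], hnorm, hs, ?_, ?_, ?_, ?_⟩ <;>
  simp only [Matrix.cons_val_zero, Matrix.cons_val_one, h0, h1, hsymm]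
  · linarith
  · linarith
  · linarith
  · linarith

/-- The vector potential `X^⊥` rotates together with `P`, so the rotation diagonalizes the potential
and leaves the kinetic part in the same form. The factor `2` in `IsFrame` cancels the `½` of the
potential. -/
theorem oscillator_eq {M : Matrix (Fin 2) (Fin 2) ℝ} {c d : ℝ} {s : Fin 2 → ℝ}
    (h : IsFrame M c d s) (b l : ℝ) (φ : 𝓢(Plane, ℂ)) :
    oscillator M b l φ = hamS c d s b l φ := by
  have hu : (c : ℂ) ^ 2 + (d : ℂ) ^ 2 = 1 := by exact_mod_cast h.unit
  simp only [oscillator, positionPerp, Fin.sum_univ_two, hamS, ham, sumSq, magP_zero, magP_one,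
    Matrix.cons_val_zero, Matrix.cons_val_one, h.entry00, h.entry01, h.entry10, h.entry11,
    add_apply, sub_apply, smul_apply, neg_apply, ContinuousLinearMap.comp_apply,
    LinearMap.comp_apply, LinearMap.add_apply, LinearMap.sub_apply, LinearMap.smul_apply,
    rot_zero_apply, rot_one_apply, map_add, map_sub, map_neg, map_smul, position_comm 1 0,
    momentum_comm 1 0]
  push_cast
  linear_combination (norm := module) (-1 : ℂ) • hu • (momentum 0 (momentum 0 φ) +
    momentum 1 (momentum 1 φ) + (b * l / 2 : ℂ) • (momentum 0 (position 1 φ) +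
    position 1 (momentum 0 φ) - momentum 1 (position 0 φ) - position 0 (momentum 1 φ)) +
    (b * l / 2 : ℂ) ^ 2 • (position 0 (position 0 φ) + position 1 (position 1 φ)))

/-! ### Gaussians -/

/-- A complex quadratic form on the plane. -/
def quad (A B D : ℂ) (x : Plane) : ℂ :=
  A * (x 0 : ℂ) ^ 2 + 2 * B * ((x 0 : ℂ) * (x 1 : ℂ)) + D * (x 1 : ℂ) ^ 2

/-- The coordinates, as complex-valued functionals. -/
def coord (j : Fin 2) : Plane →L[ℝ] ℂ :=
  Complex.ofRealCLM.comp (EuclideanSpace.proj j : Plane →L[ℝ] ℝ)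

theorem coord_apply (j : Fin 2) (x : Plane) : coord j x = (x j : ℂ) := rfl

theorem quad_hasTemperateGrowth (A B D : ℂ) : (quad A B D).HasTemperateGrowth := by
  have h := fun j => (coord j).hasTemperateGrowth
  have hc : ∀ a : ℂ, (fun _ : Plane => a).HasTemperateGrowth := fun a =>
    Function.HasTemperateGrowth.const a
  exact (((hc A).mul ((h 0).pow 2)).add ((hc (2 * B)).mul ((h 0).mul (h 1)))).add
    ((hc D).mul ((h 1).pow 2))

theorem hasFDerivAt_quad (A B D : ℂ) (x : Plane) :
    HasFDerivAt (quad A B D) ((2 * A * coord 0 x + 2 * B * coord 1 x) • coord 0 +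
      (2 * B * coord 0 x + 2 * D * coord 1 x) • coord 1) x := by
  have h0 : HasFDerivAt (fun z => coord 0 z) (coord 0) x := (coord 0).hasFDerivAt
  have h1 : HasFDerivAt (fun z => coord 1 z) (coord 1) x := (coord 1).hasFDerivAt
  have h := (((HasFDerivAt.mul h0 h0).const_mul A).add
    ((HasFDerivAt.mul h0 h1).const_mul (2 * B))).add ((HasFDerivAt.mul h1 h1).const_mul D)
  refine (h.congr_fderiv ?_).congr_of_eventuallyEq (Filter.Eventually.of_forall fun z => ?_)
  · ext v
    simp
    ring
  · simp only [quad, Pi.add_apply, Pi.mul_apply, coord_apply]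
    ring

theorem fderiv_quad_hasTemperateGrowth (A B D : ℂ) :
    (fderiv ℝ (quad A B D)).HasTemperateGrowth := by
  have e : fderiv ℝ (quad A B D) = fun x => (2 * A * coord 0 x + 2 * B * coord 1 x) • coord 0 +
      (2 * B * coord 0 x + 2 * D * coord 1 x) • coord 1 :=
    funext fun x => (hasFDerivAt_quad A B D x).fderiv
  rw [e]
  have h := fun j => (coord j).hasTemperateGrowth
  have hc : ∀ a : ℂ, (fun _ : Plane => a).HasTemperateGrowth := fun a =>
    Function.HasTemperateGrowth.const a
  exact ((((hc _).mul (h 0)).add ((hc _).mul (h 1))).smul (Function.HasTemperateGrowth.const _)).add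
    ((((hc _).mul (h 0)).add ((hc _).mul (h 1))).smul (Function.HasTemperateGrowth.const _))

theorem exists_gaussian {A B D : ℂ} {r : ℝ} (hr : 0 < r)
    (hre : ∀ x, r * ‖x‖ ^ 2 ≤ (quad A B D x).re) :
    ∃ ψ : 𝓢(Plane, ℂ), (∀ x, ψ x = Complex.exp (-quad A B D x)) ∧
      momentum 0 ψ = Complex.I • ((2 * A) • position 0 ψ + (2 * B) • position 1 ψ) ∧
      momentum 1 ψ = Complex.I • ((2 * B) • position 0 ψ + (2 * D) • position 1 ψ) := by
  set ψ := gaussian (quad A B D) (quad_hasTemperateGrowth A B D)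
    (fderiv_quad_hasTemperateGrowth A B D) r hr hre with hψ
  have hval : ∀ x, ψ x = Complex.exp (-quad A B D x) := fun x => rfl
  have hfd : ∀ x, fderiv ℝ ψ x = Complex.exp (-quad A B D x) •
      -((2 * A * coord 0 x + 2 * B * coord 1 x) • coord 0 +
      (2 * B * coord 0 x + 2 * D * coord 1 x) • coord 1) := fun x =>
    (hasFDerivAt_quad A B D x).neg.cexp.fderiv
  refine ⟨ψ, hval, ?_, ?_⟩
  · ext x
    simp only [momentum_apply, smul_apply, add_apply, position_apply, hfd, hval]
    simp [coord_apply]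
    ring
  · ext x
    simp only [momentum_apply, smul_apply, add_apply, position_apply, hfd, hval]
    simp [coord_apply]
    ring

/-! ### Ground state and completeness of its excitations -/

/-- The lowest eigenvalue of the magnetic oscillator at `l = 1`. -/
def ground (s : Fin 2 → ℝ) (b : ℝ) : ℝ := √((s 0 + s 1) ^ 2 + b ^ 2)

theorem ground_sq (s : Fin 2 → ℝ) (b : ℝ) : ground s b ^ 2 = (s 0 + s 1) ^ 2 + b ^ 2 :=
  Real.sq_sqrt (by positivity)

theorem le_ground (s : Fin 2 → ℝ) (b : ℝ) : s 0 + s 1 ≤ ground s b :=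
  Real.le_sqrt_of_sq_le (by nlinarith [sq_nonneg b])

/-- The matrix `W` with `W Wᵀ = diag s²` and `W - Wᵀ = i b J`. -/
def wMat (s : Fin 2 → ℝ) (b : ℝ) : Fin 2 → Fin 2 → ℂ :=
  ![![s 0 * ground s b / (s 0 + s 1), Complex.I * b * s 0 / (s 0 + s 1)],
    ![-Complex.I * b * s 1 / (s 0 + s 1), s 1 * ground s b / (s 0 + s 1)]]

theorem rot_position_zero_apply (c d : ℝ) (φ : 𝓢(Plane, ℂ)) (x : Plane) :
    rot c d position 0 φ x = ((c * x 0 + d * x 1 : ℝ) : ℂ) * φ x := by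
  rw [rot_zero_apply, add_apply, smul_apply, smul_apply, position_apply, position_apply]
  push_cast
  simp only [smul_eq_mul]
  ring

theorem rot_position_one_apply (c d : ℝ) (φ : 𝓢(Plane, ℂ)) (x : Plane) :
    rot c d position 1 φ x = ((-d * x 0 + c * x 1 : ℝ) : ℂ) * φ x := by
  rw [rot_one_apply, add_apply, smul_apply, smul_apply, position_apply, position_apply]
  push_cast
  simp only [smul_eq_mul]
  ring

/-- A nowhere vanishing function with Gaussian decay. -/
structure IsGaussianLike (ψ : 𝓢(Plane, ℂ)) : Prop where
  decay : ∃ a > 0, ∀ x, ‖ψ x‖ ≤ Real.exp (-(a * ‖x‖ ^ 2))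
  ne_zero : ∀ x, ψ x ≠ 0

/-- In the rotated coordinates the exponent is `l ((z₀ y₀² + z₁ y₁²) / 2 + i β y₀ y₁)`. For complex
`l` the magnetic phase `β` contributes to the real part; the condition `b ≤ c₀ σ` keeps this loss
below half of the gain. -/
theorem re_quad_rot {c d : ℝ} (hcd : c ^ 2 + d ^ 2 = 1) {σ c₀ b : ℝ} {l : ℂ}
    (hσ : 0 < σ) (hb0 : 0 ≤ b) (hb : b ≤ c₀ * σ) (hl : c₀ * ‖l‖ ≤ l.re)
    (hc₀ : 0 < c₀) {z₀ z₁ β : ℝ} (hz₀ : σ ≤ z₀) (hz₁ : σ ≤ z₁) (hβ : |β| ≤ b / 2) (x : Plane) :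
    ‖l‖ * c₀ * σ / 4 * ‖x‖ ^ 2 ≤
      (quad (l / 2 * (z₀ * c ^ 2 - 2 * (Complex.I * β) * c * d + z₁ * d ^ 2))
        (l / 2 * (z₀ * c * d + (Complex.I * β) * (c ^ 2 - d ^ 2) - z₁ * c * d))
        (l / 2 * (z₀ * d ^ 2 + 2 * (Complex.I * β) * c * d + z₁ * c ^ 2)) x).re := by
  set y₀ := c * x 0 + d * x 1 with hy₀
  set y₁ := -d * x 0 + c * x 1 with hy₁
  have e : quad (l / 2 * (z₀ * c ^ 2 - 2 * (Complex.I * β) * c * d + z₁ * d ^ 2))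
        (l / 2 * (z₀ * c * d + (Complex.I * β) * (c ^ 2 - d ^ 2) - z₁ * c * d))
        (l / 2 * (z₀ * d ^ 2 + 2 * (Complex.I * β) * c * d + z₁ * c ^ 2)) x =
      l * (((z₀ * y₀ ^ 2 + z₁ * y₁ ^ 2) / 2 : ℝ) : ℂ) +
        l * (Complex.I * ((β * (y₀ * y₁) : ℝ) : ℂ)) := by
    simp only [quad, hy₀, hy₁]
    push_cast
    ring
  have hx : ‖x‖ ^ 2 = y₀ ^ 2 + y₁ ^ 2 := by
    rw [EuclideanSpace.norm_sq_eq, Fin.sum_univ_two, Real.norm_eq_abs, Real.norm_eq_abs, sq_abs,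
      sq_abs, hy₀, hy₁]
    linear_combination (-(x 0 ^ 2 + x 1 ^ 2)) * hcd
  have e2 : (l * (((z₀ * y₀ ^ 2 + z₁ * y₁ ^ 2) / 2 : ℝ) : ℂ) +
        l * (Complex.I * ((β * (y₀ * y₁) : ℝ) : ℂ))).re =
      l.re * ((z₀ * y₀ ^ 2 + z₁ * y₁ ^ 2) / 2) - l.im * (β * (y₀ * y₁)) := by
    simp only [Complex.add_re, Complex.mul_re, Complex.mul_im, Complex.ofReal_re,
      Complex.ofReal_im, Complex.I_re, Complex.I_im]
    ring
  rw [e, e2, hx]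
  have h1 : l.im * (β * (y₀ * y₁)) ≤ ‖l‖ * (b / 2 * ((y₀ ^ 2 + y₁ ^ 2) / 2)) := by
    refine (le_abs_self _).trans ?_
    rw [abs_mul, abs_mul, abs_mul]
    have h2 : |y₀| * |y₁| ≤ (y₀ ^ 2 + y₁ ^ 2) / 2 := by
      nlinarith [sq_nonneg (|y₀| - |y₁|), sq_abs y₀, sq_abs y₁]
    have := Complex.abs_im_le_norm l
    gcongr
  have h3 : σ * (y₀ ^ 2 + y₁ ^ 2) ≤ z₀ * y₀ ^ 2 + z₁ * y₁ ^ 2 := by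
    nlinarith [mul_le_mul_of_nonneg_right hz₀ (sq_nonneg y₀),
      mul_le_mul_of_nonneg_right hz₁ (sq_nonneg y₁)]
  have h4 : c₀ * ‖l‖ * (σ * (y₀ ^ 2 + y₁ ^ 2)) ≤ l.re * (z₀ * y₀ ^ 2 + z₁ * y₁ ^ 2) :=
    mul_le_mul hl h3 (by positivity) (le_trans (by positivity) hl)
  have h5 : ‖l‖ * (b / 2 * ((y₀ ^ 2 + y₁ ^ 2) / 2)) ≤
      ‖l‖ * (c₀ * σ / 2 * ((y₀ ^ 2 + y₁ ^ 2) / 2)) := by gcongr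
  linarith

/-- The logarithmic gradient of a Gaussian is a symmetric matrix applied to `x`. The antisymmetric
part of `wMat` equals the magnetic vector potential, so the symmetric part, with diagonal `z₀`, `z₁`
and off-diagonal entry `i β`, is the exponent. -/
theorem exists_ground_state {c d : ℝ} (hcd : c ^ 2 + d ^ 2 = 1) {s : Fin 2 → ℝ} {σ c₀ b : ℝ}
    {l : ℂ} (hσ : 0 < σ) (hs : ∀ j, σ ≤ s j) (hb0 : 0 ≤ b) (hb : b ≤ c₀ * σ)
    (hl : c₀ * ‖l‖ ≤ l.re) (hc₀ : 0 < c₀) (hl0 : l ≠ 0) :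
    ∃ ψ, IsGaussianLike ψ ∧
      magP (rot c d momentum) (rot c d position) b l 0 ψ = (Complex.I * l) •
        (wMat s b 0 0 • rot c d position 0 ψ + wMat s b 1 0 • rot c d position 1 ψ) ∧
      magP (rot c d momentum) (rot c d position) b l 1 ψ = (Complex.I * l) •
        (wMat s b 0 1 • rot c d position 0 ψ + wMat s b 1 1 • rot c d position 1 ψ) := by
  have hs0 := hσ.trans_le (hs 0)
  have hs1 := hσ.trans_le (hs 1)
  have hT : 0 < s 0 + s 1 := by positivity
  have ht := le_ground s b
  have hz : ∀ j, σ ≤ s j * ground s b / (s 0 + s 1) := by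
    intro j
    rw [le_div_iff₀ hT]
    exact mul_le_mul (hs j) ht hT.le (hσ.le.trans (hs j))
  have hβ : |b * (s 0 - s 1) / (2 * (s 0 + s 1))| ≤ b / 2 := by
    rw [abs_div, abs_mul, abs_of_nonneg hb0, abs_of_pos (by positivity : 0 < 2 * (s 0 + s 1)),
      div_le_div_iff₀ (by positivity) (by positivity)]
    have : |s 0 - s 1| ≤ s 0 + s 1 := abs_le.2 ⟨by linarith, by linarith⟩
    nlinarith [mul_le_mul_of_nonneg_left this hb0]
  have hr : 0 < ‖l‖ * c₀ * σ / 4 := by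
    have := norm_pos_iff.2 hl0
    positivity
  obtain ⟨ψ, hψ, hm0, hm1⟩ := exists_gaussian hr fun x =>
    re_quad_rot hcd hσ hb0 hb hl hc₀ (hz 0) (hz 1) hβ x
  have hcd' : (c : ℂ) ^ 2 + (d : ℂ) ^ 2 = 1 := by exact_mod_cast hcd
  have hT' : (s 0 : ℂ) + s 1 ≠ 0 := by exact_mod_cast hT.ne'
  set z₀ : ℝ := s 0 * ground s b / (s 0 + s 1) with hz₀
  set z₁ : ℝ := s 1 * ground s b / (s 0 + s 1) with hz₁
  set β : ℝ := b * (s 0 - s 1) / (2 * (s 0 + s 1)) with hβ'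
  have w00 : wMat s b 0 0 = z₀ := by simp [wMat, hz₀]
  have w11 : wMat s b 1 1 = z₁ := by simp [wMat, hz₁]
  have w10 : wMat s b 1 0 = Complex.I * β - Complex.I * b / 2 := by
    simp only [wMat, hβ', Matrix.cons_val_zero, Matrix.cons_val_one]
    push_cast
    field_simp
    ring
  have w01 : wMat s b 0 1 = Complex.I * β + Complex.I * b / 2 := by
    simp only [wMat, hβ', Matrix.cons_val_zero, Matrix.cons_val_one]
    push_cast
    field_simp
    ring
  have hI := Complex.I_mul_I
  refine ⟨ψ, ⟨⟨_, hr, fun x => ?_⟩, fun x => ?_⟩, ?_, ?_⟩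
  · rw [hψ, Complex.norm_exp, Complex.neg_re]
    exact Real.exp_le_exp.2 (neg_le_neg (re_quad_rot hcd hσ hb0 hb hl hc₀ (hz 0) (hz 1) hβ x))
  · rw [hψ]
    exact Complex.exp_ne_zero _
  · rw [magP_zero, w00, w10]
    simp only [LinearMap.add_apply, LinearMap.smul_apply, rot_zero_apply, rot_one_apply, hm0, hm1]
    linear_combination (norm := module)
      (Complex.I * l * z₀ * c) • hcd' • position 0 ψ +
      (Complex.I * l * z₀ * d) • hcd' • position 1 ψ
      + (Complex.I * l * (Complex.I * β) * (-d)) • hcd' • position 0 ψ +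
      (Complex.I * l * (Complex.I * β) * c) • hcd' • position 1 ψ +
      (l * b / 2 * (-d)) • hI • position 0 ψ + (l * b / 2 * c) • hI • position 1 ψ
  · rw [magP_one, w01, w11]
    simp only [LinearMap.sub_apply, LinearMap.smul_apply, rot_zero_apply, rot_one_apply, hm0, hm1]
    linear_combination (norm := module)
      (Complex.I * l * z₁ * (-d)) • hcd' • position 0 ψ +
      (Complex.I * l * z₁ * c) • hcd' • position 1 ψ
      + (Complex.I * l * (Complex.I * β) * c) • hcd' • position 0 ψ +
      (Complex.I * l * (Complex.I * β) * d) • hcd' • position 1 ψ -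
      (l * b / 2 * c) • hI • position 0 ψ - (l * b / 2 * d) • hI • position 1 ψ

/-- Eigenvectors `C k` of `wMat s b` with the eigenvalues `ω k`, forming a basis. -/
structure IsModes (s : Fin 2 → ℝ) (b : ℝ) (ω : Fin 2 → ℝ) (C : Fin 2 → Fin 2 → ℂ) : Prop where
  eig0 : ∀ k, wMat s b 0 0 * C k 0 + wMat s b 0 1 * C k 1 = ω k * C k 0
  eig1 : ∀ k, wMat s b 1 0 * C k 0 + wMat s b 1 1 * C k 1 = ω k * C k 1
  det : C 0 0 * C 1 1 - C 0 1 * C 1 0 ≠ 0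

/-- The linear functions `C k · X` in the frame `(c, d)`. -/
def linFun (c d : ℝ) (C : Fin 2 → Fin 2 → ℂ) : Fin 2 → 𝓢(Plane, ℂ) →ₗ[ℂ] 𝓢(Plane, ℂ) :=
  fun k => C k 0 • rot c d position 0 + C k 1 • rot c d position 1

theorem linFun_ne_zero {c d : ℝ} (hcd : c ^ 2 + d ^ 2 = 1) {C : Fin 2 → Fin 2 → ℂ}
    (hC : C 0 0 * C 1 1 - C 0 1 * C 1 0 ≠ 0) (k : Fin 2) {ψ : 𝓢(Plane, ℂ)}
    (hψ : IsGaussianLike ψ) : linFun c d C k ψ ≠ 0 := by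
  intro h
  have hx : ∀ x : Plane, C k 0 * ((c * x 0 + d * x 1 : ℝ) : ℂ) +
      C k 1 * ((-d * x 0 + c * x 1 : ℝ) : ℂ) = 0 := by
    intro x
    have h1 : linFun c d C k ψ x = 0 := by rw [h]; rfl
    simp only [linFun, LinearMap.add_apply, LinearMap.smul_apply, add_apply, smul_apply,
      rot_position_zero_apply, rot_position_one_apply, smul_eq_mul] at h1
    refine (mul_eq_zero.1 (?_ : _ * ψ x = 0)).resolve_right (hψ.ne_zero x)
    rw [← h1]
    ring
  have h0 : C k 0 = 0 := by
    have := hx !₂[c, d]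
    simp only [Matrix.cons_val_zero, Matrix.cons_val_one] at this
    rw [show c * c + d * d = 1 by linarith, show -d * c + c * d = 0 by ring] at this
    simpa using this
  have h1 : C k 1 = 0 := by
    have := hx !₂[-d, c]
    simp only [Matrix.cons_val_zero, Matrix.cons_val_one] at this
    rw [show c * -d + d * c = 0 by ring, show -d * -d + c * c = 1 by linarith] at this
    simpa using this
  apply hC
  fin_cases k
  · simp only [Fin.zero_eta] at h0 h1
    rw [h0, h1]; ring
  · simp only [Fin.mk_one] at h0 h1
    rw [h0, h1]; ring

/-- The modes are an invertible linear change of the coordinates, so the span of the excitations is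
stable under multiplication by coordinates and contains a Gaussian. -/
theorem eq_zero_of_excitation {c d : ℝ} (hcd : c ^ 2 + d ^ 2 = 1) {C : Fin 2 → Fin 2 → ℂ}
    (hC : C 0 0 * C 1 1 - C 0 1 * C 1 0 ≠ 0) {ψ : 𝓢(Plane, ℂ)} (hψ : IsGaussianLike ψ)
    (hL : ∀ i j v, linFun c d C i (linFun c d C j v) = linFun c d C j (linFun c d C i v))
    {u : L2Plane} (hu : ∀ m n, inner ℂ (toL2 (excitation (linFun c d C) ψ m n)) u = 0) :
    u = 0 := by
  set Φ : Submodule ℂ 𝓢(Plane, ℂ) :=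
    Submodule.span ℂ {v | ∃ m n, v = excitation (linFun c d C) ψ m n} with hΦ
  have hLΦ : ∀ k, ∀ φ ∈ Φ, linFun c d C k φ ∈ Φ := by
    intro k φ hφ
    refine (Submodule.span_le (p := Φ.comap (linFun c d C k))).2 ?_ hφ
    rintro _ ⟨m, n, rfl⟩
    fin_cases k <;> simp only [Fin.zero_eta, Fin.mk_one, SetLike.mem_coe, Submodule.mem_comap]
    · rw [← excitation_succ_left]
      exact Submodule.subset_span ⟨_, _, rfl⟩
    · rw [← excitation_succ_right hL]
      exact Submodule.subset_span ⟨_, _, rfl⟩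
  have hcd' : (c : ℂ) ^ 2 + (d : ℂ) ^ 2 = 1 := by exact_mod_cast hcd
  -- Cramer's rule recovers the determinant times a rotated coordinate from the two modes.
  have hrot : ∀ j, ∀ φ ∈ Φ, rot c d position j φ ∈ Φ := by
    intro j φ hφ
    refine (Φ.smul_mem_iff hC).1 ?_
    have h0 := hLΦ 0 φ hφ
    have h1 := hLΦ 1 φ hφ
    fin_cases j
    · have := Φ.sub_mem (Φ.smul_mem (C 1 1) h0) (Φ.smul_mem (C 0 1) h1)
      convert this using 1
      simp only [linFun, LinearMap.add_apply, LinearMap.smul_apply, Fin.zero_eta]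
      module
    · have := Φ.sub_mem (Φ.smul_mem (C 0 0) h1) (Φ.smul_mem (C 1 0) h0)
      convert this using 1
      simp only [linFun, LinearMap.add_apply, LinearMap.smul_apply, Fin.mk_one]
      module
  have hpos : ∀ j, ∀ φ ∈ Φ, position j φ ∈ Φ := by
    intro j φ hφ
    have h0 := hrot 0 φ hφ
    have h1 := hrot 1 φ hφ
    fin_cases j
    · have := Φ.sub_mem (Φ.smul_mem (c : ℂ) h0) (Φ.smul_mem (d : ℂ) h1)
      convert this using 1
      simp only [rot_zero_apply, rot_one_apply, Fin.zero_eta]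
      linear_combination (norm := module) (-1 : ℂ) • hcd' • position 0 φ
    · have := Φ.add_mem (Φ.smul_mem (d : ℂ) h0) (Φ.smul_mem (c : ℂ) h1)
      convert this using 1
      simp only [rot_zero_apply, rot_one_apply, Fin.mk_one]
      linear_combination (norm := module) (-1 : ℂ) • hcd' • position 1 φ
  obtain ⟨a, ha, hdec⟩ := hψ.decay
  refine eq_zero_of_orthogonal hpos (Submodule.subset_span ⟨0, 0, rfl⟩) ha hdec hψ.ne_zero ?_
  intro φ hφ
  have hle : Φ ≤ ((ℂ ∙ u)ᗮ).comap toL2 := by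
    refine Submodule.span_le.2 ?_
    rintro _ ⟨m, n, rfl⟩
    exact Submodule.mem_orthogonal_singleton_iff_inner_left.2 (hu m n)
  exact Submodule.mem_orthogonal_singleton_iff_inner_left.1 (hle hφ)

/-- The ladder of the magnetic oscillator, and the completeness of its excitations. -/
theorem exists_ladder {c d : ℝ} (hcd : c ^ 2 + d ^ 2 = 1) {s : Fin 2 → ℝ} {σ c₀ b : ℝ}
    {l : ℂ} (hσ : 0 < σ) (hs : ∀ j, σ ≤ s j) (hb0 : 0 ≤ b) (hb : b ≤ c₀ * σ)
    (hl : c₀ * ‖l‖ ≤ l.re) (hc₀ : 0 < c₀) (hl0 : l ≠ 0) {ω : Fin 2 → ℝ} {C : Fin 2 → Fin 2 → ℂ}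
    (hC : IsModes s b ω C) :
    ∃ L Q ψ, IsLadder (hamS c d s b l) L Q ω l (ground s b) ψ ∧ ψ ≠ 0 ∧ (∀ k, L k ψ ≠ 0) ∧
      ∀ u : L2Plane, (∀ m n, inner ℂ (toL2 (excitation L ψ m n)) u = 0) → u = 0 := by
  obtain ⟨ψ, hψ, h0, h1⟩ := exists_ground_state hcd hσ hs hb0 hb hl hc₀ hl0
  have hT : (s 0 : ℂ) + s 1 ≠ 0 := by
    have := hσ.trans_le (hs 0)
    have := hσ.trans_le (hs 1)
    have h : s 0 + s 1 ≠ 0 := by positivity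
    exact_mod_cast h
  have hsq : (ground s b : ℂ) ^ 2 = (s 0 + s 1 : ℂ) ^ 2 + (b : ℂ) ^ 2 := by
    exact_mod_cast ground_sq s b
  have hI := Complex.I_sq
  have hlad : IsLadder (hamS c d s b l) (linFun c d C)
      (fun k => C k 0 • magP (rot c d momentum) (rot c d position) b l 0 +
        C k 1 • magP (rot c d momentum) (rot c d position) b l 1) ω l (ground s b) ψ := by
    refine isLadder_ham (W := wMat s b) ?_ (rot_momentum_position hcd) ?_ ?_ ?_ ?_ hC.eig0 hC.eig1
      h0 h1
    · exact rot_comm c d position_comm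
    · simp only [wMat, Matrix.cons_val_zero, Matrix.cons_val_one]
      field_simp
      linear_combination (s 0 : ℂ) ^ 2 * hsq + (s 0 : ℂ) ^ 2 * (b : ℂ) ^ 2 * hI
    · simp only [wMat, Matrix.cons_val_zero, Matrix.cons_val_one]
      field_simp
      linear_combination (s 1 : ℂ) ^ 2 * hsq + (s 1 : ℂ) ^ 2 * (b : ℂ) ^ 2 * hI
    · simp only [wMat, Matrix.cons_val_zero, Matrix.cons_val_one]
      field_simp
      ring
    · simp only [wMat, Matrix.cons_val_zero, Matrix.cons_val_one]
      field_simp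
  refine ⟨_, _, ψ, hlad, ?_, fun k => linFun_ne_zero hcd hC.det k hψ, fun u hu =>
    eq_zero_of_excitation hcd hC.det hψ hlad.comm hu⟩
  intro h
  exact hψ.ne_zero 0 (by rw [h]; rfl)

/-! ### Frequencies and modes -/

/-- The frequencies of the magnetic oscillator at `l = 1`. -/
def freq (s : Fin 2 → ℝ) (b : ℝ) : Fin 2 → ℝ :=
  ![(ground s b + √((s 0 - s 1) ^ 2 + b ^ 2)) / 2, (ground s b - √((s 0 - s 1) ^ 2 + b ^ 2)) / 2]

theorem freq_zero (s : Fin 2 → ℝ) (b : ℝ) :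
    freq s b 0 = (ground s b + √((s 0 - s 1) ^ 2 + b ^ 2)) / 2 := rfl

theorem freq_one (s : Fin 2 → ℝ) (b : ℝ) :
    freq s b 1 = (ground s b - √((s 0 - s 1) ^ 2 + b ^ 2)) / 2 := rfl

theorem isModes_zero {s : Fin 2 → ℝ} (hs : ∀ j, 0 < s j) :
    IsModes s 0 s ![![1, 0], ![0, 1]] := by
  have hT : (s 0 : ℂ) + s 1 ≠ 0 := by
    have := hs 0
    have := hs 1
    have h : s 0 + s 1 ≠ 0 := by positivity
    exact_mod_cast h
  have hg : ground s 0 = s 0 + s 1 := by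
    have := hs 0
    have := hs 1
    simp only [ground, ne_eq, OfNat.ofNat_ne_zero, not_false_eq_true, zero_pow, add_zero]
    exact Real.sqrt_sq (by positivity)
  refine ⟨fun k => ?_, fun k => ?_, by simp⟩ <;> fin_cases k <;>
  simp [wMat, hg] <;> field_simp

/-- The characteristic equation of `wMat s b`, whose trace is `ground s b` and whose determinant is
`s 0 * s 1`. -/
theorem freq_mul (s : Fin 2 → ℝ) (b : ℝ) (k : Fin 2) :
    freq s b k ^ 2 = ground s b * freq s b k - s 0 * s 1 := by
  have h1 := ground_sq s b
  have h2 : √((s 0 - s 1) ^ 2 + b ^ 2) ^ 2 = (s 0 - s 1) ^ 2 + b ^ 2 :=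
    Real.sq_sqrt (by positivity)
  fin_cases k
  · simp only [Fin.zero_eta, freq_zero]
    linear_combination (h2 - h1) / 4
  · simp only [Fin.mk_one, freq_one]
    linear_combination (h2 - h1) / 4

theorem freq_pos {s : Fin 2 → ℝ} (hs : ∀ j, 0 < s j) (b : ℝ) (k : Fin 2) : 0 < freq s b k := by
  have h0 := hs 0
  have h1 := hs 1
  have h : √((s 0 - s 1) ^ 2 + b ^ 2) < ground s b :=
    Real.sqrt_lt_sqrt (by positivity) (by nlinarith [mul_pos h0 h1])
  have h2 := Real.sqrt_nonneg ((s 0 - s 1) ^ 2 + b ^ 2)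
  fin_cases k
  · simp only [Fin.zero_eta, freq_zero]
    linarith
  · simp only [Fin.mk_one, freq_one]
    linarith

theorem freq_one_le (s : Fin 2 → ℝ) (b : ℝ) (k : Fin 2) : freq s b 1 ≤ freq s b k := by
  have h2 := Real.sqrt_nonneg ((s 0 - s 1) ^ 2 + b ^ 2)
  fin_cases k
  · simp only [freq, Fin.zero_eta, Matrix.cons_val_zero, Matrix.cons_val_one]
    linarith
  · exact le_rfl

/-- For `b > 0` the off-diagonal entry of `wMat` is nonzero and the frequencies are distinct even if
`s 0 = s 1`, so these eigenvectors form a basis. They degenerate at `b = 0`, which is why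
`isModes_zero` is separate. -/
theorem isModes_freq {s : Fin 2 → ℝ} (hs : ∀ j, 0 < s j) {b : ℝ} (hb : 0 < b) :
    IsModes s b (freq s b) (fun k => ![wMat s b 0 1, freq s b k - wMat s b 0 0]) := by
  have h0 := hs 0
  have h1 := hs 1
  have hT : (s 0 : ℂ) + s 1 ≠ 0 := by
    have h : s 0 + s 1 ≠ 0 := by positivity
    exact_mod_cast h
  have hsq : (ground s b : ℂ) ^ 2 = (s 0 + s 1 : ℂ) ^ 2 + (b : ℂ) ^ 2 := by
    exact_mod_cast ground_sq s b
  have hI := Complex.I_sq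
  have htr : wMat s b 0 0 + wMat s b 1 1 = ground s b := by
    simp only [wMat, Matrix.cons_val_zero, Matrix.cons_val_one]
    field_simp
  have hdet : wMat s b 0 0 * wMat s b 1 1 - wMat s b 0 1 * wMat s b 1 0 = s 0 * s 1 := by
    simp only [wMat, Matrix.cons_val_zero, Matrix.cons_val_one]
    field_simp
    linear_combination (s 0 * s 1 : ℂ) * (hsq + (b : ℂ) ^ 2 * hI)
  refine ⟨fun k => ?_, fun k => ?_, ?_⟩
  · simp only [Matrix.cons_val_zero, Matrix.cons_val_one]
    ring
  · have hq : (freq s b k : ℂ) ^ 2 = ground s b * freq s b k - s 0 * s 1 := by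
      exact_mod_cast freq_mul s b k
    simp only [Matrix.cons_val_zero, Matrix.cons_val_one]
    linear_combination (freq s b k : ℂ) * htr - hdet - hq
  · simp only [Matrix.cons_val_zero, Matrix.cons_val_one]
    have e : wMat s b 0 1 * (freq s b 1 - wMat s b 0 0) -
        (freq s b 0 - wMat s b 0 0) * wMat s b 0 1 =
        wMat s b 0 1 * ((-√((s 0 - s 1) ^ 2 + b ^ 2) : ℝ) : ℂ) := by
      simp only [freq, Matrix.cons_val_zero, Matrix.cons_val_one]
      push_cast
      ring
    rw [e]
    refine mul_ne_zero ?_ ?_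
    · simp only [wMat, Matrix.cons_val_zero, Matrix.cons_val_one]
      have hb' : (b : ℂ) ≠ 0 := by exact_mod_cast hb.ne'
      have h0' : (s 0 : ℂ) ≠ 0 := by exact_mod_cast h0.ne'
      exact div_ne_zero (mul_ne_zero (mul_ne_zero Complex.I_ne_zero hb') h0') hT
    · have : 0 < √((s 0 - s 1) ^ 2 + b ^ 2) := Real.sqrt_pos.2 (by positivity)
      exact_mod_cast (neg_ne_zero.2 this.ne')

/-- A vector orthogonal to the range of `h - l ζ` and to the excitations at the level `ζ`
vanishes. -/
theorem IsLadder.eq_zero_of_orthogonal_range {h : 𝓢(Plane, ℂ) →ₗ[ℂ] 𝓢(Plane, ℂ)}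
    {L Q : Fin 2 → 𝓢(Plane, ℂ) →ₗ[ℂ] 𝓢(Plane, ℂ)} {ω : Fin 2 → ℝ} {l : ℂ} {e : ℝ}
    {ψ : 𝓢(Plane, ℂ)} (hl : IsLadder h L Q ω l e ψ) (hl0 : l ≠ 0)
    (hcompl : ∀ u : L2Plane, (∀ m n, inner ℂ (toL2 (excitation L ψ m n)) u = 0) → u = 0)
    {ζ : ℂ} {u : L2Plane} (hu : ∀ φ, inner ℂ (toL2 (h φ - (l * ζ) • φ)) u = 0)
    (hζ : ∀ m n : ℕ, ζ ≠ e + 2 * m * ω 0 + 2 * n * ω 1 ∨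
      inner ℂ (toL2 (excitation L ψ m n)) u = 0) : u = 0 := by
  refine hcompl u fun m n => ?_
  have := hl.excitation_mem_of_forall (K := ((ℂ ∙ u)ᗮ).comap toL2) hl0
    (fun v => Submodule.mem_orthogonal_singleton_iff_inner_left.2 (hu v))
    (fun m n => (hζ m n).imp id fun h =>
      Submodule.mem_orthogonal_singleton_iff_inner_left.2 h) m n
  exact Submodule.mem_orthogonal_singleton_iff_inner_left.1 this

theorem denseRange_of_orthogonal {T : 𝓢(Plane, ℂ) →ₗ[ℂ] L2Plane}
    (h : ∀ u, (∀ φ, inner ℂ (T φ) u = 0) → u = 0) : DenseRange T := by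
  have hbot : (LinearMap.range T)ᗮ = ⊥ := by
    refine (Submodule.eq_bot_iff _).2 fun u hu => h u fun φ => ?_
    exact (Submodule.mem_orthogonal _ _).1 hu _ ⟨φ, rfl⟩
  have := Submodule.dense_iff_topologicalClosure_eq_top.2
    ((Submodule.topologicalClosure_eq_top_iff).2 hbot)
  rwa [LinearMap.coe_range] at this

theorem denseRange_hamS_sub {c d : ℝ} (hcd : c ^ 2 + d ^ 2 = 1) {s : Fin 2 → ℝ} {σ c₀ b : ℝ}
    {l : ℂ} (hσ : 0 < σ) (hs : ∀ j, σ ≤ s j) (hb0 : 0 ≤ b) (hb : b ≤ c₀ * σ)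
    (hl : c₀ * ‖l‖ ≤ l.re) (hc₀ : 0 < c₀) (hl0 : l ≠ 0) {ω : Fin 2 → ℝ} {C : Fin 2 → Fin 2 → ℂ}
    (hC : IsModes s b ω C) {ζ : ℂ}
    (hζ : ∀ m n : ℕ, ζ ≠ ground s b + 2 * m * ω 0 + 2 * n * ω 1) :
    DenseRange fun φ => toL2 (hamS c d s b l φ - (l * ζ) • φ) := by
  obtain ⟨L, Q, ψ, hL, -, -, hcompl⟩ := exists_ladder hcd hσ hs hb0 hb hl hc₀ hl0 hC
  have e : (fun φ => toL2 (hamS c d s b l φ - (l * ζ) • φ)) =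
      ⇑(toL2 ∘ₗ (hamS c d s b l - (l * ζ) • LinearMap.id)) := funext fun φ => by
    simp only [LinearMap.comp_apply, LinearMap.sub_apply, LinearMap.smul_apply, LinearMap.id_apply]
  rw [e]
  refine denseRange_of_orthogonal fun u hu => hL.eq_zero_of_orthogonal_range hl0 hcompl
    (fun φ => ?_) fun m n => Or.inl (hζ m n)
  rw [← hu φ, ← congrFun e φ]

/-! ### The two lowest eigenvalues -/

theorem IsEigenvector.orthogonal_range {A : SchwartzOp} {E : ℝ} {u : L2Plane}
    (h : IsEigenvector A E u) (φ : 𝓢(Plane, ℂ)) :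
    inner ℂ (toL2 (A φ - (E : ℂ) • φ)) u = 0 := by
  have h1 := h.2 φ
  rw [map_sub, map_smul, inner_sub_left, inner_smul_left, Complex.conj_ofReal, toL2_apply,
    toL2_apply, h1, inner_smul_right, sub_self]

theorem oscillator_symm {M : Matrix (Fin 2) (Fin 2) ℝ} {c d : ℝ} {s : Fin 2 → ℝ}
    (h : IsFrame M c d s) (b l : ℝ) (φ ψ : 𝓢(Plane, ℂ)) :
    inner ℂ (toL2 (oscillator M b l φ)) (toL2 ψ) =
      inner ℂ (toL2 φ) (toL2 (oscillator M b l ψ)) := by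
  have hX := rot_symm c d position_symm
  have hP := rot_symm c d momentum_symm
  have e : (b * l / 2 : ℂ) = ((b * l / 2 : ℝ) : ℂ) := by push_cast; ring
  have hm : ∀ j φ ψ, inner ℂ (toL2 (magP (rot c d momentum) (rot c d position) b l j φ)) (toL2 ψ) =
      inner ℂ (toL2 φ) (toL2 (magP (rot c d momentum) (rot c d position) b l j ψ)) := by
    intro j φ ψ
    fin_cases j
    · simp only [Fin.zero_eta, magP_zero, LinearMap.add_apply, LinearMap.smul_apply, map_add,
        map_smul, inner_add_left, inner_add_right, inner_smul_left, inner_smul_right, hX, hP, e,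
        Complex.conj_ofReal]
    · simp only [Fin.mk_one, magP_one, LinearMap.sub_apply, LinearMap.smul_apply, map_sub,
        map_smul, inner_sub_left, inner_sub_right, inner_smul_left, inner_smul_right, hX, hP, e,
        Complex.conj_ofReal]
  simp only [oscillator_eq h, hamS, ham, sumSq, LinearMap.add_apply, LinearMap.smul_apply,
    LinearMap.comp_apply, map_add, map_smul, inner_add_left, inner_add_right, inner_smul_left,
    inner_smul_right, hm, hX, map_pow, Complex.conj_ofReal]

theorem acts_toL2 {A : SchwartzOp}
    (hA : ∀ φ ψ, inner ℂ (toL2 (A φ)) (toL2 ψ) = inner ℂ (toL2 φ) (toL2 (A ψ)))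
    (φ : 𝓢(Plane, ℂ)) : Acts A (toL2 φ) (toL2 (A φ)) := fun ψ => hA ψ φ

theorem isEigenvector_toL2 {A : SchwartzOp}
    (hA : ∀ φ ψ, inner ℂ (toL2 (A φ)) (toL2 ψ) = inner ℂ (toL2 φ) (toL2 (A ψ)))
    {φ : 𝓢(Plane, ℂ)} {E : ℝ} (h0 : φ ≠ 0) (h : A φ = (E : ℂ) • φ) :
    IsEigenvector A E (toL2 φ) := by
  refine ⟨fun h => h0 (toL2_injective (by rw [h, map_zero])), ?_⟩
  have := acts_toL2 hA φ
  rwa [h, map_smul] at this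

/-- The ladder supplies eigenvectors at both values. Conversely, an eigenvector is orthogonal to the
range of the shifted operator, so its eigenvalue must be a level; the ground level is simple because
only `ψ` is resonant there. -/
theorem eigenvalue_eq {M : Matrix (Fin 2) (Fin 2) ℝ} {c d : ℝ} {s : Fin 2 → ℝ}
    (h : IsFrame M c d s) {σ c₀ b : ℝ} (hσ : 0 < σ) (hs : ∀ j, σ ≤ s j) (hb0 : 0 < b)
    (hc₀ : 0 < c₀) (hc₁ : c₀ ≤ 1) (hb : b ≤ c₀ * σ) :
    eigenvalue M b 0 = ground s b ∧ eigenvalue M b 1 = ground s b + 2 * freq s b 1 := by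
  have hs0 : ∀ j, 0 < s j := fun j => hσ.trans_le (hs j)
  obtain ⟨L, Q, ψ, hL, hψ0, hLψ, hcompl⟩ := exists_ladder h.unit hσ hs hb0.le hb
    (l := 1) (by simpa using hc₁) hc₀ one_ne_zero (isModes_freq hs0 hb0)
  have hsym := oscillator_symm h b 1
  have hosc : ∀ φ, oscillator M b 1 φ = hamS c d s b 1 φ := fun φ => by
    have := oscillator_eq h b 1 φ
    rwa [Complex.ofReal_one] at this
  have hω : ∀ k, freq s b 1 ≤ freq s b k := freq_one_le s b
  have hω1 : 0 < freq s b 1 := freq_pos hs0 b 1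
  have hlev : ∀ (E : ℝ) (u : L2Plane), IsEigenvector (oscillator M b 1) E u →
      ∃ m n : ℕ, E = ground s b + 2 * m * freq s b 0 + 2 * n * freq s b 1 := by
    intro E u hu
    by_contra! hne
    refine hu.1 (hL.eq_zero_of_orthogonal_range one_ne_zero hcompl (ζ := E) (fun φ => ?_)
      fun m n => Or.inl ?_)
    · rw [one_mul, ← hosc]
      exact hu.orthogonal_range φ
    · exact_mod_cast hne m n
  have hlev2 : ∀ (E : ℝ) (u : L2Plane), IsEigenvector (oscillator M b 1) E u →
      E < ground s b + 2 * freq s b 1 → E = ground s b := by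
    intro E u hu hlt
    obtain ⟨m, n, rfl⟩ := hlev E u hu
    have hm : m = 0 := by
      by_contra hm
      have : (1 : ℝ) ≤ m := by exact_mod_cast Nat.one_le_iff_ne_zero.2 hm
      have h2 := mul_le_mul this (hω 0) hω1.le (by positivity)
      have h3 : 0 ≤ (n : ℝ) * freq s b 1 := by positivity
      linarith
    have hn : n = 0 := by
      by_contra hn
      have : (1 : ℝ) ≤ n := by exact_mod_cast Nat.one_le_iff_ne_zero.2 hn
      have h2 := mul_le_mul this le_rfl hω1.le (by positivity)
      have h3 : 0 ≤ (m : ℝ) * freq s b 0 := mul_nonneg m.cast_nonneg (freq_pos hs0 b 0).le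
      linarith
    simp [hm, hn]
  have hge : ∀ (E : ℝ) (u : L2Plane), IsEigenvector (oscillator M b 1) E u → ground s b ≤ E := by
    intro E u hu
    by_contra! hlt
    exact hlt.ne (hlev2 E u hu (by linarith))
  have hsimple : ∀ u : L2Plane,
      (∀ φ, inner ℂ (toL2 (oscillator M b 1 φ - (ground s b : ℂ) • φ)) u = 0) →
      inner ℂ (toL2 ψ) u = 0 → u = 0 := by
    intro u hu hψu
    refine hL.eq_zero_of_orthogonal_range one_ne_zero hcompl (ζ := ground s b) (fun φ => ?_)
      fun m n => ?_
    · rw [one_mul, ← hosc]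
      exact hu φ
    · by_cases hmn : m = 0 ∧ n = 0
      · refine Or.inr ?_
        rw [hmn.1, hmn.2]
        exact hψu
      · refine Or.inl ?_
        intro he
        have he' : ground s b = ground s b + 2 * m * freq s b 0 + 2 * n * freq s b 1 := by
          exact_mod_cast he
        have p0 := freq_pos hs0 b 0
        have hm : (m : ℝ) * freq s b 0 = 0 := by
          have h1 : 0 ≤ (n : ℝ) * freq s b 1 := by positivity
          have h2 : 0 ≤ (m : ℝ) * freq s b 0 := by positivity
          linarith
        have hn : (n : ℝ) * freq s b 1 = 0 := by linarith
        refine hmn ⟨?_, ?_⟩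
        · exact_mod_cast (mul_eq_zero.1 hm).resolve_right p0.ne'
        · exact_mod_cast (mul_eq_zero.1 hn).resolve_right hω1.ne'
  have hev0 : IsEigenvector (oscillator M b 1) (ground s b) (toL2 ψ) := by
    refine isEigenvector_toL2 hsym hψ0 ?_
    rw [hosc, hL.ham_ground, one_mul]
  have hev1 : IsEigenvector (oscillator M b 1) (ground s b + 2 * freq s b 1)
      (toL2 (L 1 ψ)) := by
    refine isEigenvector_toL2 hsym (hLψ 1) ?_
    rw [hosc, hL.ham_first, one_mul]
    push_cast
    rfl
  constructor
  · have : Subsingleton (Fin (0 + 1)) := inferInstanceAs (Subsingleton (Fin 1))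
    refine IsLeast.csInf_eq ⟨⟨fun _ => toL2 ψ, ?_, fun _ => ⟨_, le_rfl, hev0⟩⟩, ?_⟩
    · exact LinearIndependent.of_subsingleton 0 hev0.1
    · rintro t ⟨v, -, hv⟩
      obtain ⟨E, hE, hu⟩ := hv 0
      exact (hge E _ hu).trans hE
  · refine IsLeast.csInf_eq ⟨⟨![toL2 ψ, toL2 (L 1 ψ)], ?_, ?_⟩, ?_⟩
    · rw [LinearIndependent.pair_iff]
      intro a a' haa
      have h1 : a • ψ + a' • L 1 ψ = 0 := toL2_injective (by
        rw [map_add, map_smul, map_smul, haa, map_zero])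
      have h2 := congrArg (hamS c d s b 1) h1
      rw [map_add, map_smul, map_smul, hL.ham_ground, hL.ham_first, map_zero] at h2
      have h3 : (a' * (2 * freq s b 1)) • L 1 ψ = 0 := by
        linear_combination (norm := module) h2 - (ground s b : ℂ) • h1
      have h4 : a' = 0 := by
        have := (smul_eq_zero.1 h3).resolve_right (hLψ 1)
        refine (mul_eq_zero.1 this).resolve_right ?_
        exact_mod_cast (by positivity : (2 * freq s b 1) ≠ 0)
      rw [h4, zero_smul, add_zero] at h1
      exact ⟨(smul_eq_zero.1 h1).resolve_right hψ0, h4⟩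
    · intro i
      fin_cases i
      · exact ⟨_, by linarith, hev0⟩
      · exact ⟨_, le_rfl, hev1⟩
    · rintro t ⟨v, hli, hv⟩
      by_contra! hlt
      have hor : ∀ i : Fin (1 + 1), ∀ φ,
          inner ℂ (toL2 (oscillator M b 1 φ - (ground s b : ℂ) • φ)) (v i) = 0 := by
        intro i
        obtain ⟨E, hE, hu⟩ := hv i
        have := hlev2 E _ hu (hE.trans_lt hlt)
        rw [← this]
        exact hu.orthogonal_range
      set a := inner ℂ (toL2 ψ) (v 0) with ha
      set a' := inner ℂ (toL2 ψ) (v 1) with ha'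
      -- Both vectors belong to the ground level; this combination is orthogonal to `ψ`, hence zero,
      -- contradicting independence.
      have hz : a' • v 0 + (-a) • v 1 = 0 := by
        refine hsimple _ (fun φ => ?_) ?_
        · rw [inner_add_right, inner_smul_right, inner_smul_right, hor, hor]
          ring
        · rw [inner_add_right, inner_smul_right, inner_smul_right, ← ha, ← ha']
          ring
      have hli' : LinearIndependent ℂ ![v 0, v 1] := by
        convert hli using 1
        ext i
        fin_cases i <;> rfl
      have hz2 := LinearIndependent.pair_iff.1 hli' _ _ hz
      have hv0 : v 0 = 0 := hsimple _ (hor 0) (by rw [← ha]; simpa using hz2.2)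
      exact hli.ne_zero 0 hv0

/-! ### Scaling and the magnetic perturbation -/

/-- The rotated momenta, scaled by `r⁻¹`. -/
def scaledP (c d r : ℝ) : Fin 2 → 𝓢(Plane, ℂ) →ₗ[ℂ] 𝓢(Plane, ℂ) :=
  fun j => ((r⁻¹ : ℝ) : ℂ) • rot c d momentum j

/-- The rotated positions, scaled by `s r`. -/
def scaledX (c d : ℝ) (s : Fin 2 → ℝ) (r : ℝ) : Fin 2 → 𝓢(Plane, ℂ) →ₗ[ℂ] 𝓢(Plane, ℂ) :=
  fun j => ((s j * r : ℝ) : ℂ) • rot c d position j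

/-- The second order norm at the scale `l`. -/
def size (c d : ℝ) (s : Fin 2 → ℝ) (l : ℂ) (w : 𝓢(Plane, ℂ)) : ℝ :=
  norm2 toL2 (scaledP c d √‖l‖) (scaledX c d s √‖l‖) w

theorem hamS_zero_eq_harm (c d : ℝ) (s : Fin 2 → ℝ) {l : ℂ} (hl : l ≠ 0) (φ : 𝓢(Plane, ℂ)) :
    hamS c d s 0 l φ =
      l • harm (scaledP c d √‖l‖) (scaledX c d s √‖l‖) (l / ‖l‖) φ := by
  have hn : (0 : ℝ) < ‖l‖ := norm_pos_iff.2 hl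
  have hr : (0 : ℝ) < √‖l‖ := Real.sqrt_pos.2 hn
  have hr2 : ((√‖l‖ : ℝ) : ℂ) ^ 2 = (‖l‖ : ℂ) := by
    exact_mod_cast Real.sq_sqrt hn.le
  have hr0 : ((√‖l‖ : ℝ) : ℂ) ≠ 0 := by exact_mod_cast hr.ne'
  have hll : l * starRingEnd ℂ l = ((√‖l‖ : ℝ) : ℂ) ^ 4 := by
    rw [Complex.mul_conj, Complex.normSq_eq_norm_sq]
    push_cast
    rw [← hr2]
    ring
  have h1 : l * (starRingEnd ℂ l / ((√‖l‖ : ℝ) : ℂ) ^ 2) * (((√‖l‖ : ℝ) : ℂ)⁻¹ ^ 2) = 1 := by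
    field_simp
    exact hll
  have h2 : (((√‖l‖ : ℝ) : ℂ) ^ 2)⁻¹ * ((√‖l‖ : ℝ) : ℂ) ^ 2 = 1 :=
    inv_mul_cancel₀ (pow_ne_zero 2 hr0)
  simp only [hamS, ham, harm, sumSq, magP_zero, magP_one, scaledP, scaledX, LinearMap.add_apply,
    LinearMap.smul_apply, LinearMap.comp_apply, map_smul, map_div₀,
    Complex.conj_ofReal, Complex.ofReal_zero, zero_mul, zero_div, zero_smul, add_zero, sub_zero]
  rw [← hr2]
  push_cast
  linear_combination (norm := skip) (-1 : ℂ) • h1 • (rot c d momentum 0 (rot c d momentum 0 φ)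
    + rot c d momentum 1 (rot c d momentum 1 φ)) - l ^ 2 • h2 • ((s 0 : ℂ) ^ 2 •
    rot c d position 0 (rot c d position 0 φ) + (s 1 : ℂ) ^ 2 •
    rot c d position 1 (rot c d position 1 φ))
  module

/-- Expanding the square leaves an angular momentum term of order `b l` and a quadratic potential of
order `b² l²`. In scaled variables both are `l` times second-order monomials whose coefficients are
bounded uniformly in `l`. -/
theorem hamS_eq_hamS_zero_add (c d : ℝ) (s : Fin 2 → ℝ) (hs : ∀ j, s j ≠ 0) (b : ℝ) {l : ℂ}
    (hl : l ≠ 0) (hcd : c ^ 2 + d ^ 2 = 1) (φ : 𝓢(Plane, ℂ)) :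
    hamS c d s b l φ = hamS c d s 0 l φ + l • ((b : ℂ) •
      (((s 1)⁻¹ : ℂ) • scaledX c d s √‖l‖ 1 (scaledP c d √‖l‖ 0 φ) -
        ((s 0)⁻¹ : ℂ) • scaledX c d s √‖l‖ 0 (scaledP c d √‖l‖ 1 φ)) +
      ((b : ℂ) ^ 2 / 4 * (l / ‖l‖)) •
      (((s 0)⁻¹ ^ 2 : ℂ) • scaledX c d s √‖l‖ 0 (scaledX c d s √‖l‖ 0 φ) +
        ((s 1)⁻¹ ^ 2 : ℂ) • scaledX c d s √‖l‖ 1 (scaledX c d s √‖l‖ 1 φ))) := by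
  have hn : (0 : ℝ) < ‖l‖ := norm_pos_iff.2 hl
  have hr : (0 : ℝ) < √‖l‖ := Real.sqrt_pos.2 hn
  have hr2 : ((√‖l‖ : ℝ) : ℂ) ^ 2 = (‖l‖ : ℂ) := by
    exact_mod_cast Real.sq_sqrt hn.le
  have hr0 : ((√‖l‖ : ℝ) : ℂ) ≠ 0 := by exact_mod_cast hr.ne'
  have hPX := rot_momentum_position hcd
  have e0 : ((s 0 : ℂ))⁻¹ * (s 0 * ((√‖l‖ : ℝ) : ℂ)) * ((√‖l‖ : ℝ) : ℂ)⁻¹ = 1 := by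
    have : (s 0 : ℂ) ≠ 0 := by exact_mod_cast hs 0
    field_simp
  have e1 : ((s 1 : ℂ))⁻¹ * (s 1 * ((√‖l‖ : ℝ) : ℂ)) * ((√‖l‖ : ℝ) : ℂ)⁻¹ = 1 := by
    have : (s 1 : ℂ) ≠ 0 := by exact_mod_cast hs 1
    field_simp
  have f0 : (((√‖l‖ : ℝ) : ℂ) ^ 2)⁻¹ * (((s 0 : ℂ))⁻¹ * (s 0 * ((√‖l‖ : ℝ) : ℂ))) ^ 2 = 1 := by
    have : (s 0 : ℂ) ≠ 0 := by exact_mod_cast hs 0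
    field_simp
  have f1 : (((√‖l‖ : ℝ) : ℂ) ^ 2)⁻¹ * (((s 1 : ℂ))⁻¹ * (s 1 * ((√‖l‖ : ℝ) : ℂ))) ^ 2 = 1 := by
    have : (s 1 : ℂ) ≠ 0 := by exact_mod_cast hs 1
    field_simp
  simp only [hamS, ham, sumSq, magP_zero, magP_one, scaledP, scaledX, LinearMap.add_apply,
    LinearMap.sub_apply, LinearMap.smul_apply, LinearMap.comp_apply, map_smul, map_add, map_sub,
    Complex.ofReal_zero, zero_mul, zero_div, zero_smul, add_zero, sub_zero, hPX]
  simp only [zero_ne_one, one_ne_zero, if_false, zero_smul, sub_zero]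
  rw [← hr2]
  push_cast
  linear_combination (norm := skip) (-l * b) • e1 •
      rot c d position 1 (rot c d momentum 0 φ) + (l * b) • e0 •
      rot c d position 0 (rot c d momentum 1 φ) -
      (l ^ 2 * b ^ 2 / 4) • f0 • rot c d position 0 (rot c d position 0 φ) -
      (l ^ 2 * b ^ 2 / 4) • f1 • rot c d position 1 (rot c d position 1 φ)
  module

theorem norm_le_norm2 {E H : Type*} [AddCommGroup E] [Module ℂ E] [NormedAddCommGroup H]
    [InnerProductSpace ℂ H] (ι : E →ₗ[ℂ] H) (p y : Fin 2 → E →ₗ[ℂ] E) (w : E) :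
    ‖ι w‖ ≤ norm2 ι p y w ∧ (∀ j, ‖ι (p j w)‖ ≤ norm2 ι p y w) ∧
      (∀ j, ‖ι (y j w)‖ ≤ norm2 ι p y w) ∧ (∀ i j, ‖ι (p i (p j w))‖ ≤ norm2 ι p y w) ∧
      (∀ i j, ‖ι (y i (p j w))‖ ≤ norm2 ι p y w) ∧
      ∀ i j, ‖ι (y i (y j w))‖ ≤ norm2 ι p y w := by
  have hA : 0 ≤ ∑ j, (‖ι (p j w)‖ + ‖ι (y j w)‖) := by positivity
  have hB : 0 ≤ ∑ i, ∑ j, (‖ι (p i (p j w))‖ + ‖ι (y i (p j w))‖ + ‖ι (y i (y j w))‖) := by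
    positivity
  have h0 := norm_nonneg (ι w)
  have hA' : ∀ j, ‖ι (p j w)‖ + ‖ι (y j w)‖ ≤ ∑ j, (‖ι (p j w)‖ + ‖ι (y j w)‖) := fun j =>
    Finset.single_le_sum (f := fun j => ‖ι (p j w)‖ + ‖ι (y j w)‖) (fun _ _ => by positivity)
      (Finset.mem_univ j)
  have hB' : ∀ i j, ‖ι (p i (p j w))‖ + ‖ι (y i (p j w))‖ + ‖ι (y i (y j w))‖ ≤
      ∑ i, ∑ j, (‖ι (p i (p j w))‖ + ‖ι (y i (p j w))‖ + ‖ι (y i (y j w))‖) := fun i j =>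
    (Finset.single_le_sum
      (f := fun j => ‖ι (p i (p j w))‖ + ‖ι (y i (p j w))‖ + ‖ι (y i (y j w))‖)
      (fun _ _ => by positivity) (Finset.mem_univ j)).trans
    (Finset.single_le_sum
      (f := fun i => ∑ j, (‖ι (p i (p j w))‖ + ‖ι (y i (p j w))‖ + ‖ι (y i (y j w))‖))
      (fun _ _ => by positivity) (Finset.mem_univ i))
  unfold norm2
  refine ⟨by linarith, fun j => ?_, fun j => ?_, fun i j => ?_, fun i j => ?_, fun i j => ?_⟩
  · linarith [hA' j, norm_nonneg (ι (y j w))]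
  · linarith [hA' j, norm_nonneg (ι (p j w))]
  · linarith [hB' i j, norm_nonneg (ι (y i (p j w))), norm_nonneg (ι (y i (y j w)))]
  · linarith [hB' i j, norm_nonneg (ι (p i (p j w))), norm_nonneg (ι (y i (y j w)))]
  · linarith [hB' i j, norm_nonneg (ι (p i (p j w))), norm_nonneg (ι (y i (p j w)))]

theorem size_nonneg (c d : ℝ) (s : Fin 2 → ℝ) (l : ℂ) (w : 𝓢(Plane, ℂ)) : 0 ≤ size c d s l w :=
  norm2_nonneg w

/-- The size of the magnetic perturbation. -/
theorem norm_hamS_sub_le {c d : ℝ} (hcd : c ^ 2 + d ^ 2 = 1) {s : Fin 2 → ℝ} (hs : ∀ j, 0 < s j)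
    {b : ℝ} (hb0 : 0 ≤ b) (hb1 : b ≤ 1) {l : ℂ} (hl : l ≠ 0) (w : 𝓢(Plane, ℂ)) :
    ‖toL2 (hamS c d s b l w - hamS c d s 0 l w)‖ ≤
      ‖l‖ * (b * ((s 0)⁻¹ + (s 1)⁻¹ + (s 0)⁻¹ ^ 2 + (s 1)⁻¹ ^ 2) * size c d s l w) := by
  have hs0 := hs 0
  have hs1 := hs 1
  obtain ⟨-, -, -, -, h1, h2⟩ := norm_le_norm2 toL2 (scaledP c d √‖l‖) (scaledX c d s √‖l‖) w
  rw [hamS_eq_hamS_zero_add c d s (fun j => (hs j).ne') b hl hcd, add_sub_cancel_left, map_smul,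
    norm_smul]
  refine mul_le_mul_of_nonneg_left ?_ (norm_nonneg _)
  have hN := size_nonneg c d s l w
  change ∀ i j, _ ≤ size c d s l w at h1 h2
  have hκ : ‖l / (‖l‖ : ℂ)‖ = 1 := by
    rw [norm_div, Complex.norm_real, norm_norm, div_self (norm_ne_zero_iff.2 hl)]
  simp only [map_add, map_sub, map_smul]
  have t1 : ‖(b : ℂ) • (((s 1)⁻¹ : ℂ) • toL2 (scaledX c d s √‖l‖ 1 (scaledP c d √‖l‖ 0 w)) -
        ((s 0)⁻¹ : ℂ) • toL2 (scaledX c d s √‖l‖ 0 (scaledP c d √‖l‖ 1 w)))‖ ≤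
      b * ((s 1)⁻¹ * size c d s l w + (s 0)⁻¹ * size c d s l w) := by
    rw [norm_smul, Complex.norm_real, Real.norm_of_nonneg hb0]
    refine mul_le_mul_of_nonneg_left ((norm_sub_le _ _).trans (add_le_add ?_ ?_)) hb0
    · rw [norm_smul, norm_inv, Complex.norm_real, Real.norm_of_nonneg hs1.le]
      exact mul_le_mul_of_nonneg_left (h1 _ _) (by positivity)
    · rw [norm_smul, norm_inv, Complex.norm_real, Real.norm_of_nonneg hs0.le]
      exact mul_le_mul_of_nonneg_left (h1 _ _) (by positivity)
  have t2 : ‖((b : ℂ) ^ 2 / 4 * (l / ‖l‖)) •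
      (((s 0)⁻¹ ^ 2 : ℂ) • toL2 (scaledX c d s √‖l‖ 0 (scaledX c d s √‖l‖ 0 w)) +
        ((s 1)⁻¹ ^ 2 : ℂ) • toL2 (scaledX c d s √‖l‖ 1 (scaledX c d s √‖l‖ 1 w)))‖ ≤
      b * ((s 0)⁻¹ ^ 2 * size c d s l w + (s 1)⁻¹ ^ 2 * size c d s l w) := by
    rw [norm_smul, norm_mul, hκ, mul_one, norm_div, norm_pow, Complex.norm_real,
      Real.norm_of_nonneg hb0]
    refine mul_le_mul ?_ ((norm_add_le _ _).trans (add_le_add ?_ ?_)) (norm_nonneg _) hb0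
    · have : ‖(4 : ℂ)‖ = 4 := by simp
      rw [this]
      nlinarith
    · rw [norm_smul, norm_pow, Complex.norm_real, Real.norm_of_nonneg (inv_pos.2 hs0).le]
      exact mul_le_mul_of_nonneg_left (h2 _ _) (by positivity)
    · rw [norm_smul, norm_pow, Complex.norm_real, Real.norm_of_nonneg (inv_pos.2 hs1).le]
      exact mul_le_mul_of_nonneg_left (h2 _ _) (by positivity)
  refine (norm_add_le _ _).trans ((add_le_add t1 t2).trans (le_of_eq ?_))
  ring

/-! ### Location of the spectral parameter -/

/-- The scaled spectral parameter: `l * spec s b ξ a l` is `z_l + a l²`. -/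
def spec (s : Fin 2 → ℝ) (b : ℝ) (ξ a l : ℂ) : ℂ :=
  ground s b + freq s b 1 * ξ - (1 - a) * l

theorem ground_nonneg (s : Fin 2 → ℝ) (b : ℝ) : 0 ≤ ground s b := Real.sqrt_nonneg _

theorem ground_le {s : Fin 2 → ℝ} (hs : ∀ j, 0 < s j) {b : ℝ} (hb : 0 ≤ b) :
    ground s b ≤ s 0 + s 1 + b := by
  have h0 := hs 0
  have h1 := hs 1
  refine Real.sqrt_le_iff.2 ⟨by positivity, ?_⟩
  nlinarith [mul_nonneg (add_nonneg h0.le h1.le) hb]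

theorem abs_freq_sub_le {s : Fin 2 → ℝ} (hs : ∀ j, 0 < s j) {b : ℝ} (hb : 0 ≤ b) :
    |freq s b 1 - min (s 0) (s 1)| ≤ b / 2 := by
  have h1 := ground_le hs hb
  have h2 := le_ground s b
  have h3 : |s 0 - s 1| ≤ √((s 0 - s 1) ^ 2 + b ^ 2) :=
    Real.abs_le_sqrt (by nlinarith)
  have h4 : √((s 0 - s 1) ^ 2 + b ^ 2) ≤ |s 0 - s 1| + b := by
    refine Real.sqrt_le_iff.2 ⟨by positivity, ?_⟩
    nlinarith [mul_nonneg (abs_nonneg (s 0 - s 1)) hb, sq_abs (s 0 - s 1)]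
  have h5 : min (s 0) (s 1) = (s 0 + s 1 - |s 0 - s 1|) / 2 := by
    rcases le_total (s 0) (s 1) with h | h
    · rw [min_eq_left h, abs_of_nonpos (by linarith)]; ring
    · rw [min_eq_right h, abs_of_nonneg (by linarith)]; ring
  rw [freq_one, h5, abs_le]
  constructor <;> linarith

theorem le_level {s : Fin 2 → ℝ} (hs : ∀ j, 0 < s j) (m n : ℕ) :
    level s m n = s 0 + s 1 ∨ s 0 + s 1 + 2 * min (s 0) (s 1) ≤ level s m n := by
  have h0 := hs 0
  have h1 := hs 1
  unfold level
  rcases Nat.eq_zero_or_pos m with rfl | hm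
  · rcases Nat.eq_zero_or_pos n with rfl | hn
    · left; simp
    · right
      have : (1 : ℝ) ≤ n := by exact_mod_cast hn
      have h2 := mul_le_mul this (min_le_right (s 0) (s 1)) (lt_min h0 h1).le (by positivity)
      push_cast
      linarith
  · right
    have : (1 : ℝ) ≤ m := by exact_mod_cast hm
    have h2 := mul_le_mul this (min_le_left (s 0) (s 1)) (lt_min h0 h1).le (by positivity)
    have h3 : 0 ≤ (n : ℝ) * s 1 := by positivity
    linarith

section Spec

variable {s : Fin 2 → ℝ} {b : ℝ} {ξ : ℂ}

theorem norm_ground_add_le (hs : ∀ j, 0 < s j) (hb0 : 0 ≤ b) (hb : b ≤ min (s 0) (s 1) / 4)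
    (hξ : ‖ξ‖ = 1) :
    ‖(ground s b : ℂ) + freq s b 1 * ξ‖ ≤ s 0 + s 1 + 2 * min (s 0) (s 1) := by
  refine (norm_add_le _ _).trans ?_
  have h0 := hs 0
  have h1 := hs 1
  rw [norm_mul, hξ, mul_one, Complex.norm_real, Complex.norm_real,
    Real.norm_of_nonneg (freq_pos hs b 1).le,
    Real.norm_of_nonneg (ground_nonneg s b)]
  have h2 := ground_le hs hb0
  have h3 := (abs_le.1 (abs_freq_sub_le hs hb0)).2
  have : 0 < min (s 0) (s 1) := lt_min h0 h1
  linarith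

/-- The field shifts the ground energy by at most `b` and the lower frequency by at most `b / 2`. So
the circle on which `μ` lies keeps distance at least `min (s 0) (s 1) - 3 b / 2` from the levels of
`b = 0`. -/
theorem le_norm_ground_add_sub_level (hs : ∀ j, 0 < s j) (hb0 : 0 ≤ b)
    (hb : b ≤ min (s 0) (s 1) / 4) (hξ : ‖ξ‖ = 1) (m n : ℕ) :
    min (s 0) (s 1) / 2 ≤ ‖(ground s b : ℂ) + freq s b 1 * ξ - (level s m n : ℂ)‖ := by
  have h2 := ground_le hs hb0
  have h2' := le_ground s b
  have h3 := abs_le.1 (abs_freq_sub_le hs hb0)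
  have hn : ‖(freq s b 1 : ℂ) * ξ‖ = freq s b 1 := by
    rw [norm_mul, hξ, mul_one, Complex.norm_real, Real.norm_of_nonneg (freq_pos hs b 1).le]
  have he : (ground s b : ℂ) + freq s b 1 * ξ - (level s m n : ℂ) =
      freq s b 1 * ξ - ((level s m n - ground s b : ℝ) : ℂ) := by push_cast; ring
  rw [he]
  rcases le_level hs m n with h | h
  · have h4 := norm_sub_norm_le ((freq s b 1 : ℂ) * ξ) ((level s m n - ground s b : ℝ) : ℂ)
    rw [hn, Complex.norm_real, Real.norm_eq_abs] at h4
    have h5 : |level s m n - ground s b| ≤ b := by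
      rw [h, abs_le]; constructor <;> linarith
    linarith
  · have h4 := norm_sub_norm_le ((level s m n - ground s b : ℝ) : ℂ) ((freq s b 1 : ℂ) * ξ)
    rw [norm_sub_rev, hn, Complex.norm_real, Real.norm_eq_abs] at h4
    have h5 := le_abs_self (level s m n - ground s b)
    linarith

/-- The point `μ` is at distance `freq s b 1` from the ground level, whereas every other level is at
least twice as far from it. -/
theorem ground_add_ne (hs : ∀ j, 0 < s j) (hξ : ‖ξ‖ = 1) (m n : ℕ) :
    (ground s b : ℂ) + freq s b 1 * ξ ≠ ground s b + 2 * m * freq s b 0 + 2 * n * freq s b 1 := by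
  intro h
  have h1 : (freq s b 1 : ℂ) * ξ = ((2 * m * freq s b 0 + 2 * n * freq s b 1 : ℝ) : ℂ) := by
    push_cast
    linear_combination h
  have p0 := freq_pos hs b 0
  have p1 := freq_pos hs b 1
  have h2 := congrArg norm h1
  rw [norm_mul, hξ, mul_one, Complex.norm_real, Complex.norm_real, Real.norm_of_nonneg p1.le,
    Real.norm_of_nonneg (by positivity)] at h2
  have h3 := freq_one_le s b 0
  rcases Nat.eq_zero_or_pos m with rfl | hm
  · rcases Nat.eq_zero_or_pos n with rfl | hn
    · simp at h2
      exact p1.ne' h2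
    · have : (1 : ℝ) ≤ n := by exact_mod_cast hn
      have h4 := mul_le_mul_of_nonneg_right this p1.le
      push_cast at h2
      linarith
  · have : (1 : ℝ) ≤ m := by exact_mod_cast hm
    have h4 := mul_le_mul_of_nonneg_right this p0.le
    have h5 : 0 ≤ (n : ℝ) * freq s b 1 := by positivity
    linarith

theorem spec_re_le (hs : ∀ j, 0 < s j) (hb0 : 0 ≤ b) (hb : b ≤ min (s 0) (s 1) / 4)
    (hξ : ‖ξ‖ = 1) {c₀ : ℝ} (hc₀ : 0 < c₀) {l : ℂ}
    (hL : 2 * (s 0 + s 1 + 2 * min (s 0) (s 1)) / c₀ ≤ ‖l‖) (hl : c₀ * ‖l‖ ≤ l.re) :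
    (spec s b ξ 0 l).re ≤ -(c₀ * ‖l‖ / 2) := by
  have h1 := norm_ground_add_le hs hb0 hb hξ
  have h2 := Complex.re_le_norm ((ground s b : ℂ) + freq s b 1 * ξ)
  have e : spec s b ξ 0 l = ((ground s b : ℂ) + freq s b 1 * ξ) - l := by unfold spec; ring
  rw [e, Complex.sub_re]
  rw [div_le_iff₀ hc₀] at hL
  linarith

/-- For `a = 1` the parameter is `μ`, inside the lowest gap; for `a = 0` it is `μ - l`, far to the
left of all levels once `‖l‖` is large. -/
theorem admissible_spec (hs : ∀ j, 0 < s j) (hb0 : 0 ≤ b) (hb : b ≤ min (s 0) (s 1) / 4)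
    (hξ : ‖ξ‖ = 1) {c₀ : ℝ} (hc₀ : 0 < c₀) {l : ℂ} (hl0 : l ≠ 0)
    (hL : 2 * (s 0 + s 1 + 2 * min (s 0) (s 1)) / c₀ ≤ ‖l‖) (hl : c₀ * ‖l‖ ≤ l.re) {a : ℂ}
    (ha : a = 0 ∨ a = 1) :
    IsCCR.Admissible s c₀ (min (s 0) (s 1) / 2) (l / ‖l‖) (spec s b ξ a l) := by
  have hn := norm_pos_iff.2 hl0
  have h0 := hs 0
  have h1 := hs 1
  have hm : 0 < min (s 0) (s 1) := lt_min h0 h1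
  refine ⟨?_, ?_, fun m n => ?_⟩
  · rw [norm_div, Complex.norm_real, norm_norm, div_self hn.ne']
  · rw [Complex.div_ofReal_re, le_div_iff₀ hn]
    exact hl
  · rcases ha with rfl | rfl
    · have h2 := spec_re_le hs hb0 hb hξ hc₀ hL hl
      have h3 := Complex.abs_re_le_norm (spec s b ξ 0 l - (level s m n : ℂ))
      rw [Complex.sub_re, Complex.ofReal_re] at h3
      have h4 := neg_abs_le ((spec s b ξ 0 l).re - level s m n)
      have h5 : 0 ≤ level s m n := by unfold level; positivity
      rw [div_le_iff₀ hc₀] at hL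
      linarith
    · have h2 := le_norm_ground_add_sub_level hs hb0 hb hξ m n
      have e : spec s b ξ 1 l = (ground s b : ℂ) + freq s b 1 * ξ := by unfold spec; ring
      rwa [e]

theorem spec_ne (hs : ∀ j, 0 < s j) (hb0 : 0 ≤ b) (hb : b ≤ min (s 0) (s 1) / 4)
    (hξ : ‖ξ‖ = 1) {c₀ : ℝ} (hc₀ : 0 < c₀) {l : ℂ} (hl0 : l ≠ 0)
    (hL : 2 * (s 0 + s 1 + 2 * min (s 0) (s 1)) / c₀ ≤ ‖l‖) (hl : c₀ * ‖l‖ ≤ l.re) {a : ℂ}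
    (ha : a = 0 ∨ a = 1) (m n : ℕ) :
    spec s b ξ a l ≠ ground s b + 2 * m * freq s b 0 + 2 * n * freq s b 1 := by
  rcases ha with rfl | rfl
  · intro h
    have h2 := spec_re_le hs hb0 hb hξ hc₀ hL hl
    have e : ((ground s b : ℂ) + 2 * m * freq s b 0 + 2 * n * freq s b 1) =
      ((ground s b + 2 * m * freq s b 0 + 2 * n * freq s b 1 : ℝ) : ℂ) := by push_cast; ring
    rw [h, e, Complex.ofReal_re] at h2
    have p0 := freq_pos hs b 0
    have p1 := freq_pos hs b 1
    have h3 : 0 ≤ ground s b := Real.sqrt_nonneg _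
    have h4 : 0 ≤ 2 * m * freq s b 0 := by positivity
    have h5 : 0 ≤ 2 * n * freq s b 1 := by positivity
    have h6 : 0 < c₀ * ‖l‖ := mul_pos hc₀ (norm_pos_iff.2 hl0)
    linarith
  · have e : spec s b ξ 1 l = (ground s b : ℂ) + freq s b 1 * ξ := by unfold spec; ring
    rw [e]
    exact ground_add_ne hs hξ m n

/-- The dichotomy needed in `exists_norm2_le`: `μ` is bounded, and `μ - l` is comparable to its
negative real part because `l` stays in a sector. -/
theorem norm_spec_le (hs : ∀ j, 0 < s j) (hb0 : 0 ≤ b) (hb : b ≤ min (s 0) (s 1) / 4)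
    (hξ : ‖ξ‖ = 1) {c₀ : ℝ} (hc₀ : 0 < c₀) (hc₁ : c₀ ≤ 1) {l : ℂ}
    (hL : 2 * (s 0 + s 1 + 2 * min (s 0) (s 1)) / c₀ ≤ ‖l‖) (hl : c₀ * ‖l‖ ≤ l.re) {a : ℂ}
    (ha : a = 0 ∨ a = 1) :
    (spec s b ξ a l).re ≤ s 0 + s 1 + 2 * min (s 0) (s 1) ∧
      (‖spec s b ξ a l‖ ≤ s 0 + s 1 + 2 * min (s 0) (s 1) + 4 / c₀ ∨
        ‖spec s b ξ a l‖ ≤ (s 0 + s 1 + 2 * min (s 0) (s 1) + 4 / c₀) * -(spec s b ξ a l).re) := by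
  have h1 := norm_ground_add_le hs hb0 hb hξ
  have hn := norm_nonneg l
  have hm : 0 < s 0 + s 1 + 2 * min (s 0) (s 1) := by
    have h0 := hs 0
    have h1 := hs 1
    have : 0 < min (s 0) (s 1) := lt_min h0 h1
    positivity
  have hcp : 0 < 4 / c₀ := by positivity
  rcases ha with rfl | rfl
  · have h2 := spec_re_le hs hb0 hb hξ hc₀ hL hl
    have h3 : 0 ≤ c₀ * ‖l‖ := by positivity
    refine ⟨by linarith, Or.inr ?_⟩
    have e : spec s b ξ 0 l = ((ground s b : ℂ) + freq s b 1 * ξ) - l := by unfold spec; ring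
    have h4 : ‖spec s b ξ 0 l‖ ≤ 2 * ‖l‖ := by
      rw [e]
      refine (norm_sub_le _ _).trans ?_
      rw [div_le_iff₀ hc₀] at hL
      nlinarith
    have h5 : 4 / c₀ * (c₀ * ‖l‖ / 2) = 2 * ‖l‖ := by field_simp; ring
    calc ‖spec s b ξ 0 l‖ ≤ 4 / c₀ * (c₀ * ‖l‖ / 2) := by rw [h5]; exact h4
      _ ≤ _ := mul_le_mul (by linarith) (by linarith) (by positivity) (by positivity)
  · have e : spec s b ξ 1 l = (ground s b : ℂ) + freq s b 1 * ξ := by unfold spec; ring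
    rw [e]
    exact ⟨(Complex.re_le_norm _).trans h1, Or.inl (by linarith)⟩

end Spec

/-! ### The uniform a priori estimate -/

theorem denseRange_harm_sub {c d : ℝ} (hcd : c ^ 2 + d ^ 2 = 1) {s : Fin 2 → ℝ}
    (hs : ∀ j, 0 < s j) {c₀ δ : ℝ} (hc₀ : 0 < c₀) (hδ : 0 < δ) {r : ℝ} (hr : 0 < r) {κ ζ : ℂ}
    (h : IsCCR.Admissible s c₀ δ κ ζ) :
    DenseRange fun v => toL2 (harm (scaledP c d r) (scaledX c d s r) κ v - ζ • v) := by
  -- Undoing the scaling: with this `l` the scaled operator is the oscillator at `b = 0`, whose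
  -- ladder has exactly the levels that admissibility avoids.
  set l : ℂ := ((r ^ 2 : ℝ) : ℂ) * κ with hl
  have hκ0 : κ ≠ 0 := norm_ne_zero_iff.1 (by rw [h.norm_eq]; exact one_ne_zero)
  have hn : ‖l‖ = r ^ 2 := by
    rw [hl, norm_mul, h.norm_eq, Complex.norm_real, Real.norm_of_nonneg (by positivity), mul_one]
  have hl0 : l ≠ 0 := norm_ne_zero_iff.1 (by rw [hn]; positivity)
  have hsq : √‖l‖ = r := by rw [hn, Real.sqrt_sq hr.le]
  have hκ : l / (‖l‖ : ℂ) = κ := by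
    rw [hn, hl, mul_div_cancel_left₀]
    exact_mod_cast (by positivity : r ^ 2 ≠ 0)
  have hre : c₀ * ‖l‖ ≤ l.re := by
    rw [hn, hl, Complex.re_ofReal_mul, mul_comm]
    exact mul_le_mul_of_nonneg_left h.le_re (by positivity)
  have hd := denseRange_hamS_sub hcd (lt_min (hs 0) (hs 1))
    (fun j => by fin_cases j; exacts [min_le_left _ _, min_le_right _ _]) le_rfl
    (by have := lt_min (hs 0) (hs 1); positivity) hre hc₀ hl0 (isModes_zero hs) (ζ := ζ)
    (fun m n he => by
      have h1 := h.le_dist m n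
      have hg : ground s 0 = s 0 + s 1 := by
        have h0 := hs 0
        have h1 := hs 1
        have e : (s 0 + s 1) ^ 2 + 0 ^ 2 = (s 0 + s 1) ^ 2 := by ring
        rw [ground, e, Real.sqrt_sq (by positivity)]
      rw [he, hg, level] at h1
      push_cast at h1
      rw [sub_self, norm_zero] at h1
      linarith)
  clear_value l
  have hcomp := (Homeomorph.smulOfNeZero l⁻¹ (inv_ne_zero hl0) :
    L2Plane ≃ₜ L2Plane).surjective.denseRange.comp hd (Homeomorph.continuous _)
  convert hcomp using 1
  funext v
  change _ = l⁻¹ • toL2 (hamS c d s 0 l v - (l * ζ) • v)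
  rw [hamS_zero_eq_harm c d s hl0, mul_smul,
    ← smul_sub, map_smul, smul_smul, inv_mul_cancel₀ hl0, one_smul, hsq, hκ]

theorem exists_estimate {c d : ℝ} (hcd : c ^ 2 + d ^ 2 = 1) {s : Fin 2 → ℝ} (hs : ∀ j, 0 < s j)
    {c₀ : ℝ} (hc₀ : 0 < c₀) (hc₁ : c₀ ≤ 1) :
    ∃ L₀ : ℝ, 0 < L₀ ∧ ∃ β : ℝ, 0 < β ∧ ∃ C : ℝ, 0 < C ∧ ∃ η : ℝ, 0 < η ∧
      ∀ b, 0 < b → b < β → ∀ ξ : ℂ, ‖ξ‖ = 1 → ∀ a : ℂ, (a = 0 ∨ a = 1) → ∀ l : ℂ, L₀ ≤ ‖l‖ →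
        c₀ * ‖l‖ ≤ l.re →
        (DenseRange fun φ => toL2 (hamS c d s b l φ - (l * spec s b ξ a l) • φ)) ∧
        ∀ (w : 𝓢(Plane, ℂ)) (g : L2Plane),
          ‖toL2 (hamS c d s b l w - (l * spec s b ξ a l) • w) - g‖ ≤ η * ‖l‖ * size c d s l w →
          ‖l‖ * size c d s l w ≤ C * ‖g‖ := by
  have h0 := hs 0
  have h1 := hs 1
  have hm : 0 < min (s 0) (s 1) := lt_min h0 h1
  set R := s 0 + s 1 + 2 * min (s 0) (s 1) with hR
  have hRp : 0 < R := by positivity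
  obtain ⟨C, hC, η, hη, hmain⟩ := IsCCR.exists_norm2_le (s := s) toL2 hc₀
    (half_pos hm) hs R (K := R + 4 / c₀) (by positivity)
  set Cs := (s 0)⁻¹ + (s 1)⁻¹ + (s 0)⁻¹ ^ 2 + (s 1)⁻¹ ^ 2 with hCs
  have hCsp : 0 < Cs := by positivity
  -- The four bounds on `b` serve, in order, the distance to the unperturbed levels, `b² ≤ b`, the
  -- decay of the complex Gaussian ground state, and the absorption of the magnetic terms into half
  -- of the tolerance `η`. The other half remains for the weights.
  refine ⟨2 * R / c₀, by positivity, min (min (min (s 0) (s 1) / 4) 1)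
    (min (c₀ * min (s 0) (s 1)) (η / 2 / Cs)), by positivity, C, hC, η / 2, by positivity, ?_⟩
  intro b hb0 hb ξ hξ a ha l hL hl
  simp only [lt_min_iff] at hb
  obtain ⟨⟨hb1, hb2⟩, hb3, hb4⟩ := hb
  have hn : 0 < ‖l‖ := lt_of_lt_of_le (by positivity) hL
  have hl0 : l ≠ 0 := norm_pos_iff.1 hn
  have hr : 0 < √‖l‖ := Real.sqrt_pos.2 hn
  refine ⟨denseRange_hamS_sub hcd hm
    (fun j => by fin_cases j; exacts [min_le_left _ _, min_le_right _ _]) hb0.le hb3.le hl hc₀ hl0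
    (isModes_freq hs hb0) (spec_ne hs hb0.le hb1.le hξ hc₀ hl0 hL hl ha), fun w g hw => ?_⟩
  have had := admissible_spec hs hb0.le hb1.le hξ hc₀ hl0 hL hl ha
  obtain ⟨hre, hnorm⟩ := norm_spec_le hs hb0.le hb1.le hξ hc₀ hc₁ hL hl ha
  have key := hmain (scaledP c d √‖l‖) (scaledX c d s √‖l‖) (isCCR_rot hcd hr s)
    (fun κ ζ h => denseRange_harm_sub hcd hs hc₀ (half_pos hm) hr h) _ _ had hre hnorm w (l⁻¹ • g)
  have hN := size_nonneg c d s l w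
  have hpert := norm_hamS_sub_le hcd hs hb0.le hb2.le hl0 w
  have hbC : b * Cs ≤ η / 2 := by
    rw [lt_div_iff₀ hCsp] at hb4
    exact hb4.le
  -- The defect for `b = 0` is the given defect minus the magnetic perturbation, up to the factor
  -- `l`.
  have e : l • (toL2 (harm (scaledP c d √‖l‖) (scaledX c d s √‖l‖) (l / ‖l‖) w -
      spec s b ξ a l • w) - l⁻¹ • g) =
      (toL2 (hamS c d s b l w - (l * spec s b ξ a l) • w) - g) -
        toL2 (hamS c d s b l w - hamS c d s 0 l w) := by
    rw [hamS_zero_eq_harm c d s hl0, smul_sub, smul_smul, mul_inv_cancel₀ hl0, one_smul]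
    simp only [map_sub, map_smul, smul_sub, smul_smul]
    abel
  have h2 : ‖l‖ * ‖toL2 (harm (scaledP c d √‖l‖) (scaledX c d s √‖l‖) (l / ‖l‖) w -
      spec s b ξ a l • w) - l⁻¹ • g‖ ≤ ‖l‖ * (η * size c d s l w) := by
    rw [← norm_smul, e]
    refine (norm_sub_le _ _).trans ((add_le_add hw hpert).trans ?_)
    have h3 := mul_le_mul_of_nonneg_right hbC (mul_nonneg hn.le hN)
    linarith
  have h3 := key (le_of_mul_le_mul_left h2 hn)
  rw [norm_smul, norm_inv] at h3
  calc ‖l‖ * size c d s l w ≤ ‖l‖ * (C * (‖l‖⁻¹ * ‖g‖)) := mul_le_mul_of_nonneg_left h3 hn.le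
    _ = C * ‖g‖ := by field_simp

/-! ### The resolvent and its analyticity -/

/-- The shifted magnetic oscillator `h_l - l ζ_l`, with values in `L²`. -/
def shifted (c d : ℝ) (s : Fin 2 → ℝ) (b : ℝ) (ξ a l : ℂ) : 𝓢(Plane, ℂ) →ₗ[ℂ] L2Plane :=
  toL2 ∘ₗ (hamS c d s b l - (l * spec s b ξ a l) • LinearMap.id)

theorem shifted_apply (c d : ℝ) (s : Fin 2 → ℝ) (b : ℝ) (ξ a l : ℂ) (φ : 𝓢(Plane, ℂ)) :
    shifted c d s b ξ a l φ = toL2 (hamS c d s b l φ - (l * spec s b ξ a l) • φ) := rfl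

/-- Invertibility of the shifted oscillator with a quantitative bound, stable under small
relatively bounded perturbations. -/
structure IsGood (c d : ℝ) (s : Fin 2 → ℝ) (b : ℝ) (ξ a : ℂ) (C η : ℝ) (l : ℂ) : Prop where
  one_le : 1 ≤ ‖l‖
  dense : DenseRange (shifted c d s b ξ a l)
  est : ∀ (w : 𝓢(Plane, ℂ)) (g : L2Plane),
    ‖shifted c d s b ξ a l w - g‖ ≤ η * ‖l‖ * size c d s l w → ‖l‖ * size c d s l w ≤ C * ‖g‖

/-- The inverse of the shifted oscillator. -/
def resolventOp (c d : ℝ) (s : Fin 2 → ℝ) (b : ℝ) (ξ a l : ℂ) : L2Plane →L[ℂ] L2Plane :=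
  toL2.extendOfNorm (shifted c d s b ξ a l)

section Good

variable {c d : ℝ} {s : Fin 2 → ℝ} {b : ℝ} {ξ a : ℂ} {C η : ℝ} {l : ℂ}

namespace IsGood

theorem ne_zero (h : IsGood c d s b ξ a C η l) : l ≠ 0 :=
  norm_pos_iff.1 (zero_lt_one.trans_le h.one_le)

theorem size_le (h : IsGood c d s b ξ a C η l) (hη : 0 < η) (w : 𝓢(Plane, ℂ)) :
    size c d s l w ≤ C * ‖l‖⁻¹ * ‖shifted c d s b ξ a l w‖ := by
  have hn : 0 < ‖l‖ := zero_lt_one.trans_le h.one_le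
  have h1 := h.est w (shifted c d s b ξ a l w) (by
    rw [sub_self, norm_zero]
    exact mul_nonneg (by positivity) (size_nonneg c d s l w))
  have h2 : size c d s l w = ‖l‖⁻¹ * (‖l‖ * size c d s l w) := by field_simp
  rw [h2]
  calc ‖l‖⁻¹ * (‖l‖ * size c d s l w) ≤ ‖l‖⁻¹ * (C * ‖shifted c d s b ξ a l w‖) :=
        mul_le_mul_of_nonneg_left h1 (by positivity)
    _ = _ := by ring

theorem norm_le (h : IsGood c d s b ξ a C η l) (hη : 0 < η) (w : 𝓢(Plane, ℂ)) :
    ‖toL2 w‖ ≤ C * ‖l‖⁻¹ * ‖shifted c d s b ξ a l w‖ :=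
  (norm_le_norm2 toL2 _ _ w).1.trans (h.size_le hη w)

theorem norm_rot_momentum_le (w : 𝓢(Plane, ℂ)) (hl : 1 ≤ ‖l‖) (j : Fin 2) :
    ‖toL2 (rot c d momentum j w)‖ ≤ √‖l‖ * size c d s l w := by
  have h1 := (norm_le_norm2 toL2 (scaledP c d √‖l‖) (scaledX c d s √‖l‖) w).2.1 j
  have hr : 0 < √‖l‖ := Real.sqrt_pos.2 (by linarith)
  rw [scaledP, LinearMap.smul_apply, map_smul, norm_smul, Complex.norm_real,
    Real.norm_of_nonneg (inv_pos.2 hr).le, inv_mul_le_iff₀ hr] at h1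
  exact h1

theorem momentum_eq_rot (hcd : c ^ 2 + d ^ 2 = 1) (j : Fin 2) :
    ∃ x y : ℝ, |x| ≤ 1 ∧ |y| ≤ 1 ∧ ∀ w, momentum j w =
      (x : ℂ) • rot c d momentum 0 w + (y : ℂ) • rot c d momentum 1 w := by
  have hcd' : (c : ℂ) ^ 2 + (d : ℂ) ^ 2 = 1 := by exact_mod_cast hcd
  have hc : |c| ≤ 1 := abs_le_one_iff_mul_self_le_one.2 (by nlinarith)
  have hd : |d| ≤ 1 := abs_le_one_iff_mul_self_le_one.2 (by nlinarith)
  fin_cases j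
  · refine ⟨c, -d, hc, by rwa [abs_neg], fun w => ?_⟩
    simp only [rot_zero_apply, rot_one_apply, Fin.zero_eta]
    push_cast
    linear_combination (norm := module) (-1 : ℂ) • hcd' • momentum 0 w
  · refine ⟨d, c, hd, hc, fun w => ?_⟩
    simp only [rot_zero_apply, rot_one_apply, Fin.mk_one]
    linear_combination (norm := module) (-1 : ℂ) • hcd' • momentum 1 w

theorem norm_momentum_le_size (hcd : c ^ 2 + d ^ 2 = 1) (hl : 1 ≤ ‖l‖) (j : Fin 2)
    (w : 𝓢(Plane, ℂ)) : ‖toL2 (momentum j w)‖ ≤ 2 * √‖l‖ * size c d s l w := by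
  obtain ⟨x, y, hx, hy, e⟩ := momentum_eq_rot hcd j
  have h0 := norm_rot_momentum_le (s := s) (c := c) (d := d) w hl 0
  have h1 := norm_rot_momentum_le (s := s) (c := c) (d := d) w hl 1
  have hN := mul_nonneg (Real.sqrt_nonneg ‖l‖) (size_nonneg c d s l w)
  rw [e, map_add, map_smul, map_smul]
  refine (norm_add_le _ _).trans ?_
  rw [norm_smul, norm_smul, Complex.norm_real, Complex.norm_real, Real.norm_eq_abs,
    Real.norm_eq_abs]
  have := mul_le_mul hx h0 (norm_nonneg _) zero_le_one
  have := mul_le_mul hy h1 (norm_nonneg _) zero_le_one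
  linarith

theorem norm_momentum_le (h : IsGood c d s b ξ a C η l) (hη : 0 < η) (hC : 0 < C)
    (hcd : c ^ 2 + d ^ 2 = 1) (j : Fin 2) (w : 𝓢(Plane, ℂ)) :
    ‖toL2 (momentum j w)‖ ≤ 2 * C * ‖shifted c d s b ξ a l w‖ := by
  have hn : 0 < ‖l‖ := zero_lt_one.trans_le h.one_le
  have h1 := norm_momentum_le_size (s := s) hcd h.one_le j w
  have h2 : √‖l‖ ≤ ‖l‖ := Real.sqrt_le_iff.2 ⟨hn.le, by nlinarith [h.one_le]⟩
  have h3 := h.size_le hη w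
  calc _ ≤ 2 * √‖l‖ * size c d s l w := h1
    _ ≤ 2 * ‖l‖ * (C * ‖l‖⁻¹ * ‖shifted c d s b ξ a l w‖) := by
      have := size_nonneg c d s l w
      gcongr
    _ = _ := by field_simp

theorem resolventOp_shifted (h : IsGood c d s b ξ a C η l) (hη : 0 < η) (w : 𝓢(Plane, ℂ)) :
    resolventOp c d s b ξ a l (shifted c d s b ξ a l w) = toL2 w :=
  LinearMap.extendOfNorm_eq h.dense ⟨_, h.norm_le hη⟩ w

theorem norm_resolventOp_le (h : IsGood c d s b ξ a C η l) (hη : 0 < η) (hC : 0 < C) :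
    ‖resolventOp c d s b ξ a l‖ ≤ C * ‖l‖⁻¹ :=
  LinearMap.opNorm_extendOfNorm_le h.dense (by positivity) (h.norm_le hη)

/-- The operator `P_j r_l`. -/
theorem exists_momentum_resolvent (h : IsGood c d s b ξ a C η l) (hη : 0 < η) (hC : 0 < C)
    (hcd : c ^ 2 + d ^ 2 = 1) (j : Fin 2) :
    ∃ D : L2Plane →L[ℂ] L2Plane,
      (∀ w, D (shifted c d s b ξ a l w) = toL2 (momentum j w)) ∧
      ∀ f, Acts (momentum j) (resolventOp c d s b ξ a l f) (D f) := by
  set A : 𝓢(Plane, ℂ) →ₗ[ℂ] L2Plane :=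
    toL2 ∘ₗ (momentum j : 𝓢(Plane, ℂ) →ₗ[ℂ] 𝓢(Plane, ℂ)) with hA
  have hnorm : ∃ K, ∀ w, ‖A w‖ ≤ K * ‖shifted c d s b ξ a l w‖ :=
    ⟨2 * C, h.norm_momentum_le hη hC hcd j⟩
  have hD : ∀ w, A.extendOfNorm (shifted c d s b ξ a l) (shifted c d s b ξ a l w) = A w :=
    LinearMap.extendOfNorm_eq h.dense hnorm
  refine ⟨A.extendOfNorm (shifted c d s b ξ a l), hD, fun f φ => ?_⟩
  refine h.dense.induction_on (p := fun f => inner ℂ ((momentum j φ).toLp 2 volume)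
    (resolventOp c d s b ξ a l f) = inner ℂ (φ.toLp 2 volume)
      (A.extendOfNorm (shifted c d s b ξ a l) f)) f ?_ fun w => ?_
  · exact isClosed_eq (by fun_prop) (by fun_prop)
  · rw [h.resolventOp_shifted hη, hD]
    exact momentum_symm j φ w

theorem eq_of_comp (h : IsGood c d s b ξ a C η l) {D D' : L2Plane →L[ℂ] L2Plane}
    (hD : ∀ w, D (shifted c d s b ξ a l w) = D' (shifted c d s b ξ a l w)) : D = D' :=
  ContinuousLinearMap.ext fun f => h.dense.induction_on
    (p := fun f => D f = D' f) f (isClosed_eq D.continuous D'.continuous) hD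

end IsGood

/-- The operators on Schwartz functions that are bounded by the second order norm. -/
def sizeBounded (c d : ℝ) (s : Fin 2 → ℝ) (l : ℂ) :
    Submodule ℂ (𝓢(Plane, ℂ) →ₗ[ℂ] 𝓢(Plane, ℂ)) where
  carrier := {Q | ∃ K, ∀ w, ‖toL2 (Q w)‖ ≤ K * size c d s l w}
  add_mem' := by
    rintro Q Q' ⟨K, hK⟩ ⟨K', hK'⟩
    refine ⟨K + K', fun w => ?_⟩
    rw [LinearMap.add_apply, map_add, add_mul]
    exact (norm_add_le _ _).trans (add_le_add (hK w) (hK' w))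
  zero_mem' := ⟨0, fun w => by simp⟩
  smul_mem' := by
    rintro z Q ⟨K, hK⟩
    refine ⟨‖z‖ * K, fun w => ?_⟩
    rw [LinearMap.smul_apply, map_smul, norm_smul, mul_assoc]
    exact mul_le_mul_of_nonneg_left (hK w) (norm_nonneg _)

theorem id_mem_sizeBounded : LinearMap.id ∈ sizeBounded c d s l :=
  ⟨1, fun w => by
    rw [one_mul, LinearMap.id_apply, size]
    exact (norm_le_norm2 toL2 (scaledP c d √‖l‖) (scaledX c d s √‖l‖) w).1⟩

theorem rot_position_momentum_mem (hs : ∀ j, 0 < s j) (hl : l ≠ 0) (i j : Fin 2) :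
    rot c d position i ∘ₗ rot c d momentum j ∈ sizeBounded c d s l := by
  have hr : ((√‖l‖ : ℝ) : ℂ) ≠ 0 := by
    exact_mod_cast (Real.sqrt_pos.2 (norm_pos_iff.2 hl)).ne'
  have hsi : (s i : ℂ) ≠ 0 := by exact_mod_cast (hs i).ne'
  have h1 : scaledX c d s √‖l‖ i ∘ₗ scaledP c d √‖l‖ j ∈ sizeBounded c d s l := by
    refine ⟨1, fun w => ?_⟩
    rw [one_mul, LinearMap.comp_apply, size]
    exact (norm_le_norm2 toL2 (scaledP c d √‖l‖) (scaledX c d s √‖l‖) w).2.2.2.2.1 i j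
  have h2 := (sizeBounded c d s l).smul_mem ((s i : ℂ)⁻¹) h1
  convert h2 using 1
  ext1 w
  simp only [scaledX, scaledP, LinearMap.comp_apply, LinearMap.smul_apply, map_smul, smul_smul]
  push_cast
  rw [show (s i : ℂ)⁻¹ * (((√‖l‖ : ℝ) : ℂ)⁻¹ * (s i * ((√‖l‖ : ℝ) : ℂ))) = 1 by field_simp,
    one_smul]

theorem rot_position_position_mem (hs : ∀ j, 0 < s j) (hl : l ≠ 0) (i j : Fin 2) :
    rot c d position i ∘ₗ rot c d position j ∈ sizeBounded c d s l := by
  have hr : ((√‖l‖ : ℝ) : ℂ) ≠ 0 := by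
    exact_mod_cast (Real.sqrt_pos.2 (norm_pos_iff.2 hl)).ne'
  have hsi : (s i : ℂ) ≠ 0 := by exact_mod_cast (hs i).ne'
  have hsj : (s j : ℂ) ≠ 0 := by exact_mod_cast (hs j).ne'
  have h1 : scaledX c d s √‖l‖ i ∘ₗ scaledX c d s √‖l‖ j ∈ sizeBounded c d s l := by
    refine ⟨1, fun w => ?_⟩
    rw [one_mul, LinearMap.comp_apply, size]
    exact (norm_le_norm2 toL2 (scaledP c d √‖l‖) (scaledX c d s √‖l‖) w).2.2.2.2.2 i j
  have h2 := (sizeBounded c d s l).smul_mem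
    ((s i * ((√‖l‖ : ℝ) : ℂ) * (s j * ((√‖l‖ : ℝ) : ℂ)))⁻¹) h1
  convert h2 using 1
  ext1 w
  simp only [scaledX, LinearMap.comp_apply, LinearMap.smul_apply, map_smul, smul_smul]
  push_cast
  rw [show (s i * ((√‖l‖ : ℝ) : ℂ) * (s j * ((√‖l‖ : ℝ) : ℂ)))⁻¹ *
    (s j * ((√‖l‖ : ℝ) : ℂ) * (s i * ((√‖l‖ : ℝ) : ℂ))) = 1 by field_simp,
    one_smul]

theorem IsGood.exists_comp {Q : 𝓢(Plane, ℂ) →ₗ[ℂ] 𝓢(Plane, ℂ)} (h : IsGood c d s b ξ a C η l)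
    (hη : 0 < η) (hQ : Q ∈ sizeBounded c d s l) :
    ∃ q : L2Plane →L[ℂ] L2Plane, ∀ w, q (shifted c d s b ξ a l w) = toL2 (Q w) := by
  obtain ⟨K, hK⟩ := hQ
  have hnorm : ∃ K, ∀ w, ‖(toL2 ∘ₗ Q) w‖ ≤ K * ‖shifted c d s b ξ a l w‖ := by
    refine ⟨|K| * (C * ‖l‖⁻¹), fun w => (hK w).trans ?_⟩
    rw [mul_assoc]
    exact mul_le_mul (le_abs_self K) (h.size_le hη w) (size_nonneg c d s l w) (abs_nonneg K)
  exact ⟨_, LinearMap.extendOfNorm_eq h.dense hnorm⟩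

/-- The dependence of the shifted oscillator on `l`. -/
theorem exists_shifted_sub (hcd : c ^ 2 + d ^ 2 = 1) (hs : ∀ j, 0 < s j) (hl : l ≠ 0) (b : ℝ)
    (ξ a : ℂ) :
    ∃ Q₁ ∈ sizeBounded c d s l, ∃ Q₂ ∈ sizeBounded c d s l, ∀ l' w,
      shifted c d s b ξ a l' w = shifted c d s b ξ a l w + (l' - l) • toL2 (Q₁ w) +
        (l' ^ 2 - l ^ 2) • toL2 (Q₂ w) := by
  have hXP := fun i j => rot_position_momentum_mem (c := c) (d := d) hs hl i j
  have hXX := fun i j => rot_position_position_mem (c := c) (d := d) hs hl i j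
  have hid : LinearMap.id ∈ sizeBounded c d s l := id_mem_sizeBounded
  refine ⟨(b : ℂ) • (rot c d position 1 ∘ₗ rot c d momentum 0 -
      rot c d position 0 ∘ₗ rot c d momentum 1) -
      ((ground s b : ℂ) + freq s b 1 * ξ) • LinearMap.id, ?_,
    ((b : ℂ) ^ 2 / 4 + (s 0 : ℂ) ^ 2) • (rot c d position 0 ∘ₗ rot c d position 0) +
      ((b : ℂ) ^ 2 / 4 + (s 1 : ℂ) ^ 2) • (rot c d position 1 ∘ₗ rot c d position 1) +
      (1 - a) • LinearMap.id, ?_, fun l' w => ?_⟩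
  · exact Submodule.sub_mem _ (Submodule.smul_mem _ _ (Submodule.sub_mem _ (hXP 1 0) (hXP 0 1)))
      (Submodule.smul_mem _ _ hid)
  · exact Submodule.add_mem _ (Submodule.add_mem _ (Submodule.smul_mem _ _ (hXX 0 0))
      (Submodule.smul_mem _ _ (hXX 1 1))) (Submodule.smul_mem _ _ hid)
  · have hPX := rot_momentum_position hcd
    simp only [shifted_apply, hamS, ham, sumSq, magP_zero, magP_one, LinearMap.add_apply,
      LinearMap.sub_apply, LinearMap.smul_apply, LinearMap.comp_apply, map_smul, map_add, map_sub,
      hPX, LinearMap.id_apply, spec]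
    simp only [zero_ne_one, one_ne_zero, if_false, zero_smul, sub_zero]
    module

/-- The shifted oscillator at `l'` is `G l'` times the one at `l`, where `G` is a polynomial in `l'`
with bounded operator coefficients and `G l = 1`. So the resolvent near `l` is the one at `l` times
the inverse of `G l'`. -/
theorem analyticAt_resolventOp (hcd : c ^ 2 + d ^ 2 = 1) (hs : ∀ j, 0 < s j) (hη : 0 < η)
    {U : Set ℂ} (hU : IsOpen U) (hgood : ∀ l ∈ U, IsGood c d s b ξ a C η l) :
    AnalyticOnNhd ℂ (resolventOp c d s b ξ a) U := by
  intro l hl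
  have h := hgood l hl
  obtain ⟨Q₁, hQ₁, Q₂, hQ₂, hsub⟩ := exists_shifted_sub hcd hs h.ne_zero b ξ a
  obtain ⟨q₁, hq₁⟩ := h.exists_comp hη hQ₁
  obtain ⟨q₂, hq₂⟩ := h.exists_comp hη hQ₂
  set G : ℂ → L2Plane →L[ℂ] L2Plane := fun l' =>
    1 + (l' - l) • q₁ + (l' ^ 2 - l ^ 2) • q₂ with hG
  have hGa : AnalyticAt ℂ G l := by
    refine AnalyticAt.add (AnalyticAt.add analyticAt_const ?_) ?_
    · exact (analyticAt_id.sub analyticAt_const).smul analyticAt_const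
    · exact ((analyticAt_id.pow 2).sub analyticAt_const).smul analyticAt_const
  have hGl : G l = 1 := by simp [hG]
  have hinv : AnalyticAt ℂ (fun l' => Ring.inverse (G l')) l := by
    have h1 : AnalyticAt ℂ (Ring.inverse : (L2Plane →L[ℂ] L2Plane) → _) (G l) := by
      rw [hGl]
      exact analyticAt_inverse (𝕜 := ℂ) (1 : (L2Plane →L[ℂ] L2Plane)ˣ)
    exact h1.comp hGa
  have hunit : ∀ᶠ l' in nhds l, IsUnit (G l') :=
    hGa.continuousAt.eventually_mem (Units.isOpen.mem_nhds (by rw [hGl]; exact isUnit_one))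
  have hcomp : AnalyticAt ℂ (fun l' => resolventOp c d s b ξ a l * Ring.inverse (G l')) l :=
    analyticAt_const.mul hinv
  refine hcomp.congr ?_
  filter_upwards [hunit, hU.mem_nhds hl] with l' hu hl'
  have h' := hgood l' hl'
  have e : resolventOp c d s b ξ a l' * G l' = resolventOp c d s b ξ a l := by
    refine h.eq_of_comp fun w => ?_
    rw [h.resolventOp_shifted hη, ← h'.resolventOp_shifted hη, mul_apply_eq_comp]
    congr 1
    rw [hsub l' w, ← hq₁, ← hq₂]
    rfl
  rw [← e, mul_assoc, Ring.mul_inverse_cancel _ hu, mul_one]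

end Good

/-! ### Resolvent identities for real `l`, and the wedge -/

section Resolvent

variable {M : Matrix (Fin 2) (Fin 2) ℝ} {c d : ℝ} {s : Fin 2 → ℝ} {b : ℝ} {ξ a : ℂ} {C η : ℝ}

theorem zParam_eq (hM : IsFrame M c d s) {σ c₀ : ℝ} (hσ : 0 < σ) (hs : ∀ j, σ ≤ s j) (hb0 : 0 < b)
    (hc₀ : 0 < c₀) (hc₁ : c₀ ≤ 1) (hb : b ≤ c₀ * σ) (ξ a l : ℂ) :
    zParam M b ξ l + a * l ^ 2 = l * spec s b ξ a l := by
  obtain ⟨e0, e1⟩ := eigenvalue_eq hM hσ hs hb0 hc₀ hc₁ hb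
  rw [zParam, mu, e0, e1, spec]
  push_cast
  ring

theorem conj_spec {l : ℝ} (ha : a = 0 ∨ a = 1) :
    starRingEnd ℂ (l * spec s b ξ a l) = l * spec s b (starRingEnd ℂ ξ) a l := by
  rcases ha with rfl | rfl <;>
  simp only [spec, map_mul, map_sub, map_add, map_one, map_zero, Complex.conj_ofReal]

/-- The first identity holds on the dense range and passes to the limit. The second is uniqueness in
the maximal domain: it follows from density of the range at the conjugate spectral parameter, which
for real `l` corresponds to the conjugate of `ξ`. -/
theorem isResolvent_resolventOp (hM : IsFrame M c d s) {l : ℝ} (ha : a = 0 ∨ a = 1) (hη : 0 < η)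
    (h : IsGood c d s b ξ a C η l) (h' : IsGood c d s b (starRingEnd ℂ ξ) a C η l) :
    IsResolvent (oscillator M b l) (l * spec s b ξ a l) (resolventOp c d s b ξ a l) := by
  have hsym := oscillator_symm hM b l
  have hosc := oscillator_eq hM b l
  have hacts : ∀ f : L2Plane, Acts (oscillator M b l) (resolventOp c d s b ξ a l f)
      ((l * spec s b ξ a l) • resolventOp c d s b ξ a l f + f) := by
    intro f φ
    refine h.dense.induction_on (p := fun f => inner ℂ ((oscillator M b l φ).toLp 2 volume)
      (resolventOp c d s b ξ a l f) = inner ℂ (φ.toLp 2 volume)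
        ((l * spec s b ξ a l) • resolventOp c d s b ξ a l f + f)) f ?_ fun w => ?_
    · exact isClosed_eq (by fun_prop) (by fun_prop)
    · rw [h.resolventOp_shifted hη, shifted_apply, map_sub, map_smul, add_sub_cancel, ← hosc]
      exact hsym φ w
  refine ⟨hacts, fun u g hug => ?_⟩
  set z := l * spec s b ξ a l with hz
  set v := resolventOp c d s b ξ a l (g - z • u) with hv
  have h0 : ∀ φ, inner ℂ (shifted c d s b (starRingEnd ℂ ξ) a l φ) (v - u) = 0 := by
    intro φ
    have h1 := hacts (g - z • u) φ
    have h2 := hug φ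
    rw [← toL2_apply, ← toL2_apply, hosc] at h1 h2
    rw [shifted_apply, ← conj_spec ha, map_sub, map_smul, inner_sub_left, inner_smul_left,
      Complex.conj_conj, inner_sub_right, h1, h2, ← hv, ← inner_sub_right, ← inner_smul_right,
      ← inner_sub_right]
    have e : z • v + (g - z • u) - g - z • (v - u) = 0 := by module
    rw [e, inner_zero_right]
  have h1 : v - u = 0 := by
    refine h'.dense.eq_zero_of_inner_right ℂ ?_
    rintro ⟨φ⟩
    exact h0 _
  exact sub_eq_zero.1 h1

/-- On an eigenvector the resolvent is multiplication by `1 / (E - z)`, so its norm bound is a lower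
bound on the distance. -/
theorem le_norm_sub_of_isEigenvector {A : SchwartzOp} {z : ℂ} {R : L2Plane →L[ℂ] L2Plane}
    (h : IsResolvent A z R) {K : ℝ} (hK : ‖R‖ ≤ K) {E : ℝ} {u : L2Plane}
    (hu : IsEigenvector A E u) : 1 ≤ K * ‖z - E‖ := by
  have h1 := h.2 u _ hu.2
  rw [← sub_smul, map_smul] at h1
  have hn : 0 < ‖u‖ := norm_pos_iff.2 hu.1
  have h2 : ‖u‖ ≤ ‖(E : ℂ) - z‖ * (K * ‖u‖) := by
    calc ‖u‖ = ‖((E : ℂ) - z) • R u‖ := by rw [h1]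
      _ = ‖(E : ℂ) - z‖ * ‖R u‖ := norm_smul _ _
      _ ≤ _ := mul_le_mul_of_nonneg_left (R.le_of_opNorm_le hK u) (norm_nonneg _)
  rw [norm_sub_rev]
  have h3 : 1 * ‖u‖ ≤ K * ‖(E : ℂ) - z‖ * ‖u‖ := by linarith
  exact le_of_mul_le_mul_right h3 hn

/-- The argument is discontinuous only along the closed negative half-axis, which the wedge avoids.
-/
theorem isOpen_wedge (L ε : ℝ) (hε : 0 < ε) (hL : 0 ≤ L) : IsOpen (wedge L ε) := by
  have e : wedge L ε = {z : ℂ | L < ‖z‖} ∩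
      (Complex.slitPlane ∩ Complex.arg ⁻¹' Ioo (-(Real.pi / 2 - ε)) (Real.pi / 2 - ε)) := by
    ext z
    simp only [wedge, mem_ofPred_eq, mem_inter_iff, mem_preimage, mem_Ioo, abs_lt]
    refine ⟨fun h => ⟨h.1, ?_, h.2⟩, fun h => ⟨h.1, h.2.2⟩⟩
    refine Complex.mem_slitPlane_iff_arg.2 ⟨fun h2 => ?_, norm_pos_iff.1 (hL.trans_lt h.1)⟩
    have := h.2.2
    rw [h2] at this
    linarith [Real.pi_pos]
  rw [e]
  refine (isOpen_lt continuous_const continuous_norm).inter ?_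
  exact ContinuousOn.isOpen_inter_preimage
    (fun z hz => (Complex.continuousAt_arg hz).continuousWithinAt)
    Complex.isOpen_slitPlane isOpen_Ioo

theorem sin_mul_norm_le_re {L ε : ℝ} (hε : ε ∈ Ioo 0 (Real.pi / 2)) {z : ℂ} (hz : z ∈ wedge L ε) :
    Real.sin ε * ‖z‖ ≤ z.re := by
  rw [← Complex.norm_mul_cos_arg z, mul_comm, ← Real.cos_pi_div_two_sub,
    ← Real.cos_abs (Complex.arg z)]
  refine mul_le_mul_of_nonneg_left ?_ (norm_nonneg z)
  exact Real.cos_le_cos_of_nonneg_of_le_pi (abs_nonneg _) (by linarith [hε.1, Real.pi_pos]) hz.2.le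

end Resolvent

/-! ### Pointwise bounds -/

/-- Applying the triangle inequality to the absolute values lets pointwise majorants involving `|x|`
be traded for norms of coordinate multiples. -/
theorem norm_le_sum_of_ae_le {ι : Type*} (t : Finset ι) {u : L2Plane} {v : ι → L2Plane} {A : ι → ℝ}
    (hA : ∀ i, 0 ≤ A i) (h : ∀ᵐ x, ‖u x‖ ≤ ∑ i ∈ t, A i * ‖v i x‖) :
    ‖u‖ ≤ ∑ i ∈ t, A i * ‖v i‖ := by
  set v' : ι → Lp ℝ 2 (volume : Measure Plane) := fun i => (Lp.memLp (v i)).norm.toLp with hv'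
  have hv'n : ∀ i, ‖v' i‖ = ‖v i‖ := fun i => by
    rw [hv', Lp.norm_toLp, eLpNorm_norm, Lp.norm_def]
  have hv'x : ∀ i, ∀ᵐ x, v' i x = ‖v i x‖ := fun i => (Lp.memLp (v i)).norm.coeFn_toLp
  have hx : ∀ t : Finset ι, ∀ᵐ x, (∑ i ∈ t, A i • v' i : Lp ℝ 2 (volume : Measure Plane)) x =
      ∑ i ∈ t, A i * ‖v i x‖ := by
    classical
    intro t
    induction t using Finset.induction_on with
    | empty => simp
    | insert i t hi ih =>
      rw [Finset.sum_insert hi]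
      filter_upwards [ih, Lp.coeFn_add (A i • v' i) (∑ i ∈ t, A i • v' i),
        Lp.coeFn_smul (A i) (v' i), hv'x i] with x h1 h2 h3 h4
      rw [h2, Pi.add_apply, h1, h3, Pi.smul_apply, h4, Finset.sum_insert hi, smul_eq_mul]
  calc ‖u‖ ≤ ‖(∑ i ∈ t, A i • v' i : Lp ℝ 2 (volume : Measure Plane))‖ := by
        refine Lp.norm_le_norm_of_ae_le ?_
        filter_upwards [h, hx t] with x h1 h2
        rw [h2]
        exact h1.trans (le_abs_self _)
    _ ≤ ∑ i ∈ t, ‖A i • v' i‖ := norm_sum_le _ _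
    _ = _ := Finset.sum_congr rfl fun i _ => by
        rw [norm_smul, hv'n, Real.norm_of_nonneg (hA i)]

theorem norm_toL2_le_sum {ι : Type*} (t : Finset ι) {u : 𝓢(Plane, ℂ)} {v : ι → 𝓢(Plane, ℂ)}
    {A : ι → ℝ} (hA : ∀ i, 0 ≤ A i) (h : ∀ x, ‖u x‖ ≤ ∑ i ∈ t, A i * ‖v i x‖) :
    ‖toL2 u‖ ≤ ∑ i ∈ t, A i * ‖toL2 (v i)‖ := by
  refine norm_le_sum_of_ae_le t hA ?_
  have h1 : ∀ᵐ x, ∀ i ∈ t, toL2 (v i) x = v i x :=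
    (Finset.eventually_all t).2 fun i _ => (v i).coeFn_toLp 2 volume
  filter_upwards [u.coeFn_toLp 2 volume, h1] with x hu hv
  rw [toL2_apply, hu]
  refine (h x).trans (le_of_eq (Finset.sum_congr rfl fun i hi => ?_))
  rw [hv i hi]

theorem norm_toL2_le_two {u v₀ v₁ : 𝓢(Plane, ℂ)} {A : ℝ} (hA : 0 ≤ A)
    (h : ∀ x, ‖u x‖ ≤ A * (‖v₀ x‖ + ‖v₁ x‖)) : ‖toL2 u‖ ≤ A * (‖toL2 v₀‖ + ‖toL2 v₁‖) := by
  have h1 := norm_toL2_le_sum (Finset.univ : Finset (Fin 2)) (u := u) (v := ![v₀, v₁])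
    (A := fun _ => A) (fun _ => hA) (fun x => by
      rw [Fin.sum_univ_two, ← mul_add]
      exact h x)
  rw [Fin.sum_univ_two, ← mul_add] at h1
  exact h1

theorem norm_rot_position {c d : ℝ} (hcd : c ^ 2 + d ^ 2 = 1) (φ : 𝓢(Plane, ℂ)) (x : Plane) :
    ‖x‖ * ‖φ x‖ ≤ ‖rot c d position 0 φ x‖ + ‖rot c d position 1 φ x‖ ∧
    ‖x‖ ^ 2 * ‖φ x‖ ≤ ‖rot c d position 0 (rot c d position 0 φ) x‖ +
      ‖rot c d position 1 (rot c d position 1 φ) x‖ := by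
  simp only [rot_position_zero_apply, rot_position_one_apply, norm_mul, Complex.norm_real,
    Real.norm_eq_abs, ← mul_assoc, ← add_mul]
  have hx : ‖x‖ ^ 2 = (c * x 0 + d * x 1) ^ 2 + (-d * x 0 + c * x 1) ^ 2 := by
    rw [EuclideanSpace.norm_sq_eq, Fin.sum_univ_two, Real.norm_eq_abs, Real.norm_eq_abs, sq_abs,
      sq_abs]
    linear_combination (-(x 0 ^ 2 + x 1 ^ 2)) * hcd
  refine ⟨mul_le_mul_of_nonneg_right ?_ (norm_nonneg _),
    mul_le_mul_of_nonneg_right ?_ (norm_nonneg _)⟩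
  · refine le_of_sq_le_sq ?_ (by positivity)
    rw [hx, ← sq_abs (c * x 0 + d * x 1), ← sq_abs (-d * x 0 + c * x 1)]
    nlinarith [mul_nonneg (abs_nonneg (c * x 0 + d * x 1)) (abs_nonneg (-d * x 0 + c * x 1))]
  · rw [hx, abs_mul_abs_self, abs_mul_abs_self]
    nlinarith

/-! ### Multiplication operators -/

/-- Multiplication by a function of temperate growth. -/
def mulOp (q : Plane → ℂ) : SchwartzOp := SchwartzMap.smulLeftCLM ℂ q

theorem mulOp_apply {q : Plane → ℂ} (hq : q.HasTemperateGrowth) (φ : 𝓢(Plane, ℂ)) (x : Plane) :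
    mulOp q φ x = q x * φ x :=
  SchwartzMap.smulLeftCLM_apply_apply hq φ x

theorem hasTemperateGrowth_fderiv {E F : Type*} [NormedAddCommGroup E] [NormedSpace ℝ E]
    [NormedAddCommGroup F] [NormedSpace ℝ F] {f : E → F} (hf : f.HasTemperateGrowth) :
    (fderiv ℝ f).HasTemperateGrowth := by
  refine ⟨(contDiff_infty_iff_fderiv.1 hf.1).2, fun n => ?_⟩
  obtain ⟨k, C, h⟩ := hf.2 (n + 1)
  exact ⟨k, C, fun x => by rw [norm_iteratedFDeriv_fderiv]; exact h x⟩

/-- The function `-i ∂_j q`. -/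
def dq (j : Fin 2) (q : Plane → ℂ) (x : Plane) : ℂ :=
  -Complex.I * fderiv ℝ q x (EuclideanSpace.single j (1 : ℝ))

theorem dq_hasTemperateGrowth {q : Plane → ℂ} (hq : q.HasTemperateGrowth) (j : Fin 2) :
    (dq j q).HasTemperateGrowth := by
  have h1 : (fun x => fderiv ℝ q x (EuclideanSpace.single j (1 : ℝ))).HasTemperateGrowth :=
    (ContinuousLinearMap.apply ℝ ℂ
      (EuclideanSpace.single j (1 : ℝ) : Plane)).hasTemperateGrowth.comp
      (hasTemperateGrowth_fderiv hq)
  exact (Function.HasTemperateGrowth.const (-Complex.I)).mul h1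

theorem norm_dq_le (q : Plane → ℂ) (j : Fin 2) (x : Plane) : ‖dq j q x‖ ≤ ‖fderiv ℝ q x‖ := by
  rw [dq, norm_mul, norm_neg, Complex.norm_I, one_mul]
  refine (ContinuousLinearMap.le_opNorm _ _).trans ?_
  rw [PiLp.norm_single, norm_one, mul_one]

theorem momentum_mulOp {q : Plane → ℂ} (hq : q.HasTemperateGrowth) (j : Fin 2)
    (φ : 𝓢(Plane, ℂ)) :
    momentum j (mulOp q φ) = mulOp q (momentum j φ) + mulOp (dq j q) φ := by
  ext x
  have hd : DifferentiableAt ℝ q x := hq.1.differentiable (by simp) x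
  have hφ : DifferentiableAt ℝ φ x := φ.differentiableAt
  have e : fderiv ℝ (mulOp q φ) x = fderiv ℝ (fun y => q y * φ y) x := by
    congr 1
    ext y
    exact mulOp_apply hq φ y
  rw [add_apply, momentum_apply, mulOp_apply hq, momentum_apply,
    mulOp_apply (dq_hasTemperateGrowth hq j), e, fderiv_fun_mul hd hφ, dq]
  simp only [add_apply, smul_apply, smul_eq_mul]
  ring

theorem position_mulOp {q : Plane → ℂ} (hq : q.HasTemperateGrowth) (j : Fin 2)
    (φ : 𝓢(Plane, ℂ)) : position j (mulOp q φ) = mulOp q (position j φ) := by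
  ext x
  rw [position_apply, mulOp_apply hq, mulOp_apply hq, position_apply]
  ring

/-- The Laplacian of `q`, up to the sign. -/
def lapl (q : Plane → ℂ) : SchwartzOp := mulOp (dq 0 (dq 0 q)) + mulOp (dq 1 (dq 1 q))

/-- Leibniz' rule: the commutator with a function is first order, twice its gradient against the
magnetic momenta plus its Laplacian. The Laplacian does not depend on the frame. -/
theorem hamS_mulOp {c d : ℝ} (hcd : c ^ 2 + d ^ 2 = 1) (s : Fin 2 → ℝ) (b : ℝ) (l : ℂ)
    {q : Plane → ℂ} (hq : q.HasTemperateGrowth) (φ : 𝓢(Plane, ℂ)) :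
    hamS c d s b l (mulOp q φ) = mulOp q (hamS c d s b l φ) +
      ((2 : ℂ) • (rot c d (fun j => mulOp (dq j q)) 0
          (magP (rot c d momentum) (rot c d position) b l 0 φ) +
        rot c d (fun j => mulOp (dq j q)) 1
          (magP (rot c d momentum) (rot c d position) b l 1 φ)) + lapl q φ) := by
  have hcd' : (c : ℂ) ^ 2 + (d : ℂ) ^ 2 = 1 := by exact_mod_cast hcd
  have hd := dq_hasTemperateGrowth hq
  have h0 := momentum_mulOp hq
  have h1 := fun j => momentum_mulOp (hd j)
  have h2 := position_mulOp hq
  have h3 := fun j => position_mulOp (hd j)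
  -- Symmetry of the second derivatives of `q`, read off from commuting the momenta on `q φ`.
  have hsym : mulOp (dq 0 (dq 1 q)) φ = mulOp (dq 1 (dq 0 q)) φ := by
    have e1 := momentum_comm 0 1 (mulOp q φ)
    rw [h0, h0, map_add, map_add, h0, h0, h1, h1, momentum_comm 0 1 φ] at e1
    linear_combination (norm := module) e1
  simp only [hamS, ham, sumSq, magP_zero, magP_one, LinearMap.add_apply,
      LinearMap.sub_apply, LinearMap.smul_apply, LinearMap.comp_apply, rot_zero_apply,
      rot_one_apply, map_add, map_sub, map_smul, h0, h1, h2, h3, lapl, add_apply]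
  linear_combination (norm := module) hcd' • (mulOp (dq 0 (dq 0 q)) φ + mulOp (dq 1 (dq 1 q)) φ)

/-! ### Weights and their commutators -/

/-- A positive bounded weight that varies on the scale `(δ ρ |x|)⁻¹`. -/
structure IsWeight (δ ρ : ℝ) (g : Plane → ℝ) : Prop where
  temperate : (fun x => (g x : ℂ)).HasTemperateGrowth
  pos : ∀ x, 0 < g x
  bdd : ∃ B, ∀ x, g x ≤ B
  first : ∀ x, ‖fderiv ℝ (fun x => (g x : ℂ)) x‖ ≤ δ * ρ * ‖x‖ * g x
  second : ∀ x j, ‖dq j (dq j fun x => (g x : ℂ)) x‖ ≤ δ * ρ ^ 2 * ‖x‖ ^ 2 * g x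

section Weight

variable {c d : ℝ} {s : Fin 2 → ℝ} {δ ρ : ℝ} {g : Plane → ℝ} {l : ℂ}

/-- Multiplication by a real weight. -/
def wOp (g : Plane → ℝ) : SchwartzOp := mulOp fun x => (g x : ℂ)

/-- The commutators of the weight with the momenta, in the frame `(c, d)`. -/
def wGrad (c d : ℝ) (g : Plane → ℝ) : Fin 2 → 𝓢(Plane, ℂ) →ₗ[ℂ] 𝓢(Plane, ℂ) :=
  rot c d (fun j => mulOp (dq j fun x => (g x : ℂ)))

theorem IsWeight.wOp_apply (hg : IsWeight δ ρ g) (φ : 𝓢(Plane, ℂ)) (x : Plane) :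
    wOp g φ x = (g x : ℂ) * φ x := mulOp_apply hg.temperate φ x

theorem IsWeight.norm_wOp_apply (hg : IsWeight δ ρ g) (φ : 𝓢(Plane, ℂ)) (x : Plane) :
    ‖wOp g φ x‖ = g x * ‖φ x‖ := by
  rw [hg.wOp_apply, norm_mul, Complex.norm_real, Real.norm_of_nonneg (hg.pos x).le]

theorem abs_le_one_of_unit (hcd : c ^ 2 + d ^ 2 = 1) : |c| ≤ 1 ∧ |d| ≤ 1 :=
  ⟨abs_le_one_iff_mul_self_le_one.2 (by nlinarith), abs_le_one_iff_mul_self_le_one.2 (by nlinarith)⟩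

theorem IsWeight.norm_mulOp_dq_le (hg : IsWeight δ ρ g) (j : Fin 2) (φ : 𝓢(Plane, ℂ)) (x : Plane) :
    ‖mulOp (dq j fun x => (g x : ℂ)) φ x‖ ≤ δ * ρ * (‖x‖ * ‖wOp g φ x‖) := by
  rw [mulOp_apply (dq_hasTemperateGrowth hg.temperate j), norm_mul, hg.norm_wOp_apply]
  calc _ ≤ δ * ρ * ‖x‖ * g x * ‖φ x‖ :=
        mul_le_mul_of_nonneg_right ((norm_dq_le _ j x).trans (hg.first x)) (norm_nonneg _)
    _ = _ := by ring

theorem IsWeight.norm_wGrad_le (hg : IsWeight δ ρ g) (hcd : c ^ 2 + d ^ 2 = 1)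
    (k : Fin 2) (φ : 𝓢(Plane, ℂ)) (x : Plane) :
    ‖wGrad c d g k φ x‖ ≤ 2 * (δ * ρ) * (‖x‖ * ‖wOp g φ x‖) := by
  obtain ⟨hc, hd⟩ := abs_le_one_of_unit hcd
  have h0 := hg.norm_mulOp_dq_le 0 φ x
  have h1 := hg.norm_mulOp_dq_le 1 φ x
  have key : ∀ a e : ℝ, |a| ≤ 1 → |e| ≤ 1 →
      ‖(a : ℂ) * mulOp (dq 0 fun x => (g x : ℂ)) φ x +
        (e : ℂ) * mulOp (dq 1 fun x => (g x : ℂ)) φ x‖ ≤ 2 * (δ * ρ) * (‖x‖ * ‖wOp g φ x‖) := by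
    intro a e ha he
    refine (norm_add_le _ _).trans ?_
    rw [norm_mul, norm_mul, Complex.norm_real, Complex.norm_real, Real.norm_eq_abs,
      Real.norm_eq_abs]
    have := mul_le_mul ha h0 (norm_nonneg _) zero_le_one
    have := mul_le_mul he h1 (norm_nonneg _) zero_le_one
    linarith
  fin_cases k
  · exact key c d hc hd
  · have := key (-d) c (by rwa [abs_neg]) hc
    push_cast at this
    exact this

/-- The factor `|x|` in the gradient bound becomes a position operator, and the weight is moved
inside the momentum (hypothesis `hψ`) at the price of one more gradient. Everything is then a
second-order expression in the weighted function. -/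
theorem IsWeight.norm_wGrad_toL2_le (hg : IsWeight δ ρ g) (hδρ : 0 ≤ δ * ρ)
    (hcd : c ^ 2 + d ^ 2 = 1) (k : Fin 2) {φ ψ₀ ψ₁ : 𝓢(Plane, ℂ)}
    (hψ : wOp g φ = ψ₀ - wGrad c d g k ψ₁) :
    ‖toL2 (wGrad c d g k φ)‖ ≤ 2 * (δ * ρ) *
      ((‖toL2 (rot c d position 0 ψ₀)‖ + ‖toL2 (rot c d position 1 ψ₀)‖) + 2 * (δ * ρ) *
        (‖toL2 (rot c d position 0 (rot c d position 0 (wOp g ψ₁)))‖ +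
          ‖toL2 (rot c d position 1 (rot c d position 1 (wOp g ψ₁)))‖)) := by
  have h := norm_toL2_le_sum (Finset.univ : Finset (Fin 4)) (u := wGrad c d g k φ)
    (v := ![rot c d position 0 ψ₀, rot c d position 1 ψ₀,
      rot c d position 0 (rot c d position 0 (wOp g ψ₁)),
      rot c d position 1 (rot c d position 1 (wOp g ψ₁))])
    (A := ![2 * (δ * ρ), 2 * (δ * ρ), 2 * (δ * ρ) * (2 * (δ * ρ)), 2 * (δ * ρ) * (2 * (δ * ρ))])
    (fun i => by fin_cases i <;> simp <;> positivity) (fun x => ?_)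
  · simp only [Fin.sum_univ_four, Matrix.cons_val] at h
    refine h.trans (le_of_eq ?_)
    ring
  · simp only [Fin.sum_univ_four, Matrix.cons_val]
    have h1 := hg.norm_wGrad_le hcd k φ x
    have h2 := hg.norm_wGrad_le hcd k ψ₁ x
    have h3 := (norm_rot_position hcd ψ₀ x).1
    have h4 := (norm_rot_position hcd (wOp g ψ₁) x).2
    have h5 : ‖wOp g φ x‖ ≤ ‖ψ₀ x‖ + ‖wGrad c d g k ψ₁ x‖ := by
      rw [hψ, sub_apply]
      exact norm_sub_le _ _
    calc _ ≤ 2 * (δ * ρ) * (‖x‖ * ‖wOp g φ x‖) := h1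
      _ ≤ 2 * (δ * ρ) * (‖x‖ * (‖ψ₀ x‖ + 2 * (δ * ρ) * (‖x‖ * ‖wOp g ψ₁ x‖))) := by
        gcongr
        exact h5.trans (by gcongr)
      _ = 2 * (δ * ρ) * (‖x‖ * ‖ψ₀ x‖ + 2 * (δ * ρ) * (‖x‖ ^ 2 * ‖wOp g ψ₁ x‖)) := by ring
      _ ≤ 2 * (δ * ρ) * ((‖rot c d position 0 ψ₀ x‖ + ‖rot c d position 1 ψ₀ x‖) + 2 * (δ * ρ) *
          (‖rot c d position 0 (rot c d position 0 (wOp g ψ₁)) x‖ +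
          ‖rot c d position 1 (rot c d position 1 (wOp g ψ₁)) x‖)) := by gcongr
      _ = _ := by ring

theorem IsWeight.norm_lapl_le (hg : IsWeight δ ρ g) (hδ : 0 ≤ δ) (hcd : c ^ 2 + d ^ 2 = 1)
    (φ : 𝓢(Plane, ℂ)) :
    ‖toL2 (lapl (fun x => (g x : ℂ)) φ)‖ ≤ 2 * (δ * ρ ^ 2) *
      (‖toL2 (rot c d position 0 (rot c d position 0 (wOp g φ)))‖ +
        ‖toL2 (rot c d position 1 (rot c d position 1 (wOp g φ)))‖) := by
  refine norm_toL2_le_two (by positivity) fun x => ?_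
  have ht := fun j => dq_hasTemperateGrowth (dq_hasTemperateGrowth hg.temperate j) j
  have h4 := (norm_rot_position hcd (wOp g φ) x).2
  have h2 : ∀ j, ‖mulOp (dq j (dq j fun x => (g x : ℂ))) φ x‖ ≤
      δ * ρ ^ 2 * (‖x‖ ^ 2 * ‖wOp g φ x‖) := by
    intro j
    rw [mulOp_apply (ht j), norm_mul, hg.norm_wOp_apply]
    calc _ ≤ δ * ρ ^ 2 * ‖x‖ ^ 2 * g x * ‖φ x‖ :=
          mul_le_mul_of_nonneg_right (hg.second x j) (norm_nonneg _)
      _ = _ := by ring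
  calc _ ≤ δ * ρ ^ 2 * (‖x‖ ^ 2 * ‖wOp g φ x‖) + δ * ρ ^ 2 * (‖x‖ ^ 2 * ‖wOp g φ x‖) := by
        rw [lapl, add_apply, add_apply]
        exact (norm_add_le _ _).trans (add_le_add (h2 0) (h2 1))
    _ = 2 * (δ * ρ ^ 2) * (‖x‖ ^ 2 * ‖wOp g φ x‖) := by ring
    _ ≤ _ := by gcongr

/-- Bounds on second order monomials by the size. -/
theorem norm_monomial_le (hs : ∀ j, 0 < s j) {K : ℝ} (hK0 : 0 ≤ K) (hK : ∀ j, (s j)⁻¹ ≤ K)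
    (hl : l ≠ 0) (w : 𝓢(Plane, ℂ)) :
    (∀ i, √‖l‖ * ‖toL2 (rot c d position i w)‖ ≤ K * size c d s l w) ∧
    (∀ i j, ‖toL2 (rot c d position i (rot c d momentum j w))‖ ≤ K * size c d s l w) ∧
    ∀ i j, ‖l‖ * ‖toL2 (rot c d position i (rot c d position j w))‖ ≤ K ^ 2 * size c d s l w := by
  have hn : 0 < ‖l‖ := norm_pos_iff.2 hl
  have hr : 0 < √‖l‖ := Real.sqrt_pos.2 hn
  have hN := size_nonneg c d s l w
  obtain ⟨-, -, hX, -, hXP, hXX⟩ := norm_le_norm2 toL2 (scaledP c d √‖l‖) (scaledX c d s √‖l‖) w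
  change ∀ j, _ ≤ size c d s l w at hX
  change ∀ i j, _ ≤ size c d s l w at hXP hXX
  simp only [scaledX, scaledP, LinearMap.smul_apply, map_smul, norm_smul,
    Complex.norm_real] at hX hXP hXX
  refine ⟨fun i => ?_, fun i j => ?_, fun i j => ?_⟩
  · have h := hX i
    rw [Real.norm_of_nonneg (mul_nonneg (hs i).le hr.le), mul_assoc, ← le_inv_mul_iff₀ (hs i)] at h
    exact h.trans (mul_le_mul_of_nonneg_right (hK i) hN)
  · have h := hXP i j
    rw [Real.norm_of_nonneg (mul_nonneg (hs i).le hr.le),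
      Real.norm_of_nonneg (inv_pos.2 hr).le] at h
    have e : (√‖l‖)⁻¹ * (s i * √‖l‖ * ‖toL2 (rot c d position i (rot c d momentum j w))‖) =
      s i * ‖toL2 (rot c d position i (rot c d momentum j w))‖ := by field_simp
    rw [e, ← le_inv_mul_iff₀ (hs i)] at h
    exact h.trans (mul_le_mul_of_nonneg_right (hK i) hN)
  · have h := hXX i j
    rw [Real.norm_of_nonneg (mul_nonneg (hs i).le hr.le),
      Real.norm_of_nonneg (mul_nonneg (hs j).le hr.le)] at h
    have e : s j * √‖l‖ * (s i * √‖l‖ * ‖toL2 (rot c d position i (rot c d position j w))‖) =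
      s j * (s i * (‖l‖ * ‖toL2 (rot c d position i (rot c d position j w))‖)) := by
      have := Real.mul_self_sqrt hn.le
      linear_combination (s i * s j * ‖toL2 (rot c d position i (rot c d position j w))‖) * this
    rw [e, ← le_inv_mul_iff₀ (hs j), ← le_inv_mul_iff₀ (hs i), ← mul_assoc] at h
    refine h.trans (mul_le_mul_of_nonneg_right ?_ hN)
    rw [sq]
    exact mul_le_mul (hK i) (hK j) (inv_pos.2 (hs j)).le hK0

/-- The commutator of the magnetic oscillator with a weight is relatively bounded. -/
theorem IsWeight.norm_commutator_le (hg : IsWeight δ ρ g) (hδ : 0 ≤ δ) (hδ1 : δ ≤ 1)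
    (hcd : c ^ 2 + d ^ 2 = 1) (hs : ∀ j, 0 < s j) {K : ℝ} (hK1 : 1 ≤ K) (hK : ∀ j, (s j)⁻¹ ≤ K)
    {b : ℝ} (hb0 : 0 ≤ b) (hb1 : b ≤ 1) (hl : l ≠ 0) (hρ : ρ = ‖l‖) (w : 𝓢(Plane, ℂ)) :
    ‖toL2 (hamS c d s b l (wOp g w) - wOp g (hamS c d s b l w))‖ ≤
      68 * K ^ 2 * δ * (‖l‖ * size c d s l (wOp g w)) := by
  have hn : 0 < ‖l‖ := norm_pos_iff.2 hl
  obtain ⟨-, hXP, hXX⟩ := norm_monomial_le (c := c) (d := d) hs (zero_le_one.trans hK1) hK hl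
    (wOp g w)
  set N := size c d s l (wOp g w) with hN
  have hN0 : 0 ≤ N := size_nonneg c d s l _
  subst hρ
  have hmag : ∀ i k, ‖toL2 (rot c d position i
      (magP (rot c d momentum) (rot c d position) b l k (wOp g w)))‖ ≤ 2 * K ^ 2 * N := by
    have hKK : K ≤ K ^ 2 := by nlinarith
    have hbl : ‖(b * l / 2 : ℂ)‖ ≤ ‖l‖ := by
      rw [norm_div, norm_mul, Complex.norm_real, Real.norm_of_nonneg hb0, Complex.norm_ofNat]
      nlinarith
    have h3 : ∀ i j, ‖(b * l / 2 : ℂ)‖ *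
        ‖toL2 (rot c d position i (rot c d position j (wOp g w)))‖ ≤
        K ^ 2 * N := fun i j =>
      (mul_le_mul_of_nonneg_right hbl (norm_nonneg _)).trans (hXX i j)
    have h4 : ∀ i j, ‖toL2 (rot c d position i (rot c d momentum j (wOp g w)))‖ ≤ K ^ 2 * N :=
      fun i j => (hXP i j).trans (mul_le_mul_of_nonneg_right hKK hN0)
    intro i k
    fin_cases k
    · simp only [Fin.zero_eta, magP_zero, LinearMap.add_apply, LinearMap.smul_apply, map_add,
        map_smul]
      refine (norm_add_le _ _).trans ?_
      rw [norm_smul]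
      linarith [h3 i 1, h4 i 0]
    · simp only [Fin.mk_one, magP_one, LinearMap.sub_apply, LinearMap.smul_apply, map_sub,
        map_smul]
      refine (norm_sub_le _ _).trans ?_
      rw [norm_smul]
      linarith [h3 i 0, h4 i 1]
  have hpsi : ∀ k, wOp g (magP (rot c d momentum) (rot c d position) b l k w) =
      magP (rot c d momentum) (rot c d position) b l k (wOp g w) - wGrad c d g k w := by
    intro k
    have h0 := momentum_mulOp hg.temperate
    have h2 := position_mulOp hg.temperate
    fin_cases k
    · simp only [Fin.zero_eta, magP_zero, LinearMap.add_apply, LinearMap.smul_apply, wOp, wGrad,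
        rot_zero_apply, rot_one_apply, map_add, map_smul, h0, h2]
      module
    · simp only [Fin.mk_one, magP_one, LinearMap.sub_apply, LinearMap.smul_apply, wOp, wGrad,
        rot_zero_apply, rot_one_apply, map_add, map_sub, map_smul, h0, h2]
      module
  -- The constants: `16` from each of two gradient terms, doubled by Leibniz' rule, plus `4` from
  -- the Laplacian, make the final `68`.
  have hgrad : ∀ k, ‖toL2 (wGrad c d g k
      (magP (rot c d momentum) (rot c d position) b l k w))‖ ≤ 16 * K ^ 2 * δ * (‖l‖ * N) := by
    intro k
    refine (hg.norm_wGrad_toL2_le (by positivity) hcd k (hpsi k)).trans ?_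
    have h1 := hmag 0 k
    have h2 := hmag 1 k
    have h3 := hXX 0 0
    have h4 := hXX 1 1
    have h5 : 2 * (δ * ‖l‖) *
        (‖toL2 (rot c d position 0 (rot c d position 0 (wOp g w)))‖ +
          ‖toL2 (rot c d position 1 (rot c d position 1 (wOp g w)))‖) ≤ 2 * (2 * (K ^ 2 * N)) := by
      have h6 : δ * (‖l‖ * (‖toL2 (rot c d position 0 (rot c d position 0 (wOp g w)))‖ +
          ‖toL2 (rot c d position 1 (rot c d position 1 (wOp g w)))‖)) ≤ 1 * (2 * (K ^ 2 * N)) :=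
        mul_le_mul hδ1 (by linarith) (by positivity) zero_le_one
      linarith
    calc _ ≤ 2 * (δ * ‖l‖) * ((2 * K ^ 2 * N + 2 * K ^ 2 * N) + 2 * (2 * (K ^ 2 * N))) := by
          gcongr
      _ ≤ _ := by
          have : 0 ≤ δ * ‖l‖ * (K ^ 2 * N) := by positivity
          linarith
  have hlap : ‖toL2 (lapl (fun x => (g x : ℂ)) w)‖ ≤ 4 * K ^ 2 * δ * (‖l‖ * N) := by
    refine (hg.norm_lapl_le hδ hcd w).trans ?_
    have h6 : δ * ‖l‖ * (‖l‖ * (‖toL2 (rot c d position 0 (rot c d position 0 (wOp g w)))‖ +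
          ‖toL2 (rot c d position 1 (rot c d position 1 (wOp g w)))‖)) ≤
        δ * ‖l‖ * (2 * (K ^ 2 * N)) :=
      mul_le_mul_of_nonneg_left (by linarith [hXX 0 0, hXX 1 1]) (by positivity)
    linarith
  have e : hamS c d s b l (wOp g w) - wOp g (hamS c d s b l w) =
      (2 : ℂ) • (wGrad c d g 0 (magP (rot c d momentum) (rot c d position) b l 0 w) +
        wGrad c d g 1 (magP (rot c d momentum) (rot c d position) b l 1 w)) +
      lapl (fun x => (g x : ℂ)) w := by
    rw [wOp, hamS_mulOp hcd s b l hg.temperate w, add_sub_cancel_left]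
    rfl
  rw [e, map_add, map_smul, map_add]
  refine (norm_add_le _ _).trans ?_
  rw [norm_smul, Complex.norm_ofNat]
  have := norm_add_le (toL2 (wGrad c d g 0 (magP (rot c d momentum) (rot c d position) b l 0 w)))
    (toL2 (wGrad c d g 1 (magP (rot c d momentum) (rot c d position) b l 1 w)))
  linarith [hgrad 0, hgrad 1, mul_nonneg hn.le hN0]

/-- The weighted estimate. -/
theorem IsGood.size_wOp_le {b : ℝ} {ξ a : ℂ} {C η : ℝ} (h : IsGood c d s b ξ a C η l)
    (hg : IsWeight δ ‖l‖ g) (hδ : 0 ≤ δ) (hδ1 : δ ≤ 1)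
    (hcd : c ^ 2 + d ^ 2 = 1) (hs : ∀ j, 0 < s j) {K : ℝ} (hK1 : 1 ≤ K) (hK : ∀ j, (s j)⁻¹ ≤ K)
    (hb0 : 0 ≤ b) (hb1 : b ≤ 1) (hη : 68 * K ^ 2 * δ ≤ η) (w : 𝓢(Plane, ℂ)) :
    ‖l‖ * size c d s l (wOp g w) ≤
      C * ‖toL2 (wOp g (hamS c d s b l w - (l * spec s b ξ a l) • w))‖ := by
  refine h.est _ _ ?_
  -- The spectral term commutes with the weight, so the defect to be absorbed is the commutator with
  -- the Hamiltonian alone.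
  have e : shifted c d s b ξ a l (wOp g w) -
      toL2 (wOp g (hamS c d s b l w - (l * spec s b ξ a l) • w)) =
      toL2 (hamS c d s b l (wOp g w) - wOp g (hamS c d s b l w)) := by
    rw [shifted_apply]
    simp only [map_sub, map_smul]
    abel
  rw [e, mul_assoc]
  refine (hg.norm_commutator_le hδ hδ1 hcd hs hK1 hK hb0 hb1 h.ne_zero rfl w).trans ?_
  exact mul_le_mul_of_nonneg_right hη (mul_nonneg (norm_nonneg _) (size_nonneg c d s l _))

theorem IsWeight.norm_wOp_momentum_le (hg : IsWeight δ ‖l‖ g) (hδ : 0 ≤ δ) (hδ1 : δ ≤ 1)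
    (hcd : c ^ 2 + d ^ 2 = 1) (hs : ∀ j, 0 < s j) {K : ℝ} (hK1 : 1 ≤ K) (hK : ∀ j, (s j)⁻¹ ≤ K)
    (hl : 1 ≤ ‖l‖) (j : Fin 2) (w : 𝓢(Plane, ℂ)) :
    ‖toL2 (wOp g (momentum j w))‖ ≤ 4 * K * (√‖l‖ * size c d s l (wOp g w)) := by
  have hn : 0 < ‖l‖ := zero_lt_one.trans_le hl
  have hN := size_nonneg c d s l (wOp g w)
  have hr := Real.sqrt_nonneg ‖l‖
  have h0 := momentum_mulOp hg.temperate j w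
  have e : wOp g (momentum j w) =
      momentum j (wOp g w) - mulOp (dq j fun x => (g x : ℂ)) w := by
    rw [wOp, h0, add_sub_cancel_right]
  rw [e, map_sub]
  have h1 := IsGood.norm_momentum_le_size (s := s) hcd hl j (wOp g w)
  have h2 : ‖toL2 (mulOp (dq j fun x => (g x : ℂ)) w)‖ ≤ δ * ‖l‖ *
      (‖toL2 (rot c d position 0 (wOp g w))‖ + ‖toL2 (rot c d position 1 (wOp g w))‖) :=
    norm_toL2_le_two (by positivity) fun x => (hg.norm_mulOp_dq_le j w x).trans
      (mul_le_mul_of_nonneg_left (norm_rot_position hcd (wOp g w) x).1 (by positivity))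
  obtain ⟨hX, -, -⟩ := norm_monomial_le (c := c) (d := d) hs (zero_le_one.trans hK1) hK
    (norm_pos_iff.1 hn) (wOp g w)
  have h3 : δ * ‖l‖ *
      (‖toL2 (rot c d position 0 (wOp g w))‖ + ‖toL2 (rot c d position 1 (wOp g w))‖) ≤
      √‖l‖ * (2 * (K * size c d s l (wOp g w))) := by
    have h4 : √‖l‖ * (√‖l‖ *
      (‖toL2 (rot c d position 0 (wOp g w))‖ + ‖toL2 (rot c d position 1 (wOp g w))‖)) ≤
      √‖l‖ * (2 * (K * size c d s l (wOp g w))) :=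
      mul_le_mul_of_nonneg_left (by linarith [hX 0, hX 1]) hr
    rw [← mul_assoc, Real.mul_self_sqrt hn.le] at h4
    refine le_trans ?_ h4
    gcongr
    nlinarith
  refine (norm_sub_le _ _).trans ?_
  have h5 : √‖l‖ * size c d s l (wOp g w) ≤ K * (√‖l‖ * size c d s l (wOp g w)) :=
    le_mul_of_one_le_left (by positivity) hK1
  linarith

end Weight

/-! ### Mollification -/

section Mollify

open scoped Convolution

variable {F : Type} [NormedAddCommGroup F] [NormedSpace ℝ F] {f : Plane → ℝ} {φ : Plane → F}

/-- The convolution of a real function with a kernel. -/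
def mollify (f : Plane → ℝ) (φ : Plane → F) : Plane → F :=
  f ⋆[ContinuousLinearMap.lsmul ℝ ℝ, volume] φ

theorem mollify_apply (f : Plane → ℝ) (φ : Plane → F) (x : Plane) :
    mollify f φ x = ∫ t, f t • φ (x - t) := rfl

theorem hasFDerivAt_mollify (hf : Continuous f) (hφ : ContDiff ℝ (⊤ : ℕ∞) φ)
    (hc : HasCompactSupport φ) (x : Plane) :
    HasFDerivAt (mollify f φ) (mollify f (fderiv ℝ φ) x) x := by
  have h := hc.hasFDerivAt_convolution_right (ContinuousLinearMap.lsmul ℝ ℝ)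
    hf.locallyIntegrable (hφ.of_le (by simp)) x (μ := volume)
  have e : (f ⋆[ContinuousLinearMap.precompR Plane (ContinuousLinearMap.lsmul ℝ ℝ), volume]
      fderiv ℝ φ) x = mollify f (fderiv ℝ φ) x := by
    rw [mollify_apply]
    refine integral_congr_ae (Filter.Eventually.of_forall fun t => ?_)
    ext v
    rfl
  rw [e] at h
  exact h

theorem norm_mollify_le {B : ℝ} (hB : ∀ x, |f x| ≤ B) (hφ : Continuous φ)
    (hc : HasCompactSupport φ) (x : Plane) : ‖mollify f φ x‖ ≤ B * ∫ t, ‖φ t‖ := by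
  have hi : Integrable (fun t => ‖φ (x - t)‖) :=
    (hφ.integrable_of_hasCompactSupport hc).norm.comp_sub_left x
  rw [mollify_apply]
  refine (norm_integral_le_of_norm_le (hi.const_mul B)
    (Filter.Eventually.of_forall fun t => ?_)).trans
    (le_of_eq ?_)
  · rw [norm_smul, Real.norm_eq_abs]
    exact mul_le_mul_of_nonneg_right (hB t) (norm_nonneg _)
  · rw [integral_const_mul, integral_sub_left_eq_self (fun t => ‖φ t‖) volume x]

/-- Derivatives fall on the kernel, whose values then lie in a space of linear maps; hence the
induction ranges over all target spaces. -/
theorem exists_norm_iteratedFDeriv_mollify_le {B : ℝ} (hf : Continuous f) (hB : ∀ x, |f x| ≤ B)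
    (n : ℕ) : ∀ (F : Type) [NormedAddCommGroup F] [NormedSpace ℝ F] (φ : Plane → F),
      ContDiff ℝ (⊤ : ℕ∞) φ → HasCompactSupport φ →
      ∃ K, ∀ x, ‖iteratedFDeriv ℝ n (mollify f φ) x‖ ≤ K := by
  induction n with
  | zero =>
    intro F _ _ φ hφ hc
    refine ⟨B * ∫ t, ‖φ t‖, fun x => ?_⟩
    rw [norm_iteratedFDeriv_zero]
    exact norm_mollify_le hB hφ.continuous hc x
  | succ n ih =>
    intro F _ _ φ hφ hc
    obtain ⟨K, hK⟩ := ih _ (fderiv ℝ φ) (contDiff_infty_iff_fderiv.1 hφ).2 (hc.fderiv ℝ)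
    refine ⟨K, fun x => ?_⟩
    have e : fderiv ℝ (mollify f φ) = mollify f (fderiv ℝ φ) :=
      funext fun y => (hasFDerivAt_mollify hf hφ hc y).fderiv
    rw [← norm_iteratedFDeriv_fderiv, e]
    exact hK x

theorem mollify_hasTemperateGrowth {B : ℝ} (hf : Continuous f) (hB : ∀ x, |f x| ≤ B)
    (hφ : ContDiff ℝ (⊤ : ℕ∞) φ) (hc : HasCompactSupport φ) : (mollify f φ).HasTemperateGrowth := by
  refine ⟨hc.contDiff_convolution_right _ hf.locallyIntegrable hφ, fun n => ?_⟩
  obtain ⟨K, hK⟩ := exists_norm_iteratedFDeriv_mollify_le hf hB n F φ hφ hc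
  exact ⟨0, K, fun x => by rw [pow_zero, mul_one]; exact hK x⟩

/-- Convolving the constant `1` with `φ` gives a constant, whose derivative is this integral. -/
theorem integral_fderiv_eq_zero (hφ : ContDiff ℝ (⊤ : ℕ∞) φ) (hc : HasCompactSupport φ) :
    ∫ t, fderiv ℝ φ t = 0 := by
  have h := hasFDerivAt_mollify (f := fun _ => (1 : ℝ)) continuous_const hφ hc 0
  have e : mollify (fun _ => (1 : ℝ)) φ = fun _ => ∫ t, φ t := by
    funext x
    rw [mollify_apply]
    simp only [one_smul]
    exact integral_sub_left_eq_self φ volume x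
  have h1 := h.fderiv
  rw [e, fderiv_fun_const, mollify_apply] at h1
  simp only [one_smul, zero_sub, Pi.zero_apply] at h1
  rw [h1, integral_neg_eq_self]

/-- Applied to the kernel itself this compares the mollification with `f`. Applied to its
derivatives, which have integral zero, it bounds the derivatives by the local oscillation of `f`. -/
theorem norm_mollify_sub_le (hf : Continuous f) (hφ : Continuous φ) (hc : HasCompactSupport φ)
    (hsupp : tsupport φ ⊆ Metric.closedBall 0 1) {y : Plane} {ω : ℝ}
    (hω : ∀ z, dist z y ≤ 1 → |f z - f y| ≤ ω) :
    ‖mollify f φ y - f y • ∫ t, φ t‖ ≤ ω * ∫ t, ‖φ t‖ := by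
  have hint := hφ.integrable_of_hasCompactSupport hc (μ := volume)
  have hi : Integrable (fun t => ‖φ (y - t)‖) := hint.norm.comp_sub_left y
  have hω0 : 0 ≤ ω := (abs_nonneg _).trans (hω y (by simp))
  have e1 : f y • ∫ t, φ t = ∫ t, f y • φ (y - t) := by
    rw [integral_smul, integral_sub_left_eq_self φ volume y]
  have hcs : HasCompactSupport fun t => φ (y - t) := hc.comp_homeomorph (Homeomorph.subLeft y)
  have hi1 : Integrable fun t => f t • φ (y - t) :=
    (hf.smul (hφ.comp (continuous_const.sub continuous_id))).integrable_of_hasCompactSupport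
      hcs.smul_left
  have hi2 : Integrable fun t => f y • φ (y - t) := (hint.comp_sub_left y).smul (f y)
  rw [e1, mollify_apply, ← integral_sub hi1 hi2]
  refine (norm_integral_le_of_norm_le (hi.const_mul ω)
    (Filter.Eventually.of_forall fun t => ?_)).trans
    (le_of_eq ?_)
  · rw [← sub_smul, norm_smul, Real.norm_eq_abs]
    by_cases ht : dist t y ≤ 1
    · exact mul_le_mul_of_nonneg_right (hω t ht) (norm_nonneg _)
    · have h0 : φ (y - t) = 0 := by
        refine image_eq_zero_of_notMem_tsupport fun h => ht ?_
        have := hsupp h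
        rwa [mem_closedBall_zero_iff, ← dist_eq_norm, dist_comm] at this
      rw [h0, norm_zero, mul_zero, mul_zero]
  · rw [integral_const_mul, integral_sub_left_eq_self (fun t => ‖φ t‖) volume y]

end Mollify

/-- Smoothing on the unit scale, with derivatives controlled by the local oscillation. -/
theorem exists_mollification : ∃ K : ℝ, 1 ≤ K ∧ ∀ f : Plane → ℝ, Continuous f →
    ∀ B, (∀ x, |f x| ≤ B) → ∃ g : Plane → ℝ, g.HasTemperateGrowth ∧ (∀ x, |g x| ≤ B) ∧
      ∀ y ω, (∀ z, dist z y ≤ 1 → |f z - f y| ≤ ω) →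
        |g y - f y| ≤ ω ∧ ‖fderiv ℝ g y‖ ≤ K * ω ∧ ‖fderiv ℝ (fderiv ℝ g) y‖ ≤ K * ω := by
  let β : ContDiffBump (0 : Plane) := ⟨1 / 2, 1, by norm_num, by norm_num⟩
  set φ : Plane → ℝ := β.normed volume with hφ
  have hs : ContDiff ℝ (⊤ : ℕ∞) φ := β.contDiff_normed
  have hs1 := (contDiff_infty_iff_fderiv.1 hs).2
  have hs2 := (contDiff_infty_iff_fderiv.1 hs1).2
  have hc : HasCompactSupport φ := β.hasCompactSupport_normed
  have hc1 := hc.fderiv ℝ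
  have hc2 := hc1.fderiv ℝ
  have ht : tsupport φ ⊆ Metric.closedBall 0 1 := by rw [hφ, β.tsupport_normed_eq]
  have ht1 : tsupport (fderiv ℝ φ) ⊆ Metric.closedBall 0 1 := (tsupport_fderiv_subset ℝ).trans ht
  have ht2 : tsupport (fderiv ℝ (fderiv ℝ φ)) ⊆ Metric.closedBall 0 1 :=
    (tsupport_fderiv_subset ℝ).trans ht1
  have hone : ∫ t, φ t = 1 := β.integral_normed
  have hnorm : ∫ t, ‖φ t‖ = 1 := by
    rw [← hone]
    exact integral_congr_ae (Filter.Eventually.of_forall fun t =>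
      Real.norm_of_nonneg (β.nonneg_normed t))
  have p1 : 0 ≤ ∫ t, ‖fderiv ℝ φ t‖ := by positivity
  have p2 : 0 ≤ ∫ t, ‖fderiv ℝ (fderiv ℝ φ) t‖ := by positivity
  refine ⟨1 + (∫ t, ‖fderiv ℝ φ t‖) + ∫ t, ‖fderiv ℝ (fderiv ℝ φ) t‖, by linarith,
    fun f hf B hB => ⟨mollify f φ, mollify_hasTemperateGrowth hf hB hs hc, fun x => ?_,
      fun y ω hω => ⟨?_, ?_, ?_⟩⟩⟩
  · have := norm_mollify_le hB hs.continuous hc x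
    rwa [hnorm, mul_one, Real.norm_eq_abs] at this
  · have := norm_mollify_sub_le hf hs.continuous hc ht hω
    rwa [hone, hnorm, smul_eq_mul, mul_one, mul_one, Real.norm_eq_abs] at this
  · have hω0 : 0 ≤ ω := (abs_nonneg _).trans (hω y (by simp))
    have := norm_mollify_sub_le hf hs1.continuous hc1 ht1 hω
    rw [integral_fderiv_eq_zero hs hc, smul_zero, sub_zero,
      ← (hasFDerivAt_mollify hf hs hc y).fderiv] at this
    refine this.trans ?_
    rw [mul_comm]
    exact mul_le_mul_of_nonneg_right (by linarith) hω0
  · have hω0 : 0 ≤ ω := (abs_nonneg _).trans (hω y (by simp))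
    have := norm_mollify_sub_le hf hs2.continuous hc2 ht2 hω
    have e : fderiv ℝ (mollify f φ) = mollify f (fderiv ℝ φ) :=
      funext fun y => (hasFDerivAt_mollify hf hs hc y).fderiv
    rw [integral_fderiv_eq_zero hs1 hc1, smul_zero, sub_zero,
      ← (hasFDerivAt_mollify hf hs1 hc1 y).fderiv, ← e] at this
    refine this.trans ?_
    rw [mul_comm]
    exact mul_le_mul_of_nonneg_right (by linarith) hω0

/-! ### Dilated weights -/

section Dilate

variable {g : Plane → ℝ}

theorem hasFDerivAt_dilate (hg : Differentiable ℝ g) (R : ℝ) (x : Plane) :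
    HasFDerivAt (fun x => ((g (R • x) : ℝ) : ℂ))
      (Complex.ofRealCLM.comp ((fderiv ℝ g (R • x)).comp
        (R • ContinuousLinearMap.id ℝ Plane))) x := by
  have h1 : HasFDerivAt (fun x : Plane => R • x) (R • ContinuousLinearMap.id ℝ Plane) x :=
    (hasFDerivAt_id x).const_smul R
  have h2 := (hg (R • x)).hasFDerivAt.comp x h1
  exact Complex.ofRealCLM.hasFDerivAt.comp x h2

theorem fderiv_dilate_apply (hg : Differentiable ℝ g) (R : ℝ) (x v : Plane) :
    fderiv ℝ (fun x => ((g (R • x) : ℝ) : ℂ)) x v = R * ((fderiv ℝ g (R • x) v : ℝ) : ℂ) := by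
  rw [(hasFDerivAt_dilate hg R x).fderiv]
  simp

theorem norm_fderiv_dilate_le (hg : Differentiable ℝ g) {R : ℝ} (hR : 0 ≤ R) (x : Plane) :
    ‖fderiv ℝ (fun x => ((g (R • x) : ℝ) : ℂ)) x‖ ≤ R * ‖fderiv ℝ g (R • x)‖ := by
  refine ContinuousLinearMap.opNorm_le_bound _ (by positivity) fun v => ?_
  rw [fderiv_dilate_apply hg, norm_mul, Complex.norm_real, Complex.norm_real,
    Real.norm_of_nonneg hR, mul_assoc]
  exact mul_le_mul_of_nonneg_left (ContinuousLinearMap.le_opNorm _ _) hR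

theorem norm_dq_dq_dilate_le (hg : ContDiff ℝ (⊤ : ℕ∞) g) {R : ℝ} (hR : 0 ≤ R) (x : Plane)
    (j : Fin 2) :
    ‖dq j (dq j fun x => ((g (R • x) : ℝ) : ℂ)) x‖ ≤ R ^ 2 * ‖fderiv ℝ (fderiv ℝ g) (R • x)‖ := by
  set e : Plane := EuclideanSpace.single j (1 : ℝ) with he
  have hen : ‖e‖ = 1 := by rw [he, PiLp.norm_single, norm_one]
  have hd := hg.differentiable (by simp)
  have hd1 : Differentiable ℝ (fderiv ℝ g) :=
    (contDiff_infty_iff_fderiv.1 hg).2.differentiable (by simp)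
  set h : Plane → ℝ := fun y => fderiv ℝ g y e with hh
  have hhf : ∀ y, HasFDerivAt h
      ((ContinuousLinearMap.apply ℝ ℝ e).comp (fderiv ℝ (fderiv ℝ g) y)) y :=
    fun y => (ContinuousLinearMap.apply ℝ ℝ e).hasFDerivAt.comp y (hd1 y).hasFDerivAt
  have e1 : dq j (fun x => ((g (R • x) : ℝ) : ℂ)) =
      fun x => (-Complex.I * R) * ((h (R • x) : ℝ) : ℂ) := by
    funext x
    rw [dq, fderiv_dilate_apply hd, mul_assoc]
  have hdh : Differentiable ℝ h := fun y => (hhf y).differentiableAt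
  rw [e1, dq, fderiv_const_mul (hasFDerivAt_dilate hdh R x).differentiableAt, smul_apply,
    fderiv_dilate_apply hdh, (hhf _).fderiv, smul_eq_mul]
  simp only [norm_mul, norm_neg, Complex.norm_I, one_mul, Complex.norm_real, Real.norm_of_nonneg hR,
    ContinuousLinearMap.comp_apply, ContinuousLinearMap.apply_apply]
  have h1 : ‖fderiv ℝ (fderiv ℝ g) (R • x) e e‖ ≤ ‖fderiv ℝ (fderiv ℝ g) (R • x)‖ := by
    have := ContinuousLinearMap.le_opNorm₂ (fderiv ℝ (fderiv ℝ g) (R • x)) e e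
    rwa [hen, mul_one, mul_one] at this
  calc _ = R ^ 2 * ‖fderiv ℝ (fderiv ℝ g) (R • x) e e‖ := by ring
    _ ≤ _ := mul_le_mul_of_nonneg_left h1 (by positivity)

theorem dilate_hasTemperateGrowth (hg : g.HasTemperateGrowth) (R : ℝ) :
    (fun x => ((g (R • x) : ℝ) : ℂ)).HasTemperateGrowth := by
  have h1 : (fun x : Plane => R • x).HasTemperateGrowth :=
    (R • ContinuousLinearMap.id ℝ Plane).hasTemperateGrowth
  exact Complex.ofRealCLM.hasTemperateGrowth.comp (hg.comp h1)

end Dilate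

/-! ### Exponential weights -/

/-- The exponent of the weights: the distance to `Y`, cut off at `D / 4`. -/
def expo (a D : ℝ) (Y : Set Plane) (x : Plane) : ℝ := a * min (Metric.infDist x Y) (D / 4)

theorem abs_expo_sub_le (a D : ℝ) (Y : Set Plane) (x z : Plane) :
    |expo a D Y z - expo a D Y x| ≤ |a| * dist z x := by
  rw [expo, expo, ← mul_sub, abs_mul]
  refine mul_le_mul_of_nonneg_left ?_ (abs_nonneg a)
  refine (abs_min_sub_min_le_max _ _ _ _).trans ?_
  rw [sub_self, abs_zero, max_eq_left (abs_nonneg _), ← Real.dist_eq]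
  simpa using (Metric.lipschitz_infDist_pt Y).dist_le_mul z x

theorem abs_expo_le (a : ℝ) {D : ℝ} (hD : 0 ≤ D) (Y : Set Plane) (x : Plane) :
    |expo a D Y x| ≤ |a| * (D / 4) := by
  rw [expo, abs_mul]
  refine mul_le_mul_of_nonneg_left ?_ (abs_nonneg a)
  rw [abs_of_nonneg (le_min Metric.infDist_nonneg (by positivity))]
  exact min_le_right _ _

/-- Points near the origin are at least `D / 4` away from `Y`, so the cut-off makes the exponent
constant there. The weight must be flat at the origin, where the permitted gradient vanishes. -/
theorem expo_eq {a D : ℝ} {Y : Set Plane} (hne : Y.Nonempty) (hY : ∀ y ∈ Y, D / 2 ≤ ‖y‖)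
    {x : Plane} (hx : ‖x‖ ≤ D / 4) : expo a D Y x = a * (D / 4) := by
  rw [expo, min_eq_right]
  refine (Metric.le_infDist hne).2 fun y hy => ?_
  have h1 := hY y hy
  have h2 := norm_sub_norm_le y x
  rw [← dist_eq_norm, dist_comm] at h2
  linarith

/-- Smooth weights comparable with `exp (expo a D Y)`. -/
theorem exists_isWeight : ∃ K : ℝ, 1 ≤ K ∧ ∀ δ ρ D a : ℝ, 0 < δ → δ ≤ 1 → 0 < ρ → 0 < D →
    1 ≤ ρ * D ^ 2 → |a| = δ * ρ * D → ∀ Y : Set Plane, Y.Nonempty → (∀ y ∈ Y, D / 2 ≤ ‖y‖) →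
    ∃ g, IsWeight (K * δ) ρ g ∧ ∀ x, Real.exp (expo a D Y x) / 2 ≤ g x ∧
      g x ≤ 2 * Real.exp (expo a D Y x) := by
  obtain ⟨K, hK1, hK⟩ := exists_mollification
  refine ⟨2048 * K, by linarith, fun δ ρ D a hδ hδ1 hρ hD hρD ha Y hne hY => ?_⟩
  -- Mollification happens at length `1 / R`: there the exponent varies by at most `δ / 8`, and `ρ
  -- D² ≥ 1` gives `1 / R ≤ D / 8`, so that the ball of radius `D / 8` remains inside the flat
  -- region.
  set R : ℝ := 8 * ρ * D with hR
  have hR0 : 0 < R := by positivity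
  set f : Plane → ℝ := fun y => Real.exp (expo a D Y (R⁻¹ • y)) with hf
  have hexpc : Continuous (expo a D Y) :=
    continuous_const.mul ((Metric.continuous_infDist_pt Y).min continuous_const)
  have hfc : Continuous f := Real.continuous_exp.comp (hexpc.comp (continuous_const_smul R⁻¹))
  have hfB : ∀ y, |f y| ≤ Real.exp (|a| * (D / 4)) := fun y => by
    rw [abs_of_pos (Real.exp_pos _)]
    exact Real.exp_le_exp.2 ((le_abs_self _).trans (abs_expo_le a hD.le Y _))
  obtain ⟨g, hgt, hgB, hg⟩ := hK f hfc _ hfB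
  have hfx : ∀ x, f (R • x) = Real.exp (expo a D Y x) := fun x => by
    rw [hf]
    simp only [smul_smul, inv_mul_cancel₀ hR0.ne', one_smul]
  have hosc : ∀ x z, dist z (R • x) ≤ 1 → |f z - f (R • x)| ≤ δ / 4 * f (R • x) := by
    intro x z hz
    set u := expo a D Y (R⁻¹ • z) - expo a D Y x with hu
    have hu1 : |u| ≤ δ / 8 := by
      refine (abs_expo_sub_le a D Y x (R⁻¹ • z)).trans ?_
      have e : dist (R⁻¹ • z) x = R⁻¹ * dist z (R • x) := by
        have : x = R⁻¹ • (R • x) := by rw [smul_smul, inv_mul_cancel₀ hR0.ne', one_smul]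
        conv_lhs => rw [this]
        rw [dist_smul₀, Real.norm_of_nonneg (inv_pos.2 hR0).le]
      rw [e, ha]
      calc δ * ρ * D * (R⁻¹ * dist z (R • x)) ≤ δ * ρ * D * (R⁻¹ * 1) := by gcongr
        _ = δ / 8 := by rw [hR]; field_simp
    have e : f z - f (R • x) = f (R • x) * (Real.exp u - 1) := by
      rw [hfx, mul_sub, ← Real.exp_add, hu, mul_one, add_sub_cancel]
    have h2 := Real.abs_exp_sub_one_le (x := u) (by linarith)
    rw [e, abs_mul, abs_of_pos (Real.exp_pos _), mul_comm]
    exact mul_le_mul_of_nonneg_right (by linarith) (Real.exp_pos _).le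
  have hosc0 : ∀ x, ‖x‖ < D / 8 → ∀ z, dist z (R • x) ≤ 1 → |f z - f (R • x)| ≤ 0 := by
    intro x hx z hz
    have hz' : ‖R⁻¹ • z‖ ≤ D / 4 := by
      have e : R⁻¹ • z = R⁻¹ • (z - R • x) + x := by
        rw [smul_sub, smul_smul, inv_mul_cancel₀ hR0.ne', one_smul, sub_add_cancel]
      rw [e]
      refine (norm_add_le _ _).trans ?_
      rw [norm_smul, Real.norm_of_nonneg (inv_pos.2 hR0).le, ← dist_eq_norm]
      have h1 : R⁻¹ * dist z (R • x) ≤ R⁻¹ * 1 := by gcongr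
      have h2 : R⁻¹ * 1 ≤ D / 8 := by
        rw [mul_one, inv_le_comm₀ hR0 (by positivity), hR]
        rw [inv_le_iff_one_le_mul₀ (by positivity)]
        nlinarith
      linarith
    rw [hfx, hf]
    simp only
    rw [expo_eq hne hY hz', expo_eq hne hY (by linarith : ‖x‖ ≤ D / 4), sub_self, abs_zero]
  have hcomp : ∀ x, Real.exp (expo a D Y x) / 2 ≤ g (R • x) ∧
      g (R • x) ≤ 2 * Real.exp (expo a D Y x) := by
    intro x
    have h1 := abs_le.1 (hg _ _ (hosc x)).1
    rw [hfx] at h1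
    have hp := Real.exp_pos (expo a D Y x)
    have h2 : δ / 4 * Real.exp (expo a D Y x) ≤ 1 / 4 * Real.exp (expo a D Y x) := by gcongr
    constructor <;> linarith
  have hpos : ∀ x, 0 < g (R • x) := fun x =>
    lt_of_lt_of_le (half_pos (Real.exp_pos _)) (hcomp x).1
  have hdiff : Differentiable ℝ g := hgt.1.differentiable (by simp)
  have hω : ∀ x, K * (δ / 4 * f (R • x)) ≤ K * δ / 2 * g (R • x) := by
    intro x
    have h1 := (hcomp x).1
    have h2 : K * δ / 4 * f (R • x) ≤ K * δ / 4 * (2 * g (R • x)) := by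
      rw [hfx]
      gcongr
      linarith
    linarith
  refine ⟨fun x => g (R • x), ⟨dilate_hasTemperateGrowth hgt R, hpos,
    ⟨_, fun x => (le_abs_self _).trans (hgB _)⟩, fun x => ?_, fun x j => ?_⟩, hcomp⟩
  · refine (norm_fderiv_dilate_le hdiff hR0.le x).trans ?_
    have hgx := hpos x
    rcases lt_or_ge ‖x‖ (D / 8) with hx | hx
    · have h1 := (hg _ _ (hosc0 x hx)).2.1
      rw [mul_zero] at h1
      calc R * ‖fderiv ℝ g (R • x)‖ ≤ R * 0 := by gcongr
        _ ≤ _ := by rw [mul_zero]; positivity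
    -- Away from the flat region `D ≤ 8 ‖x‖`, which converts the slope `δ ρ D` into the permitted `δ
    -- ρ ‖x‖`.
    · have h1 := ((hg _ _ (hosc x)).2.1).trans (hω x)
      calc R * ‖fderiv ℝ g (R • x)‖ ≤ 8 * ρ * D * (K * δ / 2 * g (R • x)) := by gcongr
        _ ≤ 8 * ρ * (8 * ‖x‖) * (K * δ / 2 * g (R • x)) := by
          gcongr
          linarith
        _ ≤ 2048 * K * δ * ρ * ‖x‖ * g (R • x) := by
          have : 0 ≤ K * δ * ρ * ‖x‖ * g (R • x) := by positivity
          linarith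
  · refine (norm_dq_dq_dilate_le hgt.1 hR0.le x j).trans ?_
    have hgx := hpos x
    rcases lt_or_ge ‖x‖ (D / 8) with hx | hx
    · have h1 := (hg _ _ (hosc0 x hx)).2.2
      rw [mul_zero] at h1
      calc R ^ 2 * ‖fderiv ℝ (fderiv ℝ g) (R • x)‖ ≤ R ^ 2 * 0 := by gcongr
        _ ≤ _ := by rw [mul_zero]; positivity
    · have h1 := ((hg _ _ (hosc x)).2.2).trans (hω x)
      calc R ^ 2 * ‖fderiv ℝ (fderiv ℝ g) (R • x)‖ ≤
          (8 * ρ * D) ^ 2 * (K * δ / 2 * g (R • x)) := by gcongr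
        _ ≤ (8 * ρ * (8 * ‖x‖)) ^ 2 * (K * δ / 2 * g (R • x)) := by
          gcongr
          linarith
        _ = 2048 * K * δ * ρ ^ 2 * ‖x‖ ^ 2 * g (R • x) := by ring

/-! ### Off-diagonal decay -/

section Decay

variable {c d : ℝ} {s : Fin 2 → ℝ} {b : ℝ} {ξ a : ℂ} {C η δ ρ : ℝ} {l : ℂ} {g : Plane → ℝ}

theorem setDist_le {S T : Set Plane} {x y : Plane} (hx : x ∈ S) (hy : y ∈ T) :
    setDist S T ≤ dist x y :=
  ciInf_le (f := fun p : S × T => dist (p.1 : Plane) (p.2 : Plane))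
    ⟨0, by rintro _ ⟨p, rfl⟩; exact dist_nonneg⟩ (⟨x, hx⟩, ⟨y, hy⟩)

/-- An infimum over an empty family of reals is `0` by convention, so positivity of the distance
excludes empty sets. -/
theorem nonempty_of_setDist_pos {S T : Set Plane} (h : 0 < setDist S T) :
    S.Nonempty ∧ T.Nonempty := by
  rcases isEmpty_or_nonempty (S × T) with he | ⟨⟨⟨x, hx⟩, ⟨y, hy⟩⟩⟩
  · rw [setDist, Real.iInf_of_isEmpty] at h
    exact absurd h (lt_irrefl _)
  · exact ⟨⟨x, hx⟩, ⟨y, hy⟩⟩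

theorem one_le_mul_sq {D : ℝ} (hρ : 0 < ρ) (h : ρ ^ (-(1 / 2) : ℝ) < D) :
    0 < D ∧ 1 ≤ ρ * D ^ 2 := by
  have hD : 0 < D := (Real.rpow_pos_of_pos hρ _).trans h
  refine ⟨hD, ?_⟩
  have h1 : (ρ ^ (-(1 / 2) : ℝ)) ^ 2 ≤ D ^ 2 := by
    have := (Real.rpow_pos_of_pos hρ (-(1 / 2) : ℝ)).le
    gcongr
  rw [← Real.rpow_natCast, ← Real.rpow_mul hρ.le] at h1
  norm_num at h1
  rw [Real.rpow_neg_one] at h1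
  calc 1 = ρ * ρ⁻¹ := (mul_inv_cancel₀ hρ.ne').symm
    _ ≤ ρ * D ^ 2 := by gcongr

/-- A weight that is small on `T` relative to `S`. -/
theorem exists_separating_weight {K : ℝ} (hw : ∀ δ ρ D a : ℝ, 0 < δ → δ ≤ 1 → 0 < ρ → 0 < D →
      1 ≤ ρ * D ^ 2 → |a| = δ * ρ * D → ∀ Y : Set Plane, Y.Nonempty → (∀ y ∈ Y, D / 2 ≤ ‖y‖) →
      ∃ g, IsWeight (K * δ) ρ g ∧ ∀ x, Real.exp (expo a D Y x) / 2 ≤ g x ∧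
        g x ≤ 2 * Real.exp (expo a D Y x))
    (hδ : 0 < δ) (hδ1 : δ ≤ 1) (hρ : 0 < ρ) {S T : Set Plane}
    (hST : ρ ^ (-(1 / 2) : ℝ) < setDist S T) :
    ∃ g m M, IsWeight (K * δ) ρ g ∧ 0 < m ∧ 0 < M ∧ (∀ x ∈ S, m ≤ g x) ∧ (∀ x ∈ T, g x ≤ M) ∧
      M / m = 4 * Real.exp (-(δ / 4) * ρ * setDist S T ^ 2) := by
  set D := setDist S T with hD
  obtain ⟨hD0, hρD⟩ := one_le_mul_sq hρ hST
  obtain ⟨hS, hT⟩ := nonempty_of_setDist_pos hD0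
  have hpos : 0 < δ * ρ * D := by positivity
  -- If `T` comes within `D / 2` of the origin, then `S` does not. The distance is measured to
  -- whichever set is far away, with the sign of the slope chosen so that the weight is larger on
  -- `S`.
  by_cases hfar : ∀ y ∈ T, D / 2 ≤ ‖y‖
  · obtain ⟨g, hg, hgx⟩ := hw δ ρ D (δ * ρ * D) hδ hδ1 hρ hD0 hρD (abs_of_pos hpos) T hT hfar
    refine ⟨g, Real.exp (δ * ρ * D * (D / 4)) / 2, 2, hg, by positivity, by norm_num,
      fun x hx => ?_, fun x hx => ?_, ?_⟩
    · have e : expo (δ * ρ * D) D T x = δ * ρ * D * (D / 4) := by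
        rw [expo, min_eq_right]
        have := (Metric.le_infDist hT).2 fun y hy => setDist_le hx hy
        linarith
      rw [← e]
      exact (hgx x).1
    · have e : expo (δ * ρ * D) D T x = 0 := by
        rw [expo, Metric.infDist_zero_of_mem hx, min_eq_left (by positivity), mul_zero]
      have := (hgx x).2
      rwa [e, Real.exp_zero, mul_one] at this
    · rw [show -(δ / 4) * ρ * D ^ 2 = -(δ * ρ * D * (D / 4)) by ring, Real.exp_neg]
      field_simp
      norm_num
  · push Not at hfar
    obtain ⟨y, hy, hyD⟩ := hfar
    have hfar' : ∀ x ∈ S, D / 2 ≤ ‖x‖ := by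
      intro x hx
      have h1 : D ≤ dist x y := setDist_le hx hy
      rw [dist_eq_norm] at h1
      linarith [norm_sub_le x y]
    obtain ⟨g, hg, hgx⟩ := hw δ ρ D (-(δ * ρ * D)) hδ hδ1 hρ hD0 hρD
      (by rw [abs_neg, abs_of_pos hpos]) S hS hfar'
    refine ⟨g, 1 / 2, 2 * Real.exp (-(δ * ρ * D * (D / 4))), hg, by norm_num, by positivity,
      fun x hx => ?_, fun x hx => ?_, ?_⟩
    · have e : expo (-(δ * ρ * D)) D S x = 0 := by
        rw [expo, Metric.infDist_zero_of_mem hx, min_eq_left (by positivity), mul_zero]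
      have := (hgx x).1
      rwa [e, Real.exp_zero] at this
    · have e : expo (-(δ * ρ * D)) D S x = -(δ * ρ * D * (D / 4)) := by
        rw [expo, min_eq_right, neg_mul]
        have := (Metric.le_infDist hS).2 fun y hy => (setDist_le hy hx).trans (dist_comm y x).le
        linarith
      rw [← e]
      exact (hgx x).2
    · rw [show -(δ / 4) * ρ * D ^ 2 = -(δ * ρ * D * (D / 4)) by ring]
      ring

/-- Decay from a weighted estimate. -/
theorem IsGood.norm_cutoff_comp_le (h : IsGood c d s b ξ a C η l) (hC : 0 < C)
    (hg : IsWeight δ ρ g)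
    (hest : ∀ w, ‖l‖ * size c d s l (wOp g w) ≤
      C * ‖toL2 (wOp g (hamS c d s b l w - (l * spec s b ξ a l) • w))‖)
    {R : L2Plane →L[ℂ] L2Plane} {A : 𝓢(Plane, ℂ) → 𝓢(Plane, ℂ)}
    (hR : ∀ w, R (shifted c d s b ξ a l w) = toL2 (A w)) {K : ℝ} (hK0 : 0 ≤ K)
    (hA : ∀ w, ‖toL2 (wOp g (A w))‖ ≤ K * size c d s l (wOp g w)) {S T : Set Plane}
    (hS : MeasurableSet S) (hT : MeasurableSet T) {m M : ℝ} (hm : 0 < m) (hM : 0 < M)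
    (hgS : ∀ x ∈ S, m ≤ g x) (hgT : ∀ x ∈ T, g x ≤ M) :
    ‖cutoff S hS ∘L R ∘L cutoff T hT‖ ≤ K * (C * ‖l‖⁻¹) * (M / m) := by
  have hn : 0 < ‖l‖ := zero_lt_one.trans_le h.one_le
  obtain ⟨B, hB⟩ := hg.bdd
  have hB0 : 0 < B := (hg.pos 0).trans_le (hB 0)
  refine ContinuousLinearMap.opNorm_le_bound _ (by positivity) fun f => ?_
  set F := cutoff T hT f with hF
  have hFn : ‖F‖ ≤ ‖f‖ := norm_cutoffFun_le T hT f
  have hcut : ∀ u : 𝓢(Plane, ℂ), ‖cutoff S hS (toL2 u)‖ ≤ m⁻¹ * ‖toL2 (wOp g u)‖ := by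
    intro u
    have h1 := norm_le_sum_of_ae_le (Finset.univ : Finset (Fin 1)) (u := cutoff S hS (toL2 u))
      (v := fun _ => toL2 (wOp g u)) (A := fun _ => m⁻¹) (fun _ => by positivity) (by
        filter_upwards [cutoffFun_coe S hS (toL2 u), u.coeFn_toLp 2 volume,
          (wOp g u).coeFn_toLp 2 volume] with x h1 h2 h3
        rw [Fin.sum_univ_one, toL2_apply (wOp g u), h3, hg.norm_wOp_apply]
        change ‖cutoffFun S hS (toL2 u) x‖ ≤ _
        rw [h1]
        by_cases hx : x ∈ S
        · rw [Set.indicator_of_mem hx, toL2_apply, h2, ← mul_assoc]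
          refine le_mul_of_one_le_left (norm_nonneg _) ?_
          rw [inv_mul_eq_div, one_le_div hm]
          exact hgS x hx
        · rw [Set.indicator_of_notMem hx, norm_zero]
          have := (hg.pos x).le
          positivity)
    rwa [Fin.sum_univ_one] at h1
  have hsrc : ∀ u : 𝓢(Plane, ℂ), ‖toL2 (wOp g u)‖ ≤ B * ‖toL2 u - F‖ + M * ‖F‖ := by
    intro u
    have h1 := norm_le_sum_of_ae_le (Finset.univ : Finset (Fin 2)) (u := toL2 (wOp g u))
      (v := ![toL2 u - F, F]) (A := ![B, M]) (fun i => by fin_cases i <;> simp <;> positivity) (by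
        filter_upwards [cutoffFun_coe T hT f, u.coeFn_toLp 2 volume,
          (wOp g u).coeFn_toLp 2 volume, Lp.coeFn_sub (toL2 u) F] with x h1 h2 h3 h4
        simp only [Fin.sum_univ_two, Matrix.cons_val_zero, Matrix.cons_val_one]
        change F x = _ at h1
        have h5 : ‖u x‖ ≤ ‖u x - F x‖ + ‖F x‖ := by
          have := norm_add_le (u x - F x) (F x)
          rwa [sub_add_cancel] at this
        rw [toL2_apply (wOp g u), h3, hg.norm_wOp_apply, h4, Pi.sub_apply, toL2_apply, h2]
        have h6 : g x * ‖F x‖ ≤ M * ‖F x‖ := by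
          by_cases hx : x ∈ T
          · exact mul_le_mul_of_nonneg_right (hgT x hx) (norm_nonneg _)
          · rw [h1, Set.indicator_of_notMem hx, norm_zero, mul_zero, mul_zero]
        calc g x * ‖u x‖ ≤ g x * (‖u x - F x‖ + ‖F x‖) :=
              mul_le_mul_of_nonneg_left h5 (hg.pos x).le
          _ = g x * ‖u x - F x‖ + g x * ‖F x‖ := mul_add _ _ _
          _ ≤ _ := add_le_add (mul_le_mul_of_nonneg_right (hB x) (norm_nonneg _)) h6)
    rwa [Fin.sum_univ_two] at h1
  -- The cut-off source `F` need not be in the range on Schwartz functions. The inequality is proved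
  -- on the dense range with an error term `B * ‖u - F‖`, extended by continuity, and evaluated at
  -- `u = F`; the crude bound `B` of the weight disappears.
  have key : ∀ u : L2Plane, ‖cutoff S hS (R u)‖ ≤
      m⁻¹ * (K * (C * ‖l‖⁻¹ * (B * ‖u - F‖ + M * ‖F‖))) := by
    intro u
    refine h.dense.induction_on (p := fun u => ‖cutoff S hS (R u)‖ ≤
      m⁻¹ * (K * (C * ‖l‖⁻¹ * (B * ‖u - F‖ + M * ‖F‖)))) u
      (isClosed_le (by fun_prop) (by fun_prop)) fun w => ?_
    rw [hR]
    refine (hcut (A w)).trans (mul_le_mul_of_nonneg_left ((hA w).trans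
      (mul_le_mul_of_nonneg_left ?_ hK0)) (by positivity))
    have h1 := (hest w).trans (mul_le_mul_of_nonneg_left (hsrc _) hC.le)
    rw [mul_comm, ← le_div_iff₀ hn] at h1
    refine h1.trans (le_of_eq ?_)
    rw [shifted_apply]
    ring
  have h1 := key F
  rw [sub_self, norm_zero, mul_zero, zero_add] at h1
  change ‖cutoff S hS (R F)‖ ≤ _
  refine h1.trans ?_
  calc m⁻¹ * (K * (C * ‖l‖⁻¹ * (M * ‖F‖))) ≤ m⁻¹ * (K * (C * ‖l‖⁻¹ * (M * ‖f‖))) := by gcongr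
    _ = _ := by rw [div_eq_mul_inv]; ring

/-- Off-diagonal decay of the resolvent and of its derivatives. -/
theorem exists_decay (hcd : c ^ 2 + d ^ 2 = 1) (hs : ∀ j, 0 < s j) (hC : 0 < C) (hη : 0 < η) :
    ∃ c' : ℝ, 0 < c' ∧ ∃ C' : ℝ, 0 < C' ∧ ∀ b, 0 < b → b ≤ 1 → ∀ ξ a l : ℂ,
      IsGood c d s b ξ a C η l → ∀ (S T : Set Plane) (hS : MeasurableSet S) (hT : MeasurableSet T),
      ‖l‖ ^ (-(1 / 2) : ℝ) < setDist S T →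
      ‖cutoff S hS ∘L resolventOp c d s b ξ a l ∘L cutoff T hT‖ ≤
        C' * Real.exp (-c' * ‖l‖ * setDist S T ^ 2) ∧
      ∀ (j : Fin 2) (R : L2Plane →L[ℂ] L2Plane),
        (∀ w, R (shifted c d s b ξ a l w) = toL2 (momentum j w)) →
        ‖cutoff S hS ∘L R ∘L cutoff T hT‖ ≤
          C' * Real.exp (-c' * ‖l‖ * setDist S T ^ 2) := by
  obtain ⟨K₁, hK₁, hw⟩ := exists_isWeight
  have h0 := hs 0
  have h1 := hs 1
  set K := 1 + (s 0)⁻¹ + (s 1)⁻¹ with hKdef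
  have p0 : 0 < (s 0)⁻¹ := inv_pos.2 h0
  have p1 : 0 < (s 1)⁻¹ := inv_pos.2 h1
  have hK1 : 1 ≤ K := by linarith
  have hK : ∀ j, (s j)⁻¹ ≤ K := fun j => by
    fin_cases j
    · simp only [Fin.zero_eta]; linarith
    · simp only [Fin.mk_one]; linarith
  -- The weights have parameter `K₁ * δ`: the first bound keeps it below `1`, the second keeps the
  -- commutator within the tolerance `η`.
  set δ := min (1 / K₁) (η / (68 * K ^ 2 * K₁)) with hδdef
  have hδ : 0 < δ := by positivity
  have hKδ : K₁ * δ ≤ 1 := by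
    calc K₁ * δ ≤ K₁ * (1 / K₁) := by gcongr; exact min_le_left _ _
      _ = 1 := by field_simp
  have hδ1 : δ ≤ 1 := by nlinarith
  have hKη : 68 * K ^ 2 * (K₁ * δ) ≤ η := by
    calc 68 * K ^ 2 * (K₁ * δ) ≤ 68 * K ^ 2 * (K₁ * (η / (68 * K ^ 2 * K₁))) := by
          gcongr; exact min_le_right _ _
      _ = η := by field_simp
  refine ⟨δ / 4, by positivity, 16 * K * C, by positivity, ?_⟩
  intro b hb0 hb1 ξ a l h S T hS hT hST
  have hn : 0 < ‖l‖ := zero_lt_one.trans_le h.one_le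
  obtain ⟨g, m, M, hg, hm, hM, hgS, hgT, hMm⟩ := exists_separating_weight hw hδ hδ1 hn hST
  have hest := h.size_wOp_le hg (by positivity) hKδ hcd hs hK1 hK hb0.le hb1 hKη
  have hinv : ‖l‖⁻¹ ≤ 1 := inv_le_one_of_one_le₀ h.one_le
  have hexp := Real.exp_pos (-(δ / 4) * ‖l‖ * setDist S T ^ 2)
  constructor
  · have h2 := h.norm_cutoff_comp_le hC hg hest (A := id) (h.resolventOp_shifted hη)
      zero_le_one (fun w => by
        rw [one_mul]
        exact (norm_le_norm2 toL2 _ _ _).1) hS hT hm hM hgS hgT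
    rw [hMm] at h2
    refine h2.trans ?_
    calc 1 * (C * ‖l‖⁻¹) * (4 * Real.exp (-(δ / 4) * ‖l‖ * setDist S T ^ 2)) ≤
        1 * (C * 1) * (4 * Real.exp (-(δ / 4) * ‖l‖ * setDist S T ^ 2)) := by gcongr
      _ = 1 * (4 * C) * Real.exp (-(δ / 4) * ‖l‖ * setDist S T ^ 2) := by ring
      _ ≤ (4 * K) * (4 * C) * Real.exp (-(δ / 4) * ‖l‖ * setDist S T ^ 2) := by
        gcongr
        linarith
      _ = _ := by ring
  · intro j R hR
    have h2 := h.norm_cutoff_comp_le hC hg hest (A := fun w => momentum j w) hR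
      (K := 4 * K * √‖l‖) (by positivity) (fun w => by
        rw [mul_assoc (4 * K)]
        exact hg.norm_wOp_momentum_le (by positivity) hKδ hcd hs hK1 hK h.one_le j w)
      hS hT hm hM hgS hgT
    rw [hMm] at h2
    refine h2.trans ?_
    -- A momentum costs `√‖l‖`, which the factor `‖l‖⁻¹` of the resolvent pays for because `‖l‖ ≥
    -- 1`.
    have h3 : √‖l‖ * ‖l‖⁻¹ ≤ 1 := by
      rw [← div_eq_mul_inv, div_le_one hn]
      exact Real.sqrt_le_iff.2 ⟨hn.le, by nlinarith [h.one_le]⟩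
    calc 4 * K * √‖l‖ * (C * ‖l‖⁻¹) * (4 * Real.exp (-(δ / 4) * ‖l‖ * setDist S T ^ 2)) =
        (√‖l‖ * ‖l‖⁻¹) * (16 * K * C * Real.exp (-(δ / 4) * ‖l‖ * setDist S T ^ 2)) := by ring
      _ ≤ 1 * (16 * K * C * Real.exp (-(δ / 4) * ‖l‖ * setDist S T ^ 2)) := by gcongr
      _ = _ := one_mul _

end Decay

end MHO

end

/-! ### The proposition -/

theorem propositionF1 (M : Matrix (Fin 2) (Fin 2) ℝ) (hM : M.PosDef)
    (ε : ℝ) (hε : ε ∈ Set.Ioo 0 (Real.pi / 2)) :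
    ∃ L₀ : ℝ, 0 < L₀ ∧ ∃ bmax : ℝ, 0 < bmax ∧ ∃ C : ℝ, 0 < C ∧ ∃ c : ℝ, 0 < c ∧
      ∀ L : ℝ, L₀ ≤ L → ∀ b : ℝ, b ∈ Set.Ioo 0 bmax → ∀ ξ : ℂ, ‖ξ‖ = 1 →
      -- the spectral parameter is `z_l` itself (`σ = 0`) or `z_l + l² = μ l` (`σ = 1`)
      ∀ σ : ℂ, (σ = 0 ∨ σ = 1) →
        -- for real `l` the spectral parameter is at distance of order `l` from the eigenvalues
        (∀ l : ℝ, L < l → ∀ (E : ℝ) (u : L2Plane),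
          MHO.IsEigenvector (MHO.oscillator M b l) E u →
            c * l ≤ ‖MHO.zParam M b ξ l + σ * (l : ℂ) ^ 2 - (E : ℂ)‖) ∧
        -- the analytic continuation of the resolvent and its bounds
        ∃ R : ℂ → (L2Plane →L[ℂ] L2Plane),
          AnalyticOnNhd ℂ R (MHO.wedge L ε) ∧
          (∀ l : ℝ, L < l →
            MHO.IsResolvent (MHO.oscillator M b l)
              (MHO.zParam M b ξ l + σ * (l : ℂ) ^ 2) (R l)) ∧
          (∀ l ∈ MHO.wedge L ε, ‖R l‖ ≤ C * ‖l‖⁻¹) ∧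
          (∀ l ∈ MHO.wedge L ε, ∀ (S T : Set Plane) (hS : MeasurableSet S) (hT : MeasurableSet T),
            ‖l‖ ^ (-(1 / 2) : ℝ) < MHO.setDist S T →
              ‖MHO.cutoff S hS ∘L R l ∘L MHO.cutoff T hT‖ ≤
                C * Real.exp (-c * ‖l‖ * MHO.setDist S T ^ 2)) ∧
          -- `D = P_j R(l)`
          (∀ l ∈ MHO.wedge L ε, ∀ j : Fin 2, ∃ D : L2Plane →L[ℂ] L2Plane,
            (∀ f : L2Plane, MHO.Acts (MHO.momentum j) (R l f) (D f)) ∧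
            ∀ (S T : Set Plane) (hS : MeasurableSet S) (hT : MeasurableSet T),
              ‖l‖ ^ (-(1 / 2) : ℝ) < MHO.setDist S T →
                ‖MHO.cutoff S hS ∘L D ∘L MHO.cutoff T hT‖ ≤
                  C * Real.exp (-c * ‖l‖ * MHO.setDist S T ^ 2)) := by
  obtain ⟨c, d, s, hF⟩ := MHO.exists_isFrame hM
  have hs := hF.pos
  have hσ : 0 < min (s 0) (s 1) := lt_min (hs 0) (hs 1)
  have hσs : ∀ j, min (s 0) (s 1) ≤ s j := fun j => by
    fin_cases j
    exacts [min_le_left _ _, min_le_right _ _]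
  set c₀ := Real.sin ε with hc₀def
  have hc₀ : 0 < c₀ := Real.sin_pos_of_pos_of_lt_pi hε.1 (by linarith [hε.2, Real.pi_pos])
  have hc₁ : c₀ ≤ 1 := Real.sin_le_one ε
  obtain ⟨L₀, hL₀, β, hβ, C, hC, η, hη, hmain⟩ := MHO.exists_estimate hF.unit hs hc₀ hc₁
  obtain ⟨c', hc', C', hC', hdecay⟩ := MHO.exists_decay hF.unit hs hC hη
  -- The value `1 / C` inside the constant `c` is the distance to the eigenvalues obtained from the
  -- resolvent bound `C / l`. The third bound on `b` allows the explicit formulas for `e₀` and `e₁`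
  -- to be used.
  refine ⟨max L₀ 1, by positivity, min (min β 1) (c₀ * min (s 0) (s 1)), by positivity,
    max C C', by positivity, min c' (1 / C), by positivity, ?_⟩
  intro L hL b hb ξ hξ σ hσ01
  have hb0 : 0 < b := hb.1
  have hb' := hb.2
  simp only [lt_min_iff] at hb'
  obtain ⟨⟨hbβ, hb1⟩, hbσ⟩ := hb'
  have hL1 : 1 ≤ L := (le_max_right _ _).trans hL
  have hLL : L₀ ≤ L := (le_max_left _ _).trans hL
  -- Kept general in `ξ`, since the resolvent identity also uses the conjugate of `ξ`.
  have hgood : ∀ ξ : ℂ, ‖ξ‖ = 1 → ∀ l : ℂ, L < ‖l‖ → c₀ * ‖l‖ ≤ l.re →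
      MHO.IsGood c d s b ξ σ C η l := by
    intro ξ hξ l hl hre
    obtain ⟨h1, h2⟩ := hmain b hb0 hbβ ξ hξ σ hσ01 l (hLL.trans hl.le) hre
    exact ⟨hL1.trans hl.le, h1, h2⟩
  have hwedge : ∀ l ∈ MHO.wedge L ε, MHO.IsGood c d s b ξ σ C η l := fun l hl =>
    hgood ξ hξ l hl.1 (MHO.sin_mul_norm_le_re hε hl)
  have hnorm : ∀ l : ℝ, L < l → ‖(l : ℂ)‖ = l := fun l hl => by
    rw [Complex.norm_real, Real.norm_of_nonneg (by linarith)]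
  have hreal : ∀ ξ : ℂ, ‖ξ‖ = 1 → ∀ l : ℝ, L < l → MHO.IsGood c d s b ξ σ C η l := by
    intro ξ hξ l hl
    refine hgood ξ hξ l (by rwa [hnorm l hl]) ?_
    rw [hnorm l hl, Complex.ofReal_re]
    exact mul_le_of_le_one_left (by linarith) hc₁
  have hz := MHO.zParam_eq hF hσ hσs hb0 hc₀ hc₁ hbσ.le ξ σ
  have hres : ∀ l : ℝ, L < l → MHO.IsResolvent (MHO.oscillator M b l)
      (MHO.zParam M b ξ l + σ * (l : ℂ) ^ 2) (MHO.resolventOp c d s b ξ σ l) := by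
    intro l hl
    rw [hz]
    exact MHO.isResolvent_resolventOp hF hσ01 hη (hreal ξ hξ l hl)
      (hreal _ (by rw [RCLike.norm_conj, hξ]) l hl)
  have hexp : ∀ (l : ℂ) (S T : Set Plane),
      C' * Real.exp (-c' * ‖l‖ * MHO.setDist S T ^ 2) ≤
        max C C' * Real.exp (-min c' (1 / C) * ‖l‖ * MHO.setDist S T ^ 2) := by
    intro l S T
    gcongr
    · exact le_max_right _ _
    · exact min_le_left _ _
  refine ⟨fun l hl E u hu => ?_, MHO.resolventOp c d s b ξ σ,
    MHO.analyticAt_resolventOp hF.unit hs hη (MHO.isOpen_wedge L ε hε.1 (by linarith)) hwedge,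
    hres, fun l hl => ?_, fun l hl S T hS hT hST => ?_, fun l hl j => ?_⟩
  · have hl0 : 0 < l := by linarith
    have h1 := MHO.le_norm_sub_of_isEigenvector (hres l hl)
      ((hreal ξ hξ l hl).norm_resolventOp_le hη hC) hu
    rw [hnorm l hl, mul_assoc, mul_comm C, ← div_le_iff₀ hC, inv_mul_eq_div, le_div_iff₀ hl0] at h1
    exact (mul_le_mul_of_nonneg_right (min_le_right _ _) hl0.le).trans h1
  · refine ((hwedge l hl).norm_resolventOp_le hη hC).trans ?_
    gcongr
    exact le_max_left _ _
  · exact ((hdecay b hb0 hb1.le ξ σ l (hwedge l hl) S T hS hT hST).1).trans (hexp l S T)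
  · obtain ⟨D, hD, hDacts⟩ := (hwedge l hl).exists_momentum_resolvent hη hC hF.unit j
    refine ⟨D, hDacts, fun S T hS hT hST => ?_⟩
    exact ((hdecay b hb0 hb1.le ξ σ l (hwedge l hl) S T hS hT hST).2 j D hD).trans (hexp l S T)
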